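/- Let $G$ be a noncompact connected Lie group with Lie algebra $\mathfrak g$ (identified with the left-invariant vector fields on $G$), let $\mu$ be a left Haar measure on $G$, let $\langle\cdot,\cdot\rangle$ be a scalar product on $\mathfrak g$, and let $\mathcal H\subseteq\mathfrak g$ be a linear subspace which generates $\mathfrak g$ as a Lie algebra. Let $d$ be the associated left-invariant Carnot--Carathéodory distance: $d(x,y)=\inf_\gamma\int_0^1|\gamma'(t)|\,dt$, where $\gamma$ runs through the absolutely continuous curves $\gamma\colon[0,1]\to G$ from $x$ to $y$ such that $\gamma'(t)\in\mathcal H_{\gamma(t)}=\{X_{\gamma(t)}: X\in\mathcal H\}$ for almost every $t$, and $|X_x|=\langle X,X\rangle^{1/2}$ for $X\in\mathcal H$, $x\in G$. Balls $B=B(x,r)$, $r>0$, are open balls with respect to $d$, and $\lambda B=B(x,\lambda r)$. For $R>0$ let $\mathcal B_R$ be the set of all balls of radius at most $R$. Let $R>0$ and let $w\in L^1_{\mathrm{loc}}(\mu)$ be a non-negative function which is not almost everywhere $0$. Let $\mu_w$ be the measure with density $w$ with respect to $\mu$. Consider the following conditions. (1) There are $\varepsilon,\delta\in(0,1)$ such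 that, for every $B\in\mathcal B_R$ and every Borel subset $F$ of $B$, $$\mu(F)\le\varepsilon\mu(B)\implies\mu_w(F)\le\delta\mu_w(B).$$ (2) There are $p\in[1,\infty)$ and $C>0$ such that, for every $B\in\mathcal B_R$ with $\mu_w(B)>0$ and every Borel subset $F$ of $B$, $$\frac{\mu_w(F)}{\mu_w(B)}\ge C\Big(\frac{\mu(F)}{\mu(B)}\Big)^p.$$ (3) There are $p\in(1,\infty)$ and $C>0$ such that, for every $B\in\mathcal B_R$, with $p'=p/(p-1)$ and with the conventions $0^{-s}=\infty$ for $s>0$ and $0\cdot\infty=0$, $$\Big(\frac1{\mu(B)}\int_B w\,d\mu\Big)\Big(\frac1{\mu(B)}\int_B w^{-p'/p}\,d\mu\Big)^{p/p'}\le C.$$ (4) There are $\delta,c>0$ such that, for every $B\in\mathcal B_R$, $$\mu\Big(\Big\{x\in B: w(x)\ge\delta\frac1{\mu(B)}\int_B w\,d\mu\Big\}\Big)\ge c\,\mu(B).$$ Then (4) implies (1), (3) implies (2), (2) implies (1), and (3) implies (4). If, moreover, there is a constant $C>0$ such that $\mu_w(5B)\le C\mu_w(B)$ for every $B\in\mathcal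 B_R$, then conditions (1)--(4) are equivalent. -/

import Mathlib

open Set MeasureTheory
open scoped Manifold ContDiff ENNReal

/-- Over the reals, the smoothness required for the Lie algebra structure on the tangent space at
the identity is finite, so that smooth Lie groups have it. -/
instance instLEInftyMinSmoothnessReal : ENat.LEInfty (minSmoothness ℝ 3) :=
  ⟨by
    rw [minSmoothness_of_isRCLikeNormedField]
    exact ENat.LEInfty.out⟩

namespace SubRiemannian

noncomputable section

variable {n : ℕ} {G : Type*} [TopologicalSpace G] [ChartedSpace (EuclideanSpace ℝ (Fin n)) G]

/-- Absolute continuity on `[0, 1]` of a curve in a manifold: the curve is continuous, and its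
reading in each preferred chart is absolutely continuous on each subinterval which the curve maps
into the domain of that chart. -/
def IsAbsContCurve (n : ℕ) {G : Type*} [TopologicalSpace G]
    [ChartedSpace (EuclideanSpace ℝ (Fin n)) G] (γ : ℝ → G) : Prop :=
  ContinuousOn γ (Icc 0 1) ∧
    ∀ (x : G) (a b : ℝ), 0 ≤ a → a ≤ b → b ≤ 1 →
      MapsTo γ (Icc a b) (chartAt (EuclideanSpace ℝ (Fin n)) x).source →
      AbsolutelyContinuousOnInterval (fun t => chartAt (EuclideanSpace ℝ (Fin n)) x (γ t)) a b

/-- The velocity `γ'(t)` (it is `0` if `γ` is not differentiable at `t`). -/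
def velocity (n : ℕ) {G : Type*} [TopologicalSpace G]
    [ChartedSpace (EuclideanSpace ℝ (Fin n)) G] (γ : ℝ → G) (t : ℝ) : TangentSpace (𝓡 n) (γ t) :=
  mfderiv 𝓘(ℝ, ℝ) (𝓡 n) γ t (1 : ℝ)

variable [Group G]

/-- The left-invariant distribution `{X_x : X ∈ 𝓗}` generated by a subspace `𝓗` of the Lie algebra. -/
def distribution (𝓗 : Submodule ℝ (GroupLieAlgebra (𝓡 n) G)) (x : G) :
    Set (TangentSpace (𝓡 n) x) :=
  {v | ∃ X ∈ 𝓗, v = mulInvariantVectorField X x}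

/-- The left-invariant norm on tangent vectors: `v ∈ T_x G` is moved to the identity by the
differential of the left translation by `x⁻¹`, and measured there with the scalar product `Q`. -/
def tangentNorm (Q : LinearMap.BilinForm ℝ (GroupLieAlgebra (𝓡 n) G)) (x : G)
    (v : TangentSpace (𝓡 n) x) : ℝ :=
  let X : GroupLieAlgebra (𝓡 n) G := mfderiv (𝓡 n) (𝓡 n) (fun y : G => x⁻¹ * y) x v
  Real.sqrt (Q X X)

/-- The set of horizontal curves from `x` to `y`. -/
def horizontalCurves (𝓗 : Submodule ℝ (GroupLieAlgebra (𝓡 n) G)) (x y : G) : Set (ℝ → G) :=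
  {γ | IsAbsContCurve n γ ∧ γ 0 = x ∧ γ 1 = y ∧
    ∀ᵐ t ∂(volume.restrict (Icc (0 : ℝ) 1)),
      MDifferentiableAt 𝓘(ℝ, ℝ) (𝓡 n) γ t ∧ velocity n γ t ∈ distribution 𝓗 (γ t)}

/-- The length of a curve parametrized by `[0, 1]`. -/
def curveLength (Q : LinearMap.BilinForm ℝ (GroupLieAlgebra (𝓡 n) G)) (γ : ℝ → G) : ℝ≥0∞ :=
  ∫⁻ t in Icc (0 : ℝ) 1, ENNReal.ofReal (tangentNorm Q (γ t) (velocity n γ t))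

/-- The Carnot–Carathéodory distance. -/
def ccDist (𝓗 : Submodule ℝ (GroupLieAlgebra (𝓡 n) G))
    (Q : LinearMap.BilinForm ℝ (GroupLieAlgebra (𝓡 n) G)) (x y : G) : ℝ≥0∞ :=
  ⨅ γ ∈ horizontalCurves 𝓗 x y, curveLength Q γ

/-- The open ball `B(x, r)` for the Carnot–Carathéodory distance. -/
def ccBall (𝓗 : Submodule ℝ (GroupLieAlgebra (𝓡 n) G))
    (Q : LinearMap.BilinForm ℝ (GroupLieAlgebra (𝓡 n) G)) (x : G) (r : ℝ) : Set G :=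
  {y | ccDist 𝓗 Q x y < ENNReal.ofReal r}

end

end SubRiemannian

namespace LocalMuckenhoupt

noncomputable section

/- In this section `ball x r` is the ball of centre `x` and radius `r`, `μ` is the reference measure
and `w` the weight. -/
variable {G : Type*} [MeasurableSpace G]

/-- The measure `μ_w` with density `w` with respect to `μ`. -/
def weightMeasure (μ : Measure G) (w : G → ℝ) : Measure G :=
  μ.withDensity (fun x => ENNReal.ofReal (w x))

/-- Sets that are small for `μ` are not almost everything for `μ_w`, uniformly on the balls of radius
at most `R`. -/
def Cond1 (ball : G → ℝ → Set G) (μ : Measure G) (w : G → ℝ) (R : ℝ) : Prop :=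
  ∃ ε ∈ Ioo (0 : ℝ) 1, ∃ δ ∈ Ioo (0 : ℝ) 1, ∀ (x : G) (r : ℝ), 0 < r → r ≤ R →
    ∀ F : Set G, MeasurableSet F → F ⊆ ball x r →
      μ F ≤ ENNReal.ofReal ε * μ (ball x r) →
        weightMeasure μ w F ≤ ENNReal.ofReal δ * weightMeasure μ w (ball x r)

/-- Power lower bound of `μ_w` in terms of `μ` on the balls of radius at most `R`. The inequality is required on the balls of positive `μ_w`-measure, where its
left-hand side is meaningful. -/
def Cond2 (ball : G → ℝ → Set G) (μ : Measure G) (w : G → ℝ) (R : ℝ) : Prop :=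
  ∃ p : ℝ, 1 ≤ p ∧ ∃ C : ℝ, 0 < C ∧ ∀ (x : G) (r : ℝ), 0 < r → r ≤ R →
    0 < weightMeasure μ w (ball x r) →
    ∀ F : Set G, MeasurableSet F → F ⊆ ball x r →
      weightMeasure μ w F / weightMeasure μ w (ball x r) ≥
        ENNReal.ofReal C * (μ F / μ (ball x r)) ^ p

/-- The `A_p` condition for some `p > 1` on the balls of radius at most `R`. Negative powers of `0` are `∞`, and `0 * ∞ = 0`. -/
def Cond3 (ball : G → ℝ → Set G) (μ : Measure G) (w : G → ℝ) (R : ℝ) : Prop :=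
  ∃ p p' : ℝ, p.HolderConjugate p' ∧ ∃ C : ℝ, 0 < C ∧ ∀ (x : G) (r : ℝ), 0 < r → r ≤ R →
    (⨍⁻ y in ball x r, ENNReal.ofReal (w y) ∂μ) *
      (⨍⁻ y in ball x r, ENNReal.ofReal (w y) ^ (-(p' / p)) ∂μ) ^ (p / p') ≤ ENNReal.ofReal C

/-- On a fixed proportion of each ball of radius at most `R`, the weight is bounded below by a fixed
multiple of its average. -/
def Cond4 (ball : G → ℝ → Set G) (μ : Measure G) (w : G → ℝ) (R : ℝ) : Prop :=
  ∃ δ : ℝ, 0 < δ ∧ ∃ c : ℝ, 0 < c ∧ ∀ (x : G) (r : ℝ), 0 < r → r ≤ R →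
    μ {y ∈ ball x r | ENNReal.ofReal (w y) ≥
        ENNReal.ofReal δ * ⨍⁻ z in ball x r, ENNReal.ofReal (w z) ∂μ} ≥
      ENNReal.ofReal c * μ (ball x r)

/-- `μ_w(5B) ≤ C μ_w(B)` for some constant `C` and all balls `B` of radius at most `R`. -/
def FiveDoubling (ball : G → ℝ → Set G) (μ : Measure G) (w : G → ℝ) (R : ℝ) : Prop :=
  ∃ C : ℝ, 0 < C ∧ ∀ (x : G) (r : ℝ), 0 < r → r ≤ R →
    weightMeasure μ w (ball x (5 * r)) ≤ ENNReal.ofReal C * weightMeasure μ w (ball x r)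

end

end LocalMuckenhoupt

open SubRiemannian LocalMuckenhoupt

/-!
The implications (3) ⇒ (2) ⇒ (4) ⇒ (1) hold for any family of sets of positive finite measure:
the first is Hölder's inequality, the second applies (2) to the part of the ball where `w` is small
compared with its average, and the third is Chebyshev's inequality.

For (1) ⇒ (3), horizontal curves can be cut at any proportion of their length, so the doubling of
`μ_w` makes `μ_w` small near the boundary of a ball. By (1), a slightly smaller concentric ball
then keeps a fixed proportion of `μ`, and as balls of equal radius have equal `μ`-measure, `μ` is
doubling too. In a ball where the average of `w` exceeds a multiple of `t`, the set `{w < t}` is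
covered by balls of almost maximal radius among those on which the average of `w` is at most `t`; a
Vitali selection and (1) on the selected balls give `t μ{w < t} ≤ C μ_w{w < K t}`. Hence
`μ{w < t / M ^ j}` decays geometrically in `j`, which bounds the average of `w ^ (-s)` for a small
`s > 0`.

The geometric input is that the Carnot–Carathéodory distance induces the topology of `G` and has
relatively compact balls. A short horizontal curve stays in a given neighbourhood, since its speed
bounds the speed of its coordinates. Conversely, the span of the conjugates of `𝓗` by points near
the identity is stable under the brackets with `𝓗`, hence is the whole Lie algebra, and a product of
conjugates of integral curves of fields in `𝓗` is a submersion.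
-/

namespace LocalMuckenhoupt

open Metric Filter Topology
open scoped NNReal

section Elementary

variable {G : Type*} [MeasurableSpace G] {μ ν : Measure G} {f : G → ℝ≥0∞} {B F : Set G}

theorem one_sub_mul_le_measure_sdiff {a : ℝ≥0∞} (hB : ν B ≠ ⊤) (h : ν F ≤ a * ν B) :
    (1 - a) * ν B ≤ ν (B \ F) :=
  calc (1 - a) * ν B = ν B - a * ν B := by
        rw [ENNReal.sub_mul fun _ _ => hB, one_mul]
    _ ≤ ν B - ν F := tsub_le_tsub_left h _
    _ ≤ ν (B \ F) := le_measure_sdiff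

theorem measure_le_one_sub_mul {a : ℝ≥0∞} (hF : MeasurableSet F) (hFB : F ⊆ B) (hB : ν B ≠ ⊤)
    (h : a * ν B ≤ ν (B \ F)) : ν F ≤ (1 - a) * ν B :=
  calc ν F = ν B - ν (B \ F) := by
        rw [← measure_sdiff_add_inter B hF, inter_eq_self_of_subset_right hFB,
          ENNReal.add_sub_cancel_left (measure_ne_top_of_subset sdiff_subset hB)]
    _ ≤ ν B - a * ν B := tsub_le_tsub_left h _
    _ = (1 - a) * ν B := by rw [ENNReal.sub_mul fun _ _ => hB, one_mul]

theorem setLAverage_mul_measure (hB : MeasurableSet B) (hB0 : μ B ≠ 0) (hBt : μ B ≠ ⊤) :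
    (⨍⁻ y in B, f y ∂μ) * μ B = μ.withDensity f B := by
  rw [setLAverage_eq, ENNReal.div_mul_cancel hB0 hBt, withDensity_apply _ hB]

theorem mul_le_withDensity_sdiff {a b : ℝ≥0∞} (hf : AEMeasurable f μ) (hB : MeasurableSet B)
    (hF : MeasurableSet F) (hFt : μ F ≠ ⊤) (h : μ F + b ≤ μ {y ∈ B | a ≤ f y}) :
    a * b ≤ μ.withDensity f (B \ F) :=
  calc a * b ≤ a * μ ({y ∈ B | a ≤ f y} \ F) := by
        gcongr
        exact (ENNReal.le_sub_of_add_le_left hFt h).trans le_measure_sdiff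
    _ ≤ a * μ.restrict (B \ F) {y | a ≤ f y} := by
        rw [Measure.restrict_apply' (hB.diff hF)]
        gcongr
        exact fun y hy => ⟨hy.1.2, hy.1.1, hy.2⟩
    _ ≤ ∫⁻ y in B \ F, f y ∂μ := mul_meas_ge_le_lintegral₀ hf.restrict _
    _ = μ.withDensity f (B \ F) := (withDensity_apply _ (hB.diff hF)).symm

theorem inv_two_mul_le_measure_setOf_le {p : ℝ} {c δ : ℝ≥0∞} (hf : AEMeasurable f μ)
    (hB : MeasurableSet B) (hB0 : μ B ≠ 0) (hBt : μ B ≠ ⊤) (hνB : μ.withDensity f B ≠ ⊤)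
    (hp : 0 ≤ p) (hδ : δ < c * 2⁻¹ ^ p)
    (h : μ.withDensity f B ≠ 0 → ∀ F, MeasurableSet F → F ⊆ B →
      c * (μ F / μ B) ^ p ≤ μ.withDensity f F / μ.withDensity f B) :
    2⁻¹ * μ B ≤ μ {y ∈ B | δ * ⨍⁻ z in B, f z ∂μ ≤ f y} := by
  set A := ⨍⁻ z in B, f z ∂μ
  have hA : A * μ B = μ.withDensity f B := setLAverage_mul_measure hB hB0 hBt
  have hsplit : {y ∈ B | δ * A ≤ f y} = B \ {y ∈ B | f y < δ * A} := by
    ext y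
    simp +contextual
  have hlow : NullMeasurableSet {y ∈ B | f y < δ * A} μ :=
    hB.nullMeasurableSet.inter (nullMeasurableSet_lt hf aemeasurable_const)
  rcases eq_or_ne (μ.withDensity f B) 0 with hν0 | hν0
  · have hA0 : A = 0 := (mul_eq_zero.1 (hA.trans hν0)).resolve_right hB0
    simp only [hA0, mul_zero, zero_le, and_true, ofPred_mem_eq]
    exact mul_le_of_le_one_left' (ENNReal.inv_le_one.2 one_le_two)
  suffices hsmall : μ {y ∈ B | f y < δ * A} ≤ 2⁻¹ * μ B by
    have := one_sub_mul_le_measure_sdiff hBt hsmall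
    rwa [ENNReal.one_sub_inv_two, ← hsplit] at this
  by_contra! hlarge
  obtain ⟨F, hFL, hF, hFμ⟩ := hlow.exists_measurable_subset_ae_eq
  rw [← measure_congr hFμ] at hlarge
  have hFB : F ⊆ B := hFL.trans (sep_subset _ _)
  have hupper : μ.withDensity f F ≤ δ * μ.withDensity f B :=
    calc μ.withDensity f F ≤ ∫⁻ _ in F, δ * A ∂μ := by
          rw [withDensity_apply _ hF]
          exact setLIntegral_mono' hF fun y hy => (hFL hy).2.le
      _ = δ * A * μ F := setLIntegral_const _ _
      _ ≤ δ * A * μ B := by gcongr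
      _ = δ * μ.withDensity f B := by rw [mul_assoc, hA]
  refine hδ.not_ge ?_
  calc c * 2⁻¹ ^ p ≤ c * (μ F / μ B) ^ p := by
        gcongr
        exact (ENNReal.le_div_iff_mul_le (.inl hB0) (.inl hBt)).2 hlarge.le
    _ ≤ μ.withDensity f F / μ.withDensity f B := h hν0 F hF hFB
    _ ≤ δ := (ENNReal.div_le_iff_le_mul (.inl hν0) (.inl hνB)).2 hupper

theorem measure_rpow_le_lintegral_mul {p q : ℝ} (hpq : p.HolderConjugate q)
    (hf : AEMeasurable f (μ.restrict F)) (hfin : ∫⁻ y in F, f y ∂μ ≠ ⊤)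
    (hdual : ∫⁻ y in F, f y ^ (-(q / p)) ∂μ ≠ ⊤) :
    μ F ^ p ≤ (∫⁻ y in F, f y ∂μ) * (∫⁻ y in F, f y ^ (-(q / p)) ∂μ) ^ (p / q) := by
  have hcancel : ∀ᵐ y ∂(μ.restrict F), f y ^ (1 / p) * f y ^ (-(1 / p)) = 1 := by
    filter_upwards [ae_lt_top' hf hfin, ae_lt_top' (hf.pow_const _) hdual] with y htop hneg
    have h0 : f y ≠ 0 := by
      rintro h0
      rw [h0, ENNReal.zero_rpow_of_neg (neg_lt_zero.2 (div_pos hpq.symm.pos hpq.pos))] at hneg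
      exact hneg.ne rfl
    rw [← ENNReal.rpow_add _ _ h0 htop.ne, add_neg_cancel, ENNReal.rpow_zero]
  have hroot : ∀ y, (f y ^ (1 / p)) ^ p = f y := fun y => by
    rw [← ENNReal.rpow_mul, one_div_mul_cancel hpq.ne_zero, ENNReal.rpow_one]
  have hneg : ∀ y, (f y ^ (-(1 / p))) ^ q = f y ^ (-(q / p)) := fun y => by
    rw [← ENNReal.rpow_mul]; congr 1; ring
  calc μ F ^ p = (∫⁻ y in F, f y ^ (1 / p) * f y ^ (-(1 / p)) ∂μ) ^ p := by
        rw [lintegral_congr_ae hcancel, setLIntegral_one]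
    _ ≤ ((∫⁻ y in F, f y ∂μ) ^ (1 / p) * (∫⁻ y in F, f y ^ (-(q / p)) ∂μ) ^ (1 / q)) ^ p := by
        gcongr
        · exact hpq.nonneg
        · simpa only [hroot, hneg, Pi.mul_apply] using
            ENNReal.lintegral_mul_le_Lp_mul_Lq (μ.restrict F) hpq
              (hf.pow_const (1 / p)) (hf.pow_const (-(1 / p)))
    _ = _ := by
        rw [ENNReal.mul_rpow_of_nonneg _ _ hpq.nonneg, ← ENNReal.rpow_mul, ← ENNReal.rpow_mul,
          one_div_mul_cancel hpq.ne_zero, ENNReal.rpow_one, one_div_mul_eq_div]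

theorem mul_measure_rpow_le_of_setLAverage_mul_le {p q : ℝ} {C : ℝ≥0∞} (hpq : p.HolderConjugate q)
    (hC : C ≠ ⊤) (hf : AEMeasurable f μ) (hB0 : μ B ≠ 0) (hBt : μ B ≠ ⊤)
    (hν0 : ∫⁻ y in B, f y ∂μ ≠ 0) (hνt : ∫⁻ y in B, f y ∂μ ≠ ⊤) (hFB : F ⊆ B)
    (h : (⨍⁻ y in B, f y ∂μ) * (⨍⁻ y in B, f y ^ (-(q / p)) ∂μ) ^ (p / q) ≤ C) :
    (∫⁻ y in B, f y ∂μ) * μ F ^ p ≤ C * μ B ^ p * ∫⁻ y in F, f y ∂μ := by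
  set N := ∫⁻ y in B, f y ∂μ
  set I := ∫⁻ y in B, f y ^ (-(q / p)) ∂μ
  have hpq0 : 0 < p / q := div_pos hpq.pos hpq.symm.pos
  have hBp : μ B ^ p ≠ ⊤ := ENNReal.rpow_ne_top_of_nonneg hpq.nonneg hBt
  have hNI : N * I ^ (p / q) ≤ C * μ B ^ p := by
    have hpow : μ B ^ p = μ B * μ B ^ (p / q) := by
      rw [hpq.div_conj_eq_sub_one, ENNReal.rpow_sub _ _ hB0 hBt, ENNReal.rpow_one,
        ENNReal.mul_div_cancel hB0 hBt]
    calc N * I ^ (p / q)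
        = N / μ B * (I / μ B) ^ (p / q) * μ B ^ p := by
          rw [hpow, ENNReal.div_rpow_of_nonneg _ _ hpq0.le, mul_mul_mul_comm,
            ENNReal.div_mul_cancel hB0 hBt, ENNReal.div_mul_cancel
              (by simp [hB0, hBt]) (ENNReal.rpow_ne_top_of_nonneg hpq0.le hBt)]
      _ ≤ C * μ B ^ p := by
          gcongr
          simpa only [setLAverage_eq] using h
  have hI : I ≠ ⊤ := by
    rintro hI
    rw [hI, ENNReal.top_rpow_of_pos hpq0, ENNReal.mul_top hν0, top_le_iff] at hNI
    exact ENNReal.mul_ne_top hC hBp hNI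
  have hIF : ∫⁻ y in F, f y ^ (-(q / p)) ∂μ ≤ I := lintegral_mono_set hFB
  calc N * μ F ^ p ≤ N * ((∫⁻ y in F, f y ∂μ) * I ^ (p / q)) := by
        gcongr
        refine (measure_rpow_le_lintegral_mul hpq hf.restrict
          (ne_top_of_le_ne_top hνt (lintegral_mono_set hFB)) (ne_top_of_le_ne_top hI hIF)).trans ?_
        gcongr
    _ = N * I ^ (p / q) * ∫⁻ y in F, f y ∂μ := by ring
    _ ≤ C * μ B ^ p * ∫⁻ y in F, f y ∂μ := by gcongr

variable {ball : G → ℝ → Set G} {w : G → ℝ} {R : ℝ}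

theorem cond1_of_cond4 (hmeas : ∀ x r, MeasurableSet (ball x r))
    (hpos : ∀ x r, 0 < r → μ (ball x r) ≠ 0) (hfin : ∀ x r, μ (ball x r) ≠ ⊤)
    (hwfin : ∀ x r, weightMeasure μ w (ball x r) ≠ ⊤) (hw : AEMeasurable w μ)
    (h : Cond4 ball μ w R) : Cond1 ball μ w R := by
  obtain ⟨δ, hδ, c, hc, h⟩ := h
  set δ' := min δ 2⁻¹
  set c' := min c 1
  have hδ' : 0 < δ' := lt_min hδ (by norm_num)
  have hc' : 0 < c' := lt_min hc one_pos
  have hδ'le : δ' ≤ 2⁻¹ := min_le_right _ _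
  have hc'le : c' ≤ 1 := min_le_right _ _
  refine ⟨c' / 2, ⟨by positivity, by linarith⟩, 1 - δ' * (c' / 2),
    ⟨by nlinarith, by linarith [mul_pos hδ' (half_pos hc')]⟩, fun x r hr hrR F hF hFB hFμ => ?_⟩
  rw [ENNReal.ofReal_sub _ (by positivity), ENNReal.ofReal_one]
  refine measure_le_one_sub_mul hF hFB (hwfin x r) ?_
  have hroom : μ F + ENNReal.ofReal (c' / 2) * μ (ball x r) ≤
      μ {y ∈ ball x r | ENNReal.ofReal δ' * ⨍⁻ z in ball x r, ENNReal.ofReal (w z) ∂μ ≤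
        ENNReal.ofReal (w y)} :=
    calc _ ≤ ENNReal.ofReal (c' / 2) * μ (ball x r) + ENNReal.ofReal (c' / 2) * μ (ball x r) := by
          gcongr
      _ = ENNReal.ofReal c' * μ (ball x r) := by
          rw [← add_mul, ← ENNReal.ofReal_add (by positivity) (by positivity), add_halves]
      _ ≤ ENNReal.ofReal c * μ (ball x r) := by gcongr; exact min_le_left _ _
      _ ≤ _ := h x r hr hrR
      _ ≤ _ := by
          refine measure_mono fun y hy => ⟨hy.1, le_trans ?_ hy.2⟩
          gcongr
          exact min_le_left _ _
  calc ENNReal.ofReal (δ' * (c' / 2)) * weightMeasure μ w (ball x r)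
      = ENNReal.ofReal δ' * (⨍⁻ z in ball x r, ENNReal.ofReal (w z) ∂μ) *
          (ENNReal.ofReal (c' / 2) * μ (ball x r)) := by
        rw [weightMeasure, ← setLAverage_mul_measure (hmeas x r) (hpos x r hr) (hfin x r),
          ENNReal.ofReal_mul hδ'.le]
        ring
    _ ≤ weightMeasure μ w (ball x r \ F) := mul_le_withDensity_sdiff hw.ennreal_ofReal
        (hmeas x r) hF (measure_ne_top_of_subset hFB (hfin x r)) hroom

theorem cond4_of_cond2 (hmeas : ∀ x r, MeasurableSet (ball x r))
    (hpos : ∀ x r, 0 < r → μ (ball x r) ≠ 0) (hfin : ∀ x r, μ (ball x r) ≠ ⊤)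
    (hwfin : ∀ x r, weightMeasure μ w (ball x r) ≠ ⊤) (hw : AEMeasurable w μ)
    (h : Cond2 ball μ w R) : Cond4 ball μ w R := by
  obtain ⟨p, hp, C, hC, h⟩ := h
  have hδ : ENNReal.ofReal (C * 2⁻¹ ^ p / 2) < ENNReal.ofReal C * 2⁻¹ ^ p := by
    have hpow : ENNReal.ofReal C * 2⁻¹ ^ p = ENNReal.ofReal (C * 2⁻¹ ^ p) := by
      rw [ENNReal.ofReal_mul hC.le, ← ENNReal.ofReal_rpow_of_pos (by norm_num),
        ENNReal.ofReal_inv_of_pos two_pos, ENNReal.ofReal_ofNat]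
    rw [hpow, ENNReal.ofReal_lt_ofReal_iff (by positivity)]
    exact half_lt_self (by positivity)
  refine ⟨C * 2⁻¹ ^ p / 2, by positivity, 2⁻¹, by norm_num, fun x r hr hrR => ?_⟩
  rw [ENNReal.ofReal_inv_of_pos two_pos, ENNReal.ofReal_ofNat]
  exact inv_two_mul_le_measure_setOf_le hw.ennreal_ofReal (hmeas x r) (hpos x r hr) (hfin x r)
    (hwfin x r) (by linarith) hδ fun h0 => h x r hr hrR (pos_iff_ne_zero.2 h0)

theorem cond2_of_cond3 (hmeas : ∀ x r, MeasurableSet (ball x r))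
    (hpos : ∀ x r, 0 < r → μ (ball x r) ≠ 0) (hfin : ∀ x r, μ (ball x r) ≠ ⊤)
    (hwfin : ∀ x r, weightMeasure μ w (ball x r) ≠ ⊤) (hw : AEMeasurable w μ)
    (h : Cond3 ball μ w R) : Cond2 ball μ w R := by
  obtain ⟨p, q, hpq, C, hC, h⟩ := h
  refine ⟨p, hpq.lt.le, C⁻¹, by positivity, fun x r hr hrR hν F hF hFB => ?_⟩
  have hνt := hwfin x r
  simp only [weightMeasure, withDensity_apply _ hF, withDensity_apply _ (hmeas x r)] at hν hνt ⊢
  have hmain := mul_measure_rpow_le_of_setLAverage_mul_le hpq ENNReal.ofReal_ne_top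
    hw.ennreal_ofReal (hpos x r hr) (hfin x r) hν.ne' hνt hFB (h x r hr hrR)
  have hBp : μ (ball x r) ^ p ≠ 0 := by simp [hpos x r hr, hfin x r]
  have hBpt : μ (ball x r) ^ p ≠ ⊤ := ENNReal.rpow_ne_top_of_nonneg hpq.nonneg (hfin x r)
  rw [ge_iff_le, ENNReal.le_div_iff_mul_le (.inl hν.ne') (.inl hνt), ENNReal.ofReal_inv_of_pos hC,
    mul_assoc, ENNReal.inv_mul_le_iff (by simpa using hC) ENNReal.ofReal_ne_top,
    ENNReal.div_rpow_of_nonneg _ _ hpq.nonneg, ← ENNReal.mul_div_right_comm,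
    ENNReal.div_le_iff_le_mul (.inl hBp) (.inl hBpt)]
  rw [mul_comm, mul_right_comm]
  exact hmain

theorem isFiniteMeasureOnCompacts_weightMeasure {X : Type*} [TopologicalSpace X] [T2Space X]
    [MeasurableSpace X] [OpensMeasurableSpace X] {μ : Measure X} {w : X → ℝ}
    (hw : LocallyIntegrable w μ) (hw0 : ∀ᵐ x ∂μ, 0 ≤ w x) :
    IsFiniteMeasureOnCompacts (weightMeasure μ w) := by
  refine ⟨fun K hK => ?_⟩
  rw [weightMeasure, withDensity_apply _ hK.measurableSet]
  exact (hasFiniteIntegral_iff_ofReal (ae_restrict_of_ae hw0)).1 (hw.integrableOn_isCompact hK).2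

end Elementary

section Doubling

variable {X : Type*} [PseudoMetricSpace X] [MeasurableSpace X] {μ ν : Measure X} {R : ℝ}

/-- The length property of a metric: the ball of radius `a + b` about `x` is covered by the balls
of radius `b` with centres at distance less than `a` from `x`. -/
def LengthProperty (X : Type*) [PseudoMetricSpace X] : Prop :=
  ∀ (x y : X) (a b : ℝ), 0 < a → 0 < b → dist x y < a + b → ∃ z, dist x z < a ∧ dist z y < b

/-- The doubling condition with factor `5` and constant `D` on the balls of radius at most `R`. -/
def IsFiveDoublingUpTo (ν : Measure X) (R : ℝ) (D : ℝ≥0) : Prop :=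
  ∀ (x : X) (r : ℝ), 0 < r → r ≤ R → ν (ball x (5 * r)) ≤ D * ν (ball x r)

/-- The `A_∞` condition of `ν` with respect to `μ` on the balls of radius at most `R`: a subset
filling at most the proportion `ε` of a ball for `μ` fills at most the proportion `δ` of it
for `ν`. -/
def IsAInftyUpTo (μ ν : Measure X) (R : ℝ) (ε δ : ℝ≥0) : Prop :=
  ∀ (x : X) (r : ℝ), 0 < r → r ≤ R → ∀ F : Set X, MeasurableSet F → F ⊆ ball x r →
    μ F ≤ ε * μ (ball x r) → ν F ≤ δ * ν (ball x r)

theorem IsFiveDoublingUpTo.mono {D D' : ℝ≥0} (hD : IsFiveDoublingUpTo ν R D) (h : D ≤ D') :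
    IsFiveDoublingUpTo ν R D' := fun x r hr hrR =>
  (hD x r hr hrR).trans (by gcongr)

theorem IsFiveDoublingUpTo.measure_ball_pow_le {D : ℝ≥0} (hD : IsFiveDoublingUpTo ν R D) (k : ℕ)
    {x : X} {r : ℝ} (hr : 0 < r) (hrR : 5 ^ k * r ≤ 5 * R) :
    ν (ball x (5 ^ k * r)) ≤ D ^ k * ν (ball x r) := by
  induction k with
  | zero => simp
  | succ k ih =>
    have hk : 5 ^ k * r ≤ R := by rw [pow_succ] at hrR; linarith
    have hkpos : 0 < 5 ^ k * r := by positivity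
    calc ν (ball x (5 ^ (k + 1) * r)) = ν (ball x (5 * (5 ^ k * r))) := by ring_nf
      _ ≤ D * ν (ball x (5 ^ k * r)) := hD x _ hkpos hk
      _ ≤ D * (D ^ k * ν (ball x r)) := by gcongr; exact ih (by linarith)
      _ = D ^ (k + 1) * ν (ball x r) := by ring

theorem IsFiveDoublingUpTo.isUnifLocDoublingMeasure {D : ℝ≥0} (hR : 0 < R)
    (hD : IsFiveDoublingUpTo μ R D) : IsUnifLocDoublingMeasure μ := by
  refine ⟨⟨D, ?_⟩⟩
  filter_upwards [Ioc_mem_nhdsGT hR] with s hs x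
  calc μ (closedBall x (2 * s)) ≤ μ (ball x (5 * s)) :=
        measure_mono (closedBall_subset_ball (by linarith [hs.1]))
    _ ≤ D * μ (ball x s) := hD x s hs.1 hs.2
    _ ≤ D * μ (closedBall x s) := by gcongr; exact ball_subset_closedBall

section Covering

variable [SecondCountableTopology X] [BorelSpace X]

theorem measure_le_mul_of_forall_exists_ball {E A : Set X} {C : ℝ≥0∞} {S : ℝ}
    (h : ∀ y ∈ E, ∃ z s, 0 < s ∧ s ≤ S ∧ y ∈ ball z s ∧
      μ (ball z (5 * s)) ≤ C * ν (ball z s ∩ A)) : μ E ≤ C * ν A := by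
  choose! z s hs hsS hy hμ using h
  obtain ⟨u, huE, hdisj, hcov⟩ :=
    Vitali.exists_disjoint_subfamily_covering_enlargement_closedBall E z s S hsS 4 (by norm_num)
  have hdisj' : u.PairwiseDisjoint fun a => ball (z a) (s a) :=
    hdisj.mono fun a => ball_subset_closedBall
  have hu : u.Countable := hdisj'.countable_of_isOpen (fun a _ => isOpen_ball)
    fun a ha => ⟨z a, mem_ball_self (hs a (huE ha))⟩
  have hsub : E ⊆ ⋃ a ∈ u, ball (z a) (5 * s a) := by
    intro y hyE
    obtain ⟨b, hb, hyb⟩ := hcov y hyE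
    exact mem_iUnion₂.2 ⟨b, hb, closedBall_subset_ball (by linarith [hs b (huE hb)])
      (hyb (ball_subset_closedBall (hy y hyE)))⟩
  calc μ E ≤ ∑' a : u, μ (ball (z a) (5 * s a)) :=
        (measure_mono hsub).trans (measure_biUnion_le μ hu _)
    _ ≤ ∑' a : u, C * (ν.restrict A) (ball (z a) (s a)) := by
        refine ENNReal.tsum_le_tsum fun a => ?_
        rw [Measure.restrict_apply measurableSet_ball]
        exact hμ a (huE a.2)
    _ = C * (ν.restrict A) (⋃ a ∈ u, ball (z a) (s a)) := by
        rw [ENNReal.tsum_mul_left, measure_biUnion hu hdisj' fun _ _ => measurableSet_ball]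
    _ ≤ C * (ν.restrict A) univ := by gcongr; exact subset_univ _
    _ = C * ν A := by rw [Measure.restrict_apply_univ]

theorem IsFiveDoublingUpTo.measure_annulus_le {D : ℝ≥0} (hlen : LengthProperty X)
    (hD : IsFiveDoublingUpTo ν R D) {x : X} {r ρ : ℝ} (hρ : 0 < ρ) (hρr : 8 * ρ ≤ r) (hr : r ≤ R) :
    ν (ball x r \ ball x (r - ρ)) ≤ D ^ 2 * ν (ball x (r - ρ) \ ball x (r - 4 * ρ)) := by
  refine measure_le_mul_of_forall_exists_ball (S := 3 * ρ) fun y hy => ?_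
  rw [Set.mem_sdiff, mem_ball', mem_ball', not_lt] at hy
  obtain ⟨z, hxz, hzy⟩ := hlen x y (r - 2 * ρ) (2 * ρ) (by linarith) (by linarith) (by linarith)
  refine ⟨z, 3 * ρ, by linarith, le_rfl, mem_ball'.2 (by linarith), ?_⟩
  calc ν (ball z (5 * (3 * ρ))) ≤ ν (ball z (5 ^ 2 * ρ)) :=
        measure_mono (ball_subset_ball (by linarith))
    _ ≤ D ^ 2 * ν (ball z ρ) := hD.measure_ball_pow_le 2 hρ (by linarith)
    _ ≤ D ^ 2 * ν (ball z (3 * ρ) ∩ (ball x (r - ρ) \ ball x (r - 4 * ρ))) := by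
        gcongr
        intro q hq
        rw [mem_ball'] at hq
        rw [mem_inter_iff, Set.mem_sdiff, mem_ball', mem_ball', mem_ball', not_lt]
        exact ⟨by linarith, by linarith [dist_triangle x z q],
          by linarith [dist_triangle x q y, dist_triangle q z y, dist_comm q z]⟩

theorem IsFiveDoublingUpTo.measure_annulus_le_mul_annulus {D : ℝ≥0} (hlen : LengthProperty X)
    (hD : IsFiveDoublingUpTo ν R D) {x : X} {r ρ : ℝ} (hρ : 0 < ρ) (hρr : 8 * ρ ≤ r) (hr : r ≤ R) :
    ν (ball x r \ ball x (r - ρ)) ≤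
      (D ^ 2 / (1 + D ^ 2) : ℝ≥0) * ν (ball x r \ ball x (r - 4 * ρ)) := by
  have hsplit : ν (ball x r \ ball x (r - ρ)) + ν (ball x (r - ρ) \ ball x (r - 4 * ρ)) =
      ν (ball x r \ ball x (r - 4 * ρ)) := by
    rw [← measure_union (disjoint_sdiff_left.mono_right sdiff_subset)
      (measurableSet_ball.diff measurableSet_ball),
      sdiff_union_sdiff_cancel (ball_subset_ball (by linarith)) (ball_subset_ball (by linarith))]
  have hD0 : (1 + D ^ 2 : ℝ≥0) ≠ 0 := by positivity
  rw [ENNReal.coe_div hD0, ← ENNReal.mul_div_right_comm,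
    ENNReal.le_div_iff_mul_le (.inl (by exact_mod_cast hD0)) (.inl ENNReal.coe_ne_top), ← hsplit]
  push_cast
  calc _ = ν (ball x r \ ball x (r - ρ)) + D ^ 2 * ν (ball x r \ ball x (r - ρ)) := by ring
    _ ≤ D ^ 2 * ν (ball x (r - ρ) \ ball x (r - 4 * ρ)) +
          D ^ 2 * ν (ball x r \ ball x (r - ρ)) := by
        gcongr
        exact hD.measure_annulus_le hlen hρ hρr hr
    _ = _ := by ring

theorem IsFiveDoublingUpTo.exists_annulus_le {D κ : ℝ≥0} (hlen : LengthProperty X)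
    (hD : IsFiveDoublingUpTo ν R D) (hκ : 0 < κ) :
    ∃ η ∈ Ioo (0 : ℝ) 1, ∀ (x : X) (r : ℝ), 0 < r → r ≤ R →
      ν (ball x r \ ball x ((1 - η) * r)) ≤ κ * ν (ball x r) := by
  set θ : ℝ≥0 := D ^ 2 / (1 + D ^ 2)
  have hθ : θ < 1 := by
    rw [div_lt_one (by positivity)]
    exact lt_one_add _
  obtain ⟨k, hk⟩ := exists_pow_lt_of_lt_one hκ hθ
  have hiter : ∀ (x : X) (r : ℝ), 0 < r → r ≤ R → ∀ j : ℕ,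
      ν (ball x r \ ball x (r - r / (8 * 4 ^ j))) ≤ θ ^ j * ν (ball x r) := by
    intro x r hr hrR j
    induction j with
    | zero => simpa using measure_mono sdiff_subset
    | succ j ih =>
      have h4 : (1 : ℝ) ≤ 4 ^ (j + 1) := one_le_pow₀ (by norm_num)
      have hstep := hD.measure_annulus_le_mul_annulus hlen (x := x) (r := r)
        (ρ := r / (8 * 4 ^ (j + 1))) (by positivity)
        (by rw [mul_div_assoc', div_le_iff₀ (by positivity)]; nlinarith) hrR
      have hquad : 4 * (r / (8 * 4 ^ (j + 1))) = r / (8 * 4 ^ j) := by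
        rw [pow_succ]; field_simp
      rw [hquad] at hstep
      calc _ ≤ _ := hstep
        _ ≤ θ * (θ ^ j * ν (ball x r)) := by gcongr
        _ = θ ^ (j + 1) * ν (ball x r) := by ring
  refine ⟨1 / (8 * 4 ^ k), ⟨by positivity, ?_⟩, fun x r hr hrR => ?_⟩
  · rw [div_lt_one (by positivity)]
    linarith [one_le_pow₀ (show (1 : ℝ) ≤ 4 by norm_num) (n := k)]
  · rw [one_sub_mul, one_div_mul_eq_div]
    refine (hiter x r hr hrR k).trans ?_
    gcongr
    exact_mod_cast hk.le

theorem IsAInftyUpTo.exists_mul_measure_ball_le {D ε δ : ℝ≥0} (hlen : LengthProperty X)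
    (hD : IsFiveDoublingUpTo ν R D) (hδ : δ < 1) (h : IsAInftyUpTo μ ν R ε δ) :
    ∃ η ∈ Ioo (0 : ℝ) 1, ∀ (x : X) (r : ℝ), 0 < r → r ≤ R → ν (ball x r) ≠ 0 →
      ν (ball x r) ≠ ⊤ → ε * μ (ball x r) ≤ μ (ball x ((1 - η) * r)) := by
  obtain ⟨κ, hδκ, hκ⟩ := exists_between hδ
  obtain ⟨η, hη, hann⟩ := hD.exists_annulus_le hlen (tsub_pos_of_lt hδκ)
  refine ⟨η, hη, fun x r hr hrR hν0 hνt => ?_⟩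
  by_contra! hlt
  have hsub : ball x ((1 - η) * r) ⊆ ball x r := ball_subset_ball (by nlinarith [hη.1])
  have hinner : ν (ball x ((1 - η) * r)) ≤ δ * ν (ball x r) :=
    h x r hr hrR _ measurableSet_ball hsub hlt.le
  have hle : ν (ball x r) ≤ κ * ν (ball x r) :=
    calc ν (ball x r) = ν (ball x ((1 - η) * r)) + ν (ball x r \ ball x ((1 - η) * r)) := by
          rw [measure_add_sdiff measurableSet_ball.nullMeasurableSet,
            union_eq_self_of_subset_left hsub]
      _ ≤ δ * ν (ball x r) + (κ - δ : ℝ≥0) * ν (ball x r) := by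
          gcongr
          exact hann x r hr hrR
      _ = κ * ν (ball x r) := by
          rw [← add_mul, ← ENNReal.coe_add, add_tsub_cancel_of_le hδκ.le]
  refine hle.not_gt ?_
  calc κ * ν (ball x r) < 1 * ν (ball x r) := by
        rw [ENNReal.mul_lt_mul_iff_left hν0 hνt]
        exact_mod_cast hκ
    _ = ν (ball x r) := one_mul _

theorem IsAInftyUpTo.exists_isFiveDoublingUpTo {D ε δ : ℝ≥0} (hlen : LengthProperty X)
    (hinv : ∀ x y r, μ (ball x r) = μ (ball y r)) (hfin : ∀ x r, ν (ball x r) ≠ ⊤)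
    (hν : ν ≠ 0) (hD : IsFiveDoublingUpTo ν R D) (hε : ε ≠ 0) (hδ : δ < 1)
    (h : IsAInftyUpTo μ ν R ε δ) : ∃ D', IsFiveDoublingUpTo μ (R / 5) D' := by
  obtain ⟨x₀, hx₀⟩ := Measure.nonempty_support hν
  have hpos : ∀ r, 0 < r → ν (ball x₀ r) ≠ 0 := fun r hr =>
    ((Measure.mem_support_iff_forall x₀).1 hx₀ _ (ball_mem_nhds x₀ hr)).ne'
  obtain ⟨η, hη, hstep⟩ := h.exists_mul_measure_ball_le hlen hD hδ
  have hη0 : 0 < 1 - η := sub_pos.2 hη.2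
  have hiter : ∀ (i : ℕ) (r : ℝ), 0 < r → r ≤ R →
      ε ^ i * μ (ball x₀ r) ≤ μ (ball x₀ ((1 - η) ^ i * r)) := by
    intro i r hr hrR
    induction i with
    | zero => simp
    | succ i ih =>
      have hi : (1 - η) ^ i ≤ 1 := pow_le_one₀ hη0.le (by linarith [hη.1])
      have hri : 0 < (1 - η) ^ i * r := by positivity
      calc (ε : ℝ≥0∞) ^ (i + 1) * μ (ball x₀ r) = ε * (ε ^ i * μ (ball x₀ r)) := by ring
        _ ≤ ε * μ (ball x₀ ((1 - η) ^ i * r)) := by gcongr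
        _ ≤ μ (ball x₀ ((1 - η) * ((1 - η) ^ i * r))) :=
            hstep x₀ _ hri (by nlinarith) (hpos _ hri) (hfin _ _)
        _ = μ (ball x₀ ((1 - η) ^ (i + 1) * r)) := by ring_nf
  obtain ⟨j, hj⟩ := exists_pow_lt_of_lt_one (show (0 : ℝ) < 1 / 5 by norm_num)
    (show 1 - η < 1 by linarith [hη.1])
  refine ⟨(ε ^ j)⁻¹, fun x r hr hrR => ?_⟩
  rw [hinv x x₀, hinv x x₀, ENNReal.coe_inv (pow_ne_zero j hε),
    ← ENNReal.mul_le_iff_le_inv (by exact_mod_cast pow_ne_zero j hε) ENNReal.coe_ne_top,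
    ENNReal.coe_pow]
  exact (hiter j (5 * r) (by linarith) (by linarith)).trans
    (measure_mono (ball_subset_ball (by nlinarith)))

end Covering

end Doubling

section LevelSets

variable {X : Type*} [MeasurableSpace X] {μ ν : Measure X} {f : X → ℝ≥0∞} {B : Set X} {R : ℝ}
  {D ε δ : ℝ≥0} {t : ℝ≥0∞}

theorem one_sub_mul_le_withDensity_sublevel {t : ℝ≥0} (hf : Measurable f) (hB : MeasurableSet B)
    (hνB : μ.withDensity f B ≠ ⊤) (hε : ε ≠ 0) (ht : t ≠ 0)
    (h : ∀ F, MeasurableSet F → F ⊆ B → μ F ≤ ε * μ B →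
      μ.withDensity f F ≤ δ * μ.withDensity f B)
    (htB : μ.withDensity f B ≤ t * μ B) :
    (1 - δ) * μ.withDensity f B ≤ μ.withDensity f (B ∩ {y | f y < (t * ε⁻¹ : ℝ≥0)}) := by
  set F := B ∩ {y | (t * ε⁻¹ : ℝ≥0) ≤ f y}
  have hF : MeasurableSet F := hB.inter (measurableSet_le measurable_const hf)
  have hchebyshev : (t * ε⁻¹ : ℝ≥0) * μ F ≤ t * μ B :=
    calc (t * ε⁻¹ : ℝ≥0) * μ F = ∫⁻ _ in F, (t * ε⁻¹ : ℝ≥0) ∂μ := (setLIntegral_const _ _).symm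
      _ ≤ ∫⁻ y in F, f y ∂μ := setLIntegral_mono' hF fun y hy => hy.2
      _ = μ.withDensity f F := (withDensity_apply _ hF).symm
      _ ≤ μ.withDensity f B := measure_mono inter_subset_left
      _ ≤ t * μ B := htB
  have hFμ : μ F ≤ ε * μ B := by
    rwa [ENNReal.coe_mul, mul_assoc,
      ENNReal.mul_le_mul_iff_right (by exact_mod_cast ht) ENNReal.coe_ne_top, ENNReal.coe_inv hε,
      ENNReal.inv_mul_le_iff (by exact_mod_cast hε) ENNReal.coe_ne_top] at hchebyshev
  refine (one_sub_mul_le_measure_sdiff hνB (h F hF inter_subset_left hFμ)).trans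
    (measure_mono fun y hy => ⟨hy.1, ?_⟩)
  exact not_le.1 fun (hyt : (t * ε⁻¹ : ℝ≥0) ≤ f y) => hy.2 ⟨hy.1, hyt⟩

variable [PseudoMetricSpace X]

theorem measure_ball_le_of_forall_closedBall_le {y : X} {s : ℝ} {c : ℝ≥0∞} (hs : 0 < s)
    (h : ∀ q ∈ Ioo 0 s, ν (closedBall y q) ≤ c) : ν (ball y s) ≤ c := by
  obtain ⟨q, hmono, hmem, hlim⟩ := exists_seq_strictMono_tendsto' hs
  have hcover : ball y s ⊆ ⋃ n, closedBall y (q n) := fun z hz =>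
    mem_iUnion.2 ((hlim.eventually (lt_mem_nhds (mem_ball.1 hz))).exists.imp fun _ hn => hn.le)
  have hball : Monotone fun n => closedBall y (q n) := fun _ _ hab =>
    closedBall_subset_closedBall (hmono.monotone hab)
  calc ν (ball y s) ≤ ν (⋃ n, closedBall y (q n)) := measure_mono hcover
    _ = ⨆ n, ν (closedBall y (q n)) := hball.measure_iUnion
    _ ≤ c := iSup_le fun n => h _ (hmem n)

theorem ae_exists_ball_withDensity_le [SecondCountableTopology X] [BorelSpace X]
    [IsUnifLocDoublingMeasure μ] [IsLocallyFiniteMeasure μ]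
    [IsLocallyFiniteMeasure (μ.withDensity f)] (hf : Measurable f) (t : ℝ≥0∞) :
    ∀ᵐ y ∂μ, f y < t → ∀ ρ > 0, ∃ s ∈ Ioc 0 ρ, μ.withDensity f (ball y s) ≤ t * μ (ball y s) := by
  filter_upwards [(IsUnifLocDoublingMeasure.vitaliFamily μ 1).ae_tendsto_rnDeriv (μ.withDensity f),
    Measure.rnDeriv_withDensity μ hf] with y hy hyf hyt ρ hρ
  have ht0 : t ≠ 0 := hyt.ne_bot
  have hlim := hy.comp (IsUnifLocDoublingMeasure.tendsto_closedBall_filterAt μ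
    (fun _ : ℝ => y) id tendsto_id (K := 1) (l := 𝓝[>] 0) (by
      filter_upwards [self_mem_nhdsWithin] with q hq
      exact mem_closedBall_self (by simpa using (mem_Ioi.1 hq).le)))
  rw [hyf] at hlim
  obtain ⟨s, hs0, hs⟩ := mem_nhdsGT_iff_exists_Ioc_subset.1 (hlim.eventually (gt_mem_nhds hyt))
  have hmin : 0 < min s ρ := lt_min hs0 hρ
  refine ⟨min s ρ, ⟨hmin, min_le_right _ _⟩, measure_ball_le_of_forall_closedBall_le hmin
    fun q hq => ?_⟩
  have hratio : μ.withDensity f (closedBall y q) / μ (closedBall y q) < t :=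
    hs ⟨hq.1, hq.2.le.trans (min_le_left _ _)⟩
  have hclosed : μ.withDensity f (closedBall y q) ≤ t * μ (closedBall y q) := by
    rcases eq_or_ne (μ (closedBall y q)) 0 with h0 | h0
    · exact (withDensity_absolutelyContinuous μ f h0).trans_le zero_le
    · exact (ENNReal.div_le_iff_le_mul (.inl h0) (.inr ht0)).1 hratio.le
  refine hclosed.trans ?_
  gcongr
  exact closedBall_subset_ball hq.2

theorem IsFiveDoublingUpTo.radius_lt (hD : IsFiveDoublingUpTo ν R D) {x z : X} {r s : ℝ}
    (hr : 0 < r) (hrR : r ≤ R) (hz : z ∈ ball x r)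
    (h : D ^ 3 * ν (ball z s) < ν (ball x r)) : s < r / 40 := by
  by_contra! hs
  refine h.not_ge ?_
  calc ν (ball x r) ≤ ν (ball z (5 ^ 3 * (r / 40))) :=
        measure_mono (ball_subset_ball' (by linarith [mem_ball'.1 hz]))
    _ ≤ D ^ 3 * ν (ball z (r / 40)) :=
        hD.measure_ball_pow_le 3 (by positivity) (by linarith)
    _ ≤ D ^ 3 * ν (ball z s) := by gcongr

/-- A stopping-time argument: a ball of almost maximal radius among those with small average. The
length property lets it grow around a given point without leaving the large ball. -/
theorem exists_ball_of_almost_maximal_radius (hlen : LengthProperty X)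
    (hinv : ∀ x y r, μ (ball x r) = μ (ball y r)) (hD : IsFiveDoublingUpTo ν R D) {x y : X} {r : ℝ}
    (hr : 0 < r) (hrR : r ≤ R) (htB : D ^ 3 * (t * μ (ball x r)) < ν (ball x r))
    (hy : y ∈ ball x r) (hyt : ∀ ρ > 0, ∃ s ∈ Ioc 0 ρ, ν (ball y s) ≤ t * μ (ball y s)) :
    ∃ z s, 0 < s ∧ s < r / 40 ∧ y ∈ ball z s ∧ ball z s ⊆ ball x r ∧
      ν (ball z s) ≤ t * μ (ball z s) ∧ t * μ (ball z s) ≤ D * ν (ball z s) := by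
  set S : Set ℝ := {s | 0 < s ∧ ∃ z, y ∈ ball z s ∧ ball z s ⊆ ball x r ∧
    ν (ball z s) ≤ t * μ (ball z s)}
  have hSlt : ∀ s ∈ S, s < r / 40 := by
    rintro s ⟨hs, z, -, hzB, hz⟩
    refine hD.radius_lt hr hrR (hzB (mem_ball_self hs)) (lt_of_le_of_lt ?_ htB)
    gcongr
    exact hz.trans (by gcongr)
  have hSbdd : BddAbove S := ⟨r / 40, fun s hs => (hSlt s hs).le⟩
  obtain ⟨s₀, hs₀, hys₀⟩ := hyt _ (sub_pos.2 (mem_ball.1 hy))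
  have hs₀S : s₀ ∈ S :=
    ⟨hs₀.1, y, mem_ball_self hs₀.1, ball_subset_ball' (by linarith [hs₀.2]), hys₀⟩
  have hsup : 0 < sSup S := hs₀.1.trans_le (le_csSup hSbdd hs₀S)
  obtain ⟨s, hsS, hsup2⟩ := exists_lt_of_lt_csSup ⟨s₀, hs₀S⟩ (half_lt_self hsup)
  have h2s : 2 * s ∉ S := fun h => by linarith [le_csSup hSbdd h]
  have hsr := hSlt s hsS
  obtain ⟨hs, z, hyz, hzB, hz⟩ := hsS
  obtain ⟨z', hxz', hz'y⟩ := hlen x y (r - 2 * s) (2 * s) (by linarith) (by linarith)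
    (by linarith [mem_ball'.1 hy])
  have hz'B : ball z' (2 * s) ⊆ ball x r := ball_subset_ball' (by linarith [dist_comm x z'])
  have hz' : t * μ (ball z' (2 * s)) < ν (ball z' (2 * s)) := by
    by_contra! hle
    exact h2s ⟨by linarith, z', mem_ball'.2 hz'y, hz'B, hle⟩
  refine ⟨z, s, hs, hsr, hyz, hzB, hz, ?_⟩
  calc t * μ (ball z s) = t * μ (ball z' s) := by rw [hinv z z']
    _ ≤ t * μ (ball z' (2 * s)) := by gcongr; linarith
    _ ≤ ν (ball z' (2 * s)) := hz'.le
    _ ≤ ν (ball z (5 * s)) := measure_mono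
        (ball_subset_ball' (by linarith [mem_ball.1 hyz, dist_triangle z' y z]))
    _ ≤ D * ν (ball z s) := hD z s hs (by linarith)

theorem IsAInftyUpTo.mul_measure_sublevel_le [ProperSpace X] [BorelSpace X]
    [IsFiniteMeasureOnCompacts μ] [IsFiniteMeasureOnCompacts (μ.withDensity f)] {t : ℝ≥0}
    (hlen : LengthProperty X) (hinv : ∀ x y r, μ (ball x r) = μ (ball y r)) (hf : Measurable f)
    (hDν : IsFiveDoublingUpTo (μ.withDensity f) R D) (hDμ : IsFiveDoublingUpTo μ (R / 5) D)
    (hε : ε ≠ 0) (hδ : δ < 1) (h : IsAInftyUpTo μ (μ.withDensity f) R ε δ) {x : X} {r : ℝ}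
    (hr : 0 < r) (hrR : r ≤ R)
    (htB : D ^ 3 * (t * μ (ball x r)) < μ.withDensity f (ball x r)) :
    t * μ {y ∈ ball x r | f y < t} ≤
      (D ^ 2 / (1 - δ) : ℝ≥0) * μ.withDensity f {y ∈ ball x r | f y < (t * ε⁻¹ : ℝ≥0)} := by
  rcases eq_or_ne t 0 with rfl | ht
  · simp
  have : IsUnifLocDoublingMeasure μ := hDμ.isUnifLocDoublingMeasure (by linarith)
  rw [← measure_inter_conull (ae_exists_ball_withDensity_le hf t), ← smul_eq_mul,
    ← Measure.smul_apply]
  refine measure_le_mul_of_forall_exists_ball (S := r) fun y hy => ?_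
  obtain ⟨⟨hyB, hyt⟩, hysmall⟩ := hy
  obtain ⟨z, s, hs, hsr, hyz, hzB, hz, hzD⟩ :=
    exists_ball_of_almost_maximal_radius hlen hinv hDν hr hrR htB hyB (hysmall hyt)
  have hportion : (1 - δ : ℝ≥0) * μ.withDensity f (ball z s) ≤
      μ.withDensity f (ball z s ∩ {q ∈ ball x r | f q < (t * ε⁻¹ : ℝ≥0)}) := by
    have := one_sub_mul_le_withDensity_sublevel hf measurableSet_ball measure_ball_lt_top.ne hε ht
      (h z s hs (by linarith)) hz
    rw [ENNReal.coe_sub, ENNReal.coe_one]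
    exact this.trans (measure_mono fun q hq => ⟨hq.1, hzB hq.1, hq.2⟩)
  have hδ0 : (1 - δ : ℝ≥0) ≠ 0 := (tsub_pos_of_lt hδ).ne'
  refine ⟨z, s, hs, by linarith, hyz, ?_⟩
  calc t * μ (ball z (5 * s)) ≤ t * (D * μ (ball z s)) := by
        gcongr
        exact hDμ z s hs (by linarith)
    _ = D * (t * μ (ball z s)) := by ring
    _ ≤ D * (D * μ.withDensity f (ball z s)) := by gcongr
    _ = (D ^ 2 / (1 - δ) : ℝ≥0) * ((1 - δ : ℝ≥0) * μ.withDensity f (ball z s)) := by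
        rw [← mul_assoc, ← mul_assoc, ← ENNReal.coe_mul, ← ENNReal.coe_mul,
          div_mul_cancel₀ _ hδ0, sq]
    _ ≤ _ := by gcongr

end LevelSets

section NegativePowers

variable {X : Type*} [MeasurableSpace X] {μ : Measure X} {f : X → ℝ≥0∞} {B : Set X}

theorem measure_sublevel_le_mul (hf : Measurable f) (hB : MeasurableSet B) (hBt : μ B ≠ ⊤)
    {C K t : ℝ≥0} (hC : 1 ≤ C) (hK : 1 ≤ K) (ht : t ≠ 0)
    (h : t * μ {y ∈ B | f y < t} ≤ C * μ.withDensity f {y ∈ B | f y < (t * K : ℝ≥0)}) :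
    μ {y ∈ B | f y < (t / (2 * C) : ℝ≥0)} ≤
      (C * K / (2⁻¹ + C * K) : ℝ≥0) * μ {y ∈ B | f y < (t * K : ℝ≥0)} := by
  set E : ℝ≥0 → Set X := fun a => {y ∈ B | f y < a}
  have hE : ∀ a, MeasurableSet (E a) := fun a => hB.inter (measurableSet_lt hf measurable_const)
  have hmono : Monotone E := fun a b hab y hy => ⟨hy.1, hy.2.trans_le (by exact_mod_cast hab)⟩
  have hlow : t / (2 * C) ≤ t := div_le_self zero_le (by linarith)
  have hupper : t ≤ t * K := le_mul_of_one_le_right zero_le hK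
  have hsub : E (t / (2 * C)) ⊆ E (t * K) := hmono (hlow.trans hupper)
  have hbound : ∀ F (a : ℝ≥0), MeasurableSet F → F ⊆ E a → μ.withDensity f F ≤ a * μ F := by
    intro F a hF ha
    rw [withDensity_apply _ hF, ← setLIntegral_const]
    exact setLIntegral_mono' hF fun y hy => (ha hy).2.le
  have hsplit : ∀ ν : Measure X,
      ν (E (t * K)) = ν (E (t / (2 * C))) + ν (E (t * K) \ E (t / (2 * C))) := fun ν => by
    rw [measure_add_sdiff (hE _).nullMeasurableSet, union_eq_self_of_subset_left hsub]
  have hmain : t * μ (E (t / (2 * C))) ≤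
      C * ((t / (2 * C) : ℝ≥0) * μ (E (t / (2 * C))) +
        (t * K : ℝ≥0) * μ (E (t * K) \ E (t / (2 * C)))) :=
    calc t * μ (E (t / (2 * C))) ≤ t * μ (E t) := by gcongr; exact hmono hlow
      _ ≤ C * μ.withDensity f (E (t * K)) := h
      _ ≤ _ := by
        rw [hsplit]
        gcongr
        · exact hbound _ _ (hE _) Subset.rfl
        · exact hbound _ _ ((hE _).diff (hE _)) sdiff_subset
  change μ (E _) ≤ _ * μ (E _)
  rw [hsplit μ]
  lift μ (E (t / (2 * C))) to ℝ≥0 using measure_ne_top_of_subset (sep_subset _ _) hBt with a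
  lift μ (E (t * K) \ E (t / (2 * C))) to ℝ≥0 using
    measure_ne_top_of_subset (sdiff_subset.trans (sep_subset _ _)) hBt with b
  norm_cast at hmain ⊢
  have hcancel : C * (t / (2 * C) * a + t * K * b) = t * (2⁻¹ * a + C * K * b) := by
    have : C ≠ 0 := (one_pos.trans_le hC).ne'
    field_simp
  rw [hcancel, mul_le_mul_iff_right₀ (pos_iff_ne_zero.2 ht)] at hmain
  rw [div_mul_eq_mul_div, le_div_iff₀ (by positivity), ← NNReal.coe_le_coe]
  rw [← NNReal.coe_le_coe] at hmain
  push_cast at hmain ⊢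
  linarith

theorem measure_sublevel_le_pow_mul (hf : Measurable f) (hB : MeasurableSet B) (hBt : μ B ≠ ⊤)
    {C K t : ℝ≥0} (hC : 1 ≤ C) (hK : 1 ≤ K) (ht : t ≠ 0)
    (h : ∀ a ≤ t, a * μ {y ∈ B | f y < a} ≤
      C * μ.withDensity f {y ∈ B | f y < (a * K : ℝ≥0)}) (j : ℕ) :
    μ {y ∈ B | f y < (t / (2 * C * K) ^ j : ℝ≥0)} ≤
      (C * K / (2⁻¹ + C * K) : ℝ≥0) ^ j * μ B := by
  induction j with
  | zero => simpa using measure_mono (sep_subset _ _)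
  | succ j ih =>
    have hK0 : K ≠ 0 := (one_pos.trans_le hK).ne'
    have hM : 1 ≤ (2 * C * K) ^ j := one_le_pow₀ (one_le_mul (by linarith) hK)
    have hstep := measure_sublevel_le_mul hf hB hBt hC hK (t := t / (2 * C * K) ^ j / K)
      (by positivity) (h _ ((div_le_self zero_le hK).trans (div_le_self zero_le hM)))
    rw [div_mul_cancel₀ _ hK0, div_div, div_div, mul_comm K, ← mul_assoc, mul_assoc _ _ K,
      ← pow_succ] at hstep
    calc _ ≤ _ := hstep
      _ ≤ (C * K / (2⁻¹ + C * K) : ℝ≥0) *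
          ((C * K / (2⁻¹ + C * K) : ℝ≥0) ^ j * μ B) := by gcongr
      _ = _ := by ring

theorem rpow_neg_le_mul_tsum_indicator {t M : ℝ≥0} {s : ℝ} (ht : t ≠ 0) (hM : 1 < M) (hs : 0 < s)
    (u : ℝ≥0∞) :
    u ^ (-s) ≤ (t : ℝ≥0∞) ^ (-s) * (1 + ∑' j : ℕ,
      (Iio ((t / M ^ j : ℝ≥0) : ℝ≥0∞)).indicator (fun _ => ((M : ℝ≥0∞) ^ s) ^ (j + 1)) u) := by
  have hM0 : M ≠ 0 := (one_pos.trans hM).ne'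
  have hanti : ∀ a ≤ u, u ^ (-s) ≤ a ^ (-s) := fun a ha => by
    rw [ENNReal.rpow_neg, ENNReal.rpow_neg]
    gcongr
  rcases le_or_gt (t : ℝ≥0∞) u with htu | hut
  · exact (hanti _ htu).trans (le_mul_of_one_le_right' (self_le_add_right _ _))
  lift u to ℝ≥0 using hut.ne_top
  rcases eq_or_ne u 0 with rfl | hu0
  · have htop : ∑' j : ℕ, (Iio ((t / M ^ j : ℝ≥0) : ℝ≥0∞)).indicator
        (fun _ => ((M : ℝ≥0∞) ^ s) ^ (j + 1)) ((0 : ℝ≥0) : ℝ≥0∞) = ⊤ := by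
      refine top_le_iff.1 ?_
      rw [← ENNReal.tsum_const_eq_top_of_ne_zero (α := ℕ) one_ne_zero]
      refine ENNReal.tsum_le_tsum fun j => ?_
      rw [indicator_of_mem (by simp only [mem_Iio, ENNReal.coe_lt_coe]; positivity)]
      exact one_le_pow₀ (ENNReal.one_le_rpow (by exact_mod_cast hM.le) hs)
    rw [htop, add_top, ENNReal.mul_top (by simp [ht])]
    exact le_top
  · obtain ⟨j, hj, hj'⟩ : ∃ j : ℕ, ¬t / M ^ j ≤ u ∧ t / M ^ (j + 1) ≤ u := by
      refine Nat.exists_not_and_succ_of_not_zero_of_exists (by simpa using hut) ?_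
      obtain ⟨j, hj⟩ := pow_unbounded_of_one_lt (t / u) hM
      exact ⟨j, (div_le_comm₀ (pos_iff_ne_zero.2 hu0) (by positivity)).1 hj.le⟩
    calc (u : ℝ≥0∞) ^ (-s) ≤ ((t / M ^ (j + 1) : ℝ≥0) : ℝ≥0∞) ^ (-s) :=
          hanti _ (by exact_mod_cast hj')
      _ = (t : ℝ≥0∞) ^ (-s) * ((M : ℝ≥0∞) ^ s) ^ (j + 1) := by
        have hquot : t / M ^ (j + 1) ≠ 0 := by positivity
        rw [← ENNReal.coe_rpow_of_ne_zero hquot, ← ENNReal.coe_rpow_of_ne_zero ht,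
          ← ENNReal.coe_rpow_of_ne_zero hM0, NNReal.div_rpow, NNReal.rpow_neg (M ^ (j + 1)),
          div_inv_eq_mul, ← NNReal.rpow_natCast, ← NNReal.rpow_mul, mul_comm (_ : ℝ) s,
          NNReal.rpow_mul, NNReal.rpow_natCast]
        norm_cast
      _ ≤ _ := by
        gcongr
        refine le_add_left (le_trans ?_ (ENNReal.le_tsum j))
        rw [indicator_of_mem (mem_Iio.2 (by exact_mod_cast not_le.1 hj))]

theorem lintegral_rpow_neg_le (hf : Measurable f) {t M θ : ℝ≥0} {s : ℝ} (ht : t ≠ 0)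
    (hM : 1 < M) (hs : 0 < s)
    (h : ∀ j : ℕ, μ {y ∈ B | f y < (t / M ^ j : ℝ≥0)} ≤ (θ : ℝ≥0∞) ^ j * μ B) :
    ∫⁻ y in B, f y ^ (-s) ∂μ ≤
      (t : ℝ≥0∞) ^ (-s) * (1 + M ^ s * (1 - M ^ s * θ : ℝ≥0∞)⁻¹) * μ B := by
  have hsub : ∀ j : ℕ, MeasurableSet {y | f y < (t / M ^ j : ℝ≥0)} := fun j =>
    measurableSet_lt hf measurable_const
  have hterm : ∀ j : ℕ, Measurable fun y =>
      (Iio ((t / M ^ j : ℝ≥0) : ℝ≥0∞)).indicator (fun _ => ((M : ℝ≥0∞) ^ s) ^ (j + 1)) (f y) :=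
    fun j => (measurable_const.indicator measurableSet_Iio).comp hf
  calc ∫⁻ y in B, f y ^ (-s) ∂μ
      ≤ ∫⁻ y in B, (t : ℝ≥0∞) ^ (-s) * (1 + ∑' j : ℕ,
          (Iio ((t / M ^ j : ℝ≥0) : ℝ≥0∞)).indicator
            (fun _ => ((M : ℝ≥0∞) ^ s) ^ (j + 1)) (f y)) ∂μ :=
        lintegral_mono fun y => rpow_neg_le_mul_tsum_indicator ht hM hs (f y)
    _ = (t : ℝ≥0∞) ^ (-s) * (μ B + ∑' j : ℕ, ((M : ℝ≥0∞) ^ s) ^ (j + 1) *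
          μ {y ∈ B | f y < (t / M ^ j : ℝ≥0)}) := by
        rw [lintegral_const_mul _ (Measurable.const_add (Measurable.tsum hterm) 1),
          lintegral_add_left measurable_const, setLIntegral_one,
          lintegral_tsum fun j => (hterm j).aemeasurable]
        congr 3 with j
        calc _ = ∫⁻ y in B, {y | f y < (t / M ^ j : ℝ≥0)}.indicator
              (fun _ => ((M : ℝ≥0∞) ^ s) ^ (j + 1)) y ∂μ := rfl
          _ = _ := by
            rw [lintegral_indicator_const (hsub j), Measure.restrict_apply (hsub j), inter_comm]
            rfl
    _ ≤ (t : ℝ≥0∞) ^ (-s) * (μ B + ∑' j : ℕ, ((M : ℝ≥0∞) ^ s) ^ (j + 1) * (θ ^ j * μ B)) := by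
        gcongr with j
        exact h j
    _ = _ := by
        have hgeom : ∀ j : ℕ, ((M : ℝ≥0∞) ^ s) ^ (j + 1) * (θ ^ j * μ B) =
            M ^ s * μ B * (M ^ s * θ) ^ j := fun j => by ring
        rw [tsum_congr hgeom, ENNReal.tsum_mul_left, ENNReal.tsum_geometric]
        ring

theorem exists_rpow_mul_lt_one {M θ : ℝ≥0} (hM : M ≠ 0) (hθ : θ < 1) :
    ∃ s : ℝ, 0 < s ∧ M ^ s * θ < 1 := by
  have hcont : ContinuousAt (fun s : ℝ => M ^ s * θ) 0 :=
    ((NNReal.continuousAt_rpow (.inl hM)).comp₂ continuousAt_const continuousAt_id).mul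
      continuousAt_const
  have hlt : ∀ᶠ s in 𝓝[>] (0 : ℝ), M ^ s * θ < 1 :=
    (hcont.eventually_lt_const (by simpa using hθ)).filter_mono nhdsWithin_le_nhds
  obtain ⟨s, hs, hs0⟩ := (hlt.and self_mem_nhdsWithin).exists
  exact ⟨s, hs0, hs⟩

theorem laverage_mul_laverage_rpow_neg_le (hf : Measurable f) {t M θ L : ℝ≥0} {s : ℝ} (ht : t ≠ 0)
    (hM : 1 < M) (hs : 0 < s) (hA : ⨍⁻ y in B, f y ∂μ = L * t)
    (h : ∀ j : ℕ, μ {y ∈ B | f y < (t / M ^ j : ℝ≥0)} ≤ (θ : ℝ≥0∞) ^ j * μ B) :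
    (⨍⁻ y in B, f y ∂μ) * (⨍⁻ y in B, f y ^ (-s) ∂μ) ^ s⁻¹ ≤
      L * (1 + M ^ s * (1 - M ^ s * θ : ℝ≥0∞)⁻¹) ^ s⁻¹ := by
  have hneg := lintegral_rpow_neg_le hf ht hM hs h
  generalize (1 + M ^ s * (1 - M ^ s * θ : ℝ≥0∞)⁻¹) = S at hneg ⊢
  have havg : ⨍⁻ y in B, f y ^ (-s) ∂μ ≤ (t : ℝ≥0∞) ^ (-s) * S := by
    rw [setLAverage_eq]
    exact ENNReal.div_le_of_le_mul hneg
  calc _ ≤ (L * t : ℝ≥0∞) * ((t : ℝ≥0∞) ^ (-s) * S) ^ s⁻¹ := by rw [hA]; gcongr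
    _ = L * (t * (t : ℝ≥0∞)⁻¹) * S ^ s⁻¹ := by
      rw [ENNReal.mul_rpow_of_nonneg _ _ (inv_nonneg.2 hs.le), ← ENNReal.rpow_mul, neg_mul,
        mul_inv_cancel₀ hs.ne', ENNReal.rpow_neg_one]
      ring
    _ = L * S ^ s⁻¹ := by
      rw [ENNReal.mul_inv_cancel (by exact_mod_cast ht) ENNReal.coe_ne_top, mul_one]

theorem exists_laverage_mul_laverage_rpow_neg_le (μ : Measure X) {C K : ℝ≥0} (hC : 1 ≤ C)
    (hK : 1 ≤ K) :
    ∃ s : ℝ, 0 < s ∧ ∃ S : ℝ≥0, ∀ {f : X → ℝ≥0∞} {B : Set X} {L : ℝ≥0}, Measurable f →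
      MeasurableSet B → μ B ≠ ⊤ → ⨍⁻ y in B, f y ∂μ ≠ ⊤ → L ≠ 0 →
      (∀ a : ℝ≥0, a ≠ 0 → L * a ≤ ⨍⁻ y in B, f y ∂μ → a * μ {y ∈ B | f y < a} ≤
        C * μ.withDensity f {y ∈ B | f y < (a * K : ℝ≥0)}) →
      (⨍⁻ y in B, f y ∂μ) * (⨍⁻ y in B, f y ^ (-s) ∂μ) ^ s⁻¹ ≤ L * S := by
  have hθ : C * K / (2⁻¹ + C * K) < 1 := by
    rw [div_lt_one (by positivity)]
    exact lt_add_of_pos_left _ (by positivity)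
  have hM : 1 < 2 * C * K := by linarith [one_le_mul hC hK]
  obtain ⟨s, hs, hsθ⟩ := exists_rpow_mul_lt_one (one_pos.trans hM).ne' hθ
  refine ⟨s, hs, (1 + (2 * C * K) ^ s * (1 - (2 * C * K) ^ s * (C * K / (2⁻¹ + C * K)))⁻¹) ^ s⁻¹,
    fun {f B L} hf hB hBt hA hL h => ?_⟩
  obtain ⟨t, ht⟩ : ∃ t : ℝ≥0, ⨍⁻ y in B, f y ∂μ = L * t :=
    ⟨(⨍⁻ y in B, f y ∂μ).toNNReal / L, by
      rw [← ENNReal.coe_mul, mul_div_cancel₀ _ hL, ENNReal.coe_toNNReal hA]⟩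
  rcases eq_or_ne t 0 with rfl | ht0
  · simp [ht]
  have hdecay := measure_sublevel_le_pow_mul hf hB hBt hC hK ht0 fun a hat => by
    rcases eq_or_ne a 0 with rfl | ha
    · simp
    · exact h a ha (by rw [ht]; gcongr)
  have hsM : ((2 * C * K : ℝ≥0) : ℝ≥0∞) ^ s = ((2 * C * K) ^ s : ℝ≥0) :=
    (ENNReal.coe_rpow_of_nonneg _ hs.le).symm
  refine (laverage_mul_laverage_rpow_neg_le hf ht0 hM hs ht hdecay).trans_eq ?_
  rw [hsM, ENNReal.coe_rpow_of_nonneg _ (inv_nonneg.2 hs.le)]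
  norm_cast
  rw [← ENNReal.coe_inv (tsub_pos_of_lt hsθ).ne']
  norm_cast

end NegativePowers

section Muckenhoupt

variable {X : Type*} [PseudoMetricSpace X] [ProperSpace X] [MeasurableSpace X] [BorelSpace X]
  {μ : Measure X} {R : ℝ}

theorem IsAInftyUpTo.exists_laverage_mul_rpow_le_of_doubling {f : X → ℝ≥0∞} {ε δ D : ℝ≥0}
    [IsFiniteMeasureOnCompacts μ] [IsFiniteMeasureOnCompacts (μ.withDensity f)]
    (hlen : LengthProperty X) (hinv : ∀ x y r, μ (ball x r) = μ (ball y r))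
    (hpos : ∀ x r, 0 < r → μ (ball x r) ≠ 0) (hf : Measurable f) (hD : D ≠ 0)
    (hDν : IsFiveDoublingUpTo (μ.withDensity f) R D) (hDμ : IsFiveDoublingUpTo μ (R / 5) D)
    (hε : ε ≠ 0) (hδ : δ < 1) (h : IsAInftyUpTo μ (μ.withDensity f) R ε δ) :
    ∃ s : ℝ, 0 < s ∧ ∃ C : ℝ≥0, ∀ x r, 0 < r → r ≤ R →
      (⨍⁻ y in ball x r, f y ∂μ) * (⨍⁻ y in ball x r, f y ^ (-s) ∂μ) ^ s⁻¹ ≤ C := by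
  obtain ⟨s, hs, S, hS⟩ := exists_laverage_mul_laverage_rpow_neg_le μ
    (le_max_left 1 (D ^ 2 / (1 - δ))) (le_max_left 1 ε⁻¹)
  refine ⟨s, hs, 2 * D ^ 3 * S, fun x r hr hrR => ?_⟩
  have hμB : μ (ball x r) ≠ ⊤ := measure_ball_lt_top.ne
  have hμB0 := hpos x r hr
  have hνB := setLAverage_mul_measure (f := f) measurableSet_ball hμB0 hμB
  have hA : ⨍⁻ y in ball x r, f y ∂μ ≠ ⊤ := fun hA =>
    (measure_ball_lt_top (μ := μ.withDensity f)).ne (by rw [← hνB, hA, ENNReal.top_mul hμB0])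
  rw [ENNReal.coe_mul]
  refine hS hf measurableSet_ball hμB hA (by positivity) fun a ha haA => ?_
  have hlarge : (D : ℝ≥0∞) ^ 3 * (a * μ (ball x r)) < μ.withDensity f (ball x r) := by
    rw [← hνB, ← mul_assoc]
    refine ENNReal.mul_lt_mul_left hμB0 hμB (lt_of_lt_of_le ?_ haA)
    have : D ^ 3 * a < 2 * D ^ 3 * a := by
      rw [mul_assoc 2]; exact lt_two_mul_self (by positivity)
    exact_mod_cast this
  refine (h.mul_measure_sublevel_le hlen hinv hf hDν hDμ hε hδ hr hrR hlarge).trans ?_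
  gcongr
  · exact le_max_right _ _
  · exact le_max_right _ _

theorem IsAInftyUpTo.exists_laverage_mul_rpow_le {f : X → ℝ≥0∞} {ε δ D : ℝ≥0}
    [IsFiniteMeasureOnCompacts μ] [IsFiniteMeasureOnCompacts (μ.withDensity f)]
    (hlen : LengthProperty X) (hinv : ∀ x y r, μ (ball x r) = μ (ball y r))
    (hpos : ∀ x r, 0 < r → μ (ball x r) ≠ 0) (hf : Measurable f)
    (hD : IsFiveDoublingUpTo (μ.withDensity f) R D) (hε : ε ≠ 0) (hδ : δ < 1)
    (h : IsAInftyUpTo μ (μ.withDensity f) R ε δ) :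
    ∃ s : ℝ, 0 < s ∧ ∃ C : ℝ≥0, ∀ x r, 0 < r → r ≤ R →
      (⨍⁻ y in ball x r, f y ∂μ) * (⨍⁻ y in ball x r, f y ^ (-s) ∂μ) ^ s⁻¹ ≤ C := by
  rcases eq_or_ne (μ.withDensity f) 0 with hν | hν
  · refine ⟨1, one_pos, 0, fun x r _ _ => ?_⟩
    rw [setLAverage_eq, ← withDensity_apply _ measurableSet_ball, hν]
    simp
  obtain ⟨D', hD'⟩ := h.exists_isFiveDoublingUpTo hlen hinv
    (fun _ _ => measure_ball_lt_top.ne) hν hD hε hδ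
  exact h.exists_laverage_mul_rpow_le_of_doubling (D := max 1 (max D D')) hlen hinv hpos hf
    (one_pos.trans_le (le_max_left _ _)).ne' (hD.mono (by simp)) (hD'.mono (by simp)) hε hδ

theorem cond3_of_cond1 {w : X → ℝ} [IsFiniteMeasureOnCompacts μ]
    [IsFiniteMeasureOnCompacts (weightMeasure μ w)]
    (hlen : LengthProperty X) (hinv : ∀ x y r, μ (ball x r) = μ (ball y r))
    (hpos : ∀ x r, 0 < r → μ (ball x r) ≠ 0) (hw : AEMeasurable w μ)
    (hD : FiveDoubling ball μ w R) (h : Cond1 ball μ w R) : Cond3 ball μ w R := by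
  obtain ⟨D, -, hD⟩ := hD
  obtain ⟨ε, hε, δ, hδ, h⟩ := h
  have hae := hw.ennreal_ofReal.ae_eq_mk
  have hν : weightMeasure μ w = μ.withDensity (hw.ennreal_ofReal.mk _) := withDensity_congr_ae hae
  have hfin : IsFiniteMeasureOnCompacts (weightMeasure μ w) := inferInstance
  rw [hν] at hfin
  simp only [hν] at hD h
  obtain ⟨s, hs, C, hC⟩ := IsAInftyUpTo.exists_laverage_mul_rpow_le (D := D.toNNReal)
    (ε := ε.toNNReal) (δ := δ.toNNReal) hlen hinv hpos hw.ennreal_ofReal.measurable_mk hD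
    (by simpa using hε.1) (by simpa using hδ.2) h
  have hconj : (1 + s⁻¹).HolderConjugate (1 + s) := by
    rw [Real.holderConjugate_iff]
    refine ⟨by linarith [inv_pos.2 hs], ?_⟩
    field_simp
    ring
  refine ⟨1 + s⁻¹, 1 + s, hconj, C + 1, by positivity, fun x r hr hrR => ?_⟩
  have hrpow : (fun y => ENNReal.ofReal (w y) ^ (-s)) =ᵐ[μ]
      fun y => hw.ennreal_ofReal.mk _ y ^ (-s) := hae.fun_comp (· ^ (-s))
  have hexp : (1 + s) / (1 + s⁻¹) = s := by field_simp; ring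
  rw [← inv_div (1 + s), hexp, laverage_congr (ae_restrict_of_ae hae),
    laverage_congr (ae_restrict_of_ae hrpow)]
  exact (hC x r hr hrR).trans (by
    rw [← ENNReal.ofReal_coe_nnreal]
    exact ENNReal.ofReal_le_ofReal (by linarith))

end Muckenhoupt

end LocalMuckenhoupt

namespace SubRiemannian

open Filter Topology
open scoped NNReal

section AbsolutelyContinuousOnInterval

variable {X Y Z : Type*} [PseudoMetricSpace X] [PseudoMetricSpace Y] [PseudoMetricSpace Z]
  {f : ℝ → X} {a b c : ℝ} {K : ℝ≥0}

theorem absolutelyContinuousOnInterval_of_dist_le_mul_add {g : ℝ → Y} {h : ℝ → Z}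
    (hg : AbsolutelyContinuousOnInterval g a b) (hh : AbsolutelyContinuousOnInterval h a b)
    (hf : ∀ s ∈ uIcc a b, ∀ t ∈ uIcc a b,
      dist (f s) (f t) ≤ K * (dist (g s) (g t) + dist (h s) (h t))) :
    AbsolutelyContinuousOnInterval f a b := by
  have hlim := (Tendsto.add hg hh).const_mul (K : ℝ)
  rw [add_zero, mul_zero] at hlim
  refine squeeze_zero' (Eventually.of_forall fun E => Finset.sum_nonneg fun i _ => dist_nonneg)
    ?_ hlim
  filter_upwards [mem_inf_of_right (mem_principal_self _)] with E hE
  rw [← Finset.sum_add_distrib, Finset.mul_sum]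
  exact Finset.sum_le_sum fun i hi => hf _ (hE.1 i hi).1 _ (hE.1 i hi).2

theorem absolutelyContinuousOnInterval_congr {g : ℝ → X}
    (hf : AbsolutelyContinuousOnInterval f a b) (h : EqOn f g (uIcc a b)) :
    AbsolutelyContinuousOnInterval g a b :=
  absolutelyContinuousOnInterval_of_dist_le_mul_add (K := 1) hf hf fun s hs t ht => by
    rw [h hs, h ht, NNReal.coe_one, one_mul]
    exact le_add_of_nonneg_left dist_nonneg

theorem absolutelyContinuousOnInterval_lipschitzOnWith_comp {g : X → Y} {s : Set X}
    (hg : LipschitzOnWith K g s) (hf : AbsolutelyContinuousOnInterval f a b)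
    (hs : MapsTo f (uIcc a b) s) : AbsolutelyContinuousOnInterval (fun t => g (f t)) a b :=
  absolutelyContinuousOnInterval_of_dist_le_mul_add hf hf fun p hp q hq =>
    (hg.dist_le_mul _ (hs hp) _ (hs hq)).trans <| by
      gcongr
      exact le_add_of_nonneg_left dist_nonneg

theorem disjoint_uIoc_map {φ : ℝ → ℝ} (hφ : Monotone φ ∨ Antitone φ) {p q r s : ℝ}
    (h : Disjoint (uIoc p q) (uIoc r s)) :
    Disjoint (uIoc (φ p) (φ q)) (uIoc (φ r) (φ s)) := by
  rw [uIoc, uIoc, Ioc_disjoint_Ioc] at h ⊢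
  rcases hφ with hφ | hφ
  · simpa only [hφ.map_max, hφ.map_min] using hφ h
  · simpa only [hφ.map_max, hφ.map_min] using hφ h

theorem absolutelyContinuousOnInterval_comp {φ : ℝ → ℝ} (hK : LipschitzWith K φ)
    (hφ : Monotone φ ∨ Antitone φ) (hf : AbsolutelyContinuousOnInterval f (φ a) (φ b)) :
    AbsolutelyContinuousOnInterval (fun t => f (φ t)) a b := by
  have hmaps : MapsTo φ (uIcc a b) (uIcc (φ a) (φ b)) :=
    hφ.elim (fun h => h.mapsTo_uIcc) fun h => h.mapsTo_uIcc
  let Φ : ℕ × (ℕ → ℝ × ℝ) → ℕ × (ℕ → ℝ × ℝ) := fun E => (E.1, fun i => (φ (E.2 i).1, φ (E.2 i).2))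
  suffices hΦ : Tendsto Φ
      (AbsolutelyContinuousOnInterval.totalLengthFilter ⊓
        𝓟 (AbsolutelyContinuousOnInterval.disjWithin a b))
      (AbsolutelyContinuousOnInterval.totalLengthFilter ⊓
        𝓟 (AbsolutelyContinuousOnInterval.disjWithin (φ a) (φ b))) from hf.comp hΦ
  refine (tendsto_comap_iff.2 ?_).inf (tendsto_principal_principal.2 fun E hE =>
    ⟨fun i hi => ⟨hmaps (hE.1 i hi).1, hmaps (hE.1 i hi).2⟩,
      fun i hi j hj hij => disjoint_uIoc_map hφ (hE.2 hi hj hij)⟩)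
  have hlim := (tendsto_comap (f := fun E : ℕ × (ℕ → ℝ × ℝ) =>
    ∑ i ∈ Finset.range E.1, dist (E.2 i).1 (E.2 i).2) (x := 𝓝 0)).const_mul (K : ℝ)
  rw [mul_zero] at hlim
  refine squeeze_zero (fun E => Finset.sum_nonneg fun i _ => dist_nonneg) (fun E => ?_) hlim
  rw [Finset.mul_sum]
  exact Finset.sum_le_sum fun i _ => hK.dist_le_mul _ _

theorem absolutelyContinuousOnInterval_trans (hab : a ≤ b) (hbc : b ≤ c)
    (h₁ : AbsolutelyContinuousOnInterval f a b) (h₂ : AbsolutelyContinuousOnInterval f b c) :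
    AbsolutelyContinuousOnInterval f a c := by
  have hmin : AbsolutelyContinuousOnInterval (fun t => f (min t b)) a c :=
    absolutelyContinuousOnInterval_comp (LipschitzWith.id.min_const b)
      (.inl fun s t h => min_le_min_right b h) (by simpa [hab, hbc] using h₁)
  have hmax : AbsolutelyContinuousOnInterval (fun t => f (max t b)) a c :=
    absolutelyContinuousOnInterval_comp (LipschitzWith.id.max_const b)
      (.inl fun s t h => max_le_max_right b h) (by simpa [hab, hbc] using h₂)
  refine absolutelyContinuousOnInterval_of_dist_le_mul_add (K := 1) hmin hmax fun s _ t _ => ?_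
  rw [NNReal.coe_one, one_mul]
  rcases le_total s b with hs | hs <;> rcases le_total t b with ht | ht <;>
    simp only [min_eq_left, min_eq_right, max_eq_left, max_eq_right, hs, ht, dist_self,
      add_zero, zero_add, le_refl]
  · exact dist_triangle _ _ _
  · rw [add_comm]
    exact dist_triangle _ _ _

theorem absolutelyContinuousOnInterval_of_local (hab : a ≤ b)
    (h : ∀ t ∈ Icc a b, ∃ U ∈ 𝓝 t, ∀ p q, a ≤ p → p ≤ q → q ≤ b → Icc p q ⊆ U →
      AbsolutelyContinuousOnInterval f p q) : AbsolutelyContinuousOnInterval f a b := by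
  choose! U hU hAC using h
  obtain ⟨t, ht0, htm, ⟨N, hN⟩, htU⟩ := exists_monotone_Icc_subset_open_cover_Icc hab
    (c := fun x : Icc a b => Subtype.val ⁻¹' interior (U x))
    (fun x => isOpen_interior.preimage continuous_subtype_val)
    (fun x _ => mem_iUnion.2 ⟨x, mem_interior_iff_mem_nhds.2 (hU x x.2)⟩)
  have initial : ∀ k : ℕ, AbsolutelyContinuousOnInterval f a (t k) := by
    intro k
    induction k with
    | zero =>
      have ha : a ∈ Icc a b := left_mem_Icc.2 hab
      rw [ht0]
      exact hAC a ha a a le_rfl le_rfl hab (by simpa using mem_of_mem_nhds (hU a ha))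
    | succ k ih =>
      obtain ⟨x, hx⟩ := htU k
      have hle : (t k : ℝ) ≤ t (k + 1) := htm (Nat.le_succ k)
      exact absolutelyContinuousOnInterval_trans (t k).2.1 hle ih
        (hAC x x.2 _ _ (t k).2.1 hle (t (k + 1)).2.2 fun s hs =>
          interior_subset (@hx ⟨s, (t k).2.1.trans hs.1, hs.2.trans (t (k + 1)).2.2⟩ hs))
  simpa only [hN N le_rfl] using initial N

end AbsolutelyContinuousOnInterval

section AbsolutelyContinuousCurves

variable {n : ℕ} {G : Type*} [TopologicalSpace G] [ChartedSpace (EuclideanSpace ℝ (Fin n)) G]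
  {γ γ' : ℝ → G} {a b c d : ℝ}

/-- Absolute continuity on `[a, b]` of a curve in a manifold, in the sense of `IsAbsContCurve`. -/
def IsAbsContOn (n : ℕ) {G : Type*} [TopologicalSpace G]
    [ChartedSpace (EuclideanSpace ℝ (Fin n)) G] (γ : ℝ → G) (a b : ℝ) : Prop :=
  ContinuousOn γ (Icc a b) ∧
    ∀ (x : G) (c d : ℝ), a ≤ c → c ≤ d → d ≤ b →
      MapsTo γ (Icc c d) (chartAt (EuclideanSpace ℝ (Fin n)) x).source →
      AbsolutelyContinuousOnInterval (fun t => chartAt (EuclideanSpace ℝ (Fin n)) x (γ t)) c d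

theorem IsAbsContOn.mono (h : IsAbsContOn n γ a b) (hac : a ≤ c) (hdb : d ≤ b) :
    IsAbsContOn n γ c d :=
  ⟨h.1.mono (Icc_subset_Icc hac hdb), fun x p q hp hpq hq hm =>
    h.2 x p q (hac.trans hp) hpq (hq.trans hdb) hm⟩

theorem IsAbsContOn.congr (h : IsAbsContOn n γ a b) (heq : EqOn γ γ' (Icc a b)) :
    IsAbsContOn n γ' a b := by
  refine ⟨h.1.congr heq.symm, fun x p q hp hpq hq hm => ?_⟩
  have heq' : EqOn γ γ' (Icc p q) := heq.mono (Icc_subset_Icc hp hq)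
  refine absolutelyContinuousOnInterval_congr
    (h.2 x p q hp hpq hq fun t ht => by rw [heq' ht]; exact hm ht) fun t ht => ?_
  rw [uIcc_of_le hpq] at ht
  simp only [heq' ht]

theorem IsAbsContOn.union (hab : a ≤ b) (hbc : b ≤ c) (h₁ : IsAbsContOn n γ a b)
    (h₂ : IsAbsContOn n γ b c) : IsAbsContOn n γ a c := by
  refine ⟨?_, fun x p q hp hpq hq hm => ?_⟩
  · rw [← Icc_union_Icc_eq_Icc hab hbc]
    exact h₁.1.union_of_isClosed h₂.1 isClosed_Icc isClosed_Icc
  rcases le_total q b with hqb | hqb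
  · exact h₁.2 x p q hp hpq hqb hm
  rcases le_total b p with hbp | hbp
  · exact h₂.2 x p q hbp hpq hq hm
  exact absolutelyContinuousOnInterval_trans hbp hqb
    (h₁.2 x p b hp hbp le_rfl (hm.mono_left (Icc_subset_Icc le_rfl hqb)))
    (h₂.2 x b q le_rfl hqb hq (hm.mono_left (Icc_subset_Icc hbp le_rfl)))

theorem IsAbsContOn.absolutelyContinuousOnInterval (h : IsAbsContOn n γ a b) (x : G)
    (hsub : uIcc c d ⊆ Icc a b)
    (hm : MapsTo γ (uIcc c d) (chartAt (EuclideanSpace ℝ (Fin n)) x).source) :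
    AbsolutelyContinuousOnInterval (fun t => chartAt (EuclideanSpace ℝ (Fin n)) x (γ t)) c d := by
  have hc := hsub left_mem_uIcc
  have hd := hsub right_mem_uIcc
  rcases le_total c d with hcd | hcd
  · exact h.2 x c d hc.1 hcd hd.2 (by rwa [uIcc_of_le hcd] at hm)
  · exact (h.2 x d c hd.1 hcd hc.2 (by rwa [uIcc_of_ge hcd] at hm)).symm

theorem IsAbsContOn.comp_reparametrization {φ : ℝ → ℝ} {K : ℝ≥0} {p q : ℝ}
    (h : IsAbsContOn n γ p q) (hK : LipschitzWith K φ) (hφ : Monotone φ ∨ Antitone φ)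
    (hmaps : MapsTo φ (Icc a b) (Icc p q)) : IsAbsContOn n (fun t => γ (φ t)) a b := by
  refine ⟨h.1.comp hK.continuous.continuousOn hmaps, fun x c d hac hcd hdb hm => ?_⟩
  have himg : uIcc (φ c) (φ d) ⊆ φ '' Icc c d := by
    rw [← uIcc_of_le hcd]
    exact intermediate_value_uIcc hK.continuous.continuousOn
  refine absolutelyContinuousOnInterval_comp (f := fun t => chartAt _ x (γ t)) hK hφ
    (h.absolutelyContinuousOnInterval x ?_ ?_)
  · exact himg.trans (hmaps.mono_left (Icc_subset_Icc hac hdb)).image_subset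
  · intro t ht
    obtain ⟨s, hs, rfl⟩ := himg ht
    exact hm hs

theorem exists_mem_nhds_inter_mapsTo {X Y : Type*} [TopologicalSpace X] [TopologicalSpace Y]
    {f : X → Y} {s : Set X} {t : Set Y} {x : X} (hf : ContinuousWithinAt f s x)
    (ht : t ∈ 𝓝 (f x)) : ∃ V ∈ 𝓝 x, MapsTo f (V ∩ s) t :=
  mem_nhdsWithin_iff_exists_mem_nhds_inter.1 (hf ht)

theorem absolutelyContinuousOnInterval_chartAt_of_local [IsManifold (𝓡 n) ∞ G] {x : G} {t : ℝ}
    {F : EuclideanSpace ℝ (Fin n) → G} {u : ℝ → EuclideanSpace ℝ (Fin n)} {U : Set ℝ}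
    (hF : ContMDiffAt 𝓘(ℝ, EuclideanSpace ℝ (Fin n)) (𝓡 n) 1 F (u t))
    (hx : F (u t) ∈ (chartAt (EuclideanSpace ℝ (Fin n)) x).source)
    (hu : ContinuousWithinAt u (Icc a b) t) (hU : U ∈ 𝓝 t) (hγ : ∀ s ∈ U ∩ Icc a b, γ s = F (u s))
    (hAC : ∀ p q, a ≤ p → p ≤ q → q ≤ b → Icc p q ⊆ U → AbsolutelyContinuousOnInterval u p q) :
    ∃ V ∈ 𝓝 t, ∀ p q, a ≤ p → p ≤ q → q ≤ b → Icc p q ⊆ V →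
      AbsolutelyContinuousOnInterval (fun s => chartAt (EuclideanSpace ℝ (Fin n)) x (γ s))
        p q := by
  have hchart : ContMDiffAt (𝓡 n) 𝓘(ℝ, EuclideanSpace ℝ (Fin n)) 1 (extChartAt (𝓡 n) x)
      (F (u t)) := contMDiffAt_extChartAt' hx
  obtain ⟨K, s, hs, hLip⟩ := (hchart.comp (u t) hF).contDiffAt.exists_lipschitzOnWith
  obtain ⟨V, hV, hVs⟩ := exists_mem_nhds_inter_mapsTo hu hs
  refine ⟨U ∩ V, inter_mem hU hV, fun p q hap hpq hqb hsub => ?_⟩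
  have hsubab : Icc p q ⊆ Icc a b := Icc_subset_Icc hap hqb
  have hACu := hAC p q hap hpq hqb (hsub.trans inter_subset_left)
  refine absolutelyContinuousOnInterval_congr
    (absolutelyContinuousOnInterval_lipschitzOnWith_comp hLip hACu ?_) ?_ <;> rw [uIcc_of_le hpq]
  · exact fun y hy => hVs ⟨(hsub hy).2, hsubab hy⟩
  · intro y hy
    simp only [hγ y ⟨(hsub hy).1, hsubab hy⟩, Function.comp_apply, extChartAt, mfld_simps]

theorem IsAbsContOn.of_local [IsManifold (𝓡 n) ∞ G]
    (h : ∀ t ∈ Icc a b, ∃ U ∈ 𝓝 t, ∃ (F : EuclideanSpace ℝ (Fin n) → G)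
      (u : ℝ → EuclideanSpace ℝ (Fin n)),
      ContMDiffAt 𝓘(ℝ, EuclideanSpace ℝ (Fin n)) (𝓡 n) 1 F (u t) ∧
      ContinuousWithinAt u (Icc a b) t ∧ (∀ s ∈ U ∩ Icc a b, γ s = F (u s)) ∧
      ∀ p q, a ≤ p → p ≤ q → q ≤ b → Icc p q ⊆ U → AbsolutelyContinuousOnInterval u p q) :
    IsAbsContOn n γ a b := by
  refine ⟨fun t ht => ?_, fun x c d hac hcd hdb hm => ?_⟩
  · obtain ⟨U, hU, F, u, hF, hu, hγ, -⟩ := h t ht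
    refine (hF.continuousAt.comp_continuousWithinAt hu).congr_of_eventuallyEq ?_
      (hγ t ⟨mem_of_mem_nhds hU, ht⟩)
    filter_upwards [mem_nhdsWithin_of_mem_nhds hU, self_mem_nhdsWithin] with s hs hs'
      using hγ s ⟨hs, hs'⟩
  · refine absolutelyContinuousOnInterval_of_local hcd fun t ht => ?_
    have htab : t ∈ Icc a b := Icc_subset_Icc hac hdb ht
    obtain ⟨U, hU, F, u, hF, hu, hγ, hAC⟩ := h t htab
    obtain ⟨V, hV, hVAC⟩ := absolutelyContinuousOnInterval_chartAt_of_local (x := x) hF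
      (by rw [← hγ t ⟨mem_of_mem_nhds hU, htab⟩]; exact hm ht) hu hU hγ hAC
    exact ⟨V, hV, fun p q hcp hpq hqd => hVAC p q (hac.trans hcp) hpq (hqd.trans hdb)⟩

theorem IsAbsContOn.comp [IsManifold (𝓡 n) ∞ G] (h : IsAbsContOn n γ a b) {f : G → G}
    (hf : ContMDiff (𝓡 n) (𝓡 n) 1 f) : IsAbsContOn n (fun t => f (γ t)) a b := by
  refine IsAbsContOn.of_local fun t ht => ?_
  set e := chartAt (EuclideanSpace ℝ (Fin n)) (γ t)
  obtain ⟨V, hV, hVs⟩ := exists_mem_nhds_inter_mapsTo (h.1 t ht)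
    (chart_source_mem_nhds (EuclideanSpace ℝ (Fin n)) (γ t))
  have hsymm : ContMDiffOn 𝓘(ℝ, EuclideanSpace ℝ (Fin n)) (𝓡 n) 1 (extChartAt (𝓡 n) (γ t)).symm
    (extChartAt (𝓡 n) (γ t)).target := contMDiffOn_extChartAt_symm _
  refine ⟨V, hV, fun v => f (e.symm v), fun s => e (γ s), ?_, ?_, ?_, ?_⟩
  · exact (hf (e.symm (e (γ t)))).comp _ (hsymm.contMDiffAt
      ((isOpen_extChartAt_target _).mem_nhds (mem_extChartAt_target _)))
  · exact (e.continuousAt (mem_chart_source _ _)).comp_continuousWithinAt (h.1 t ht)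
  · exact fun s hs => by simp only [e.left_inv (hVs hs)]
  · exact fun p q hap hpq hqb hsub => h.2 (γ t) p q hap hpq hqb fun y hy =>
      hVs ⟨hsub hy, Icc_subset_Icc hap hqb hy⟩

end AbsolutelyContinuousCurves

section Horizontal

variable {n : ℕ} {G : Type*} [TopologicalSpace G] [ChartedSpace (EuclideanSpace ℝ (Fin n)) G]
  [Group G]

/-- Differentiability at time `t`, with velocity in the left-invariant distribution of `𝓗`. -/
def IsHorizontalAt (𝓗 : Submodule ℝ (GroupLieAlgebra (𝓡 n) G)) (γ : ℝ → G) (t : ℝ) : Prop :=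
  MDifferentiableAt 𝓘(ℝ, ℝ) (𝓡 n) γ t ∧ velocity n γ t ∈ distribution 𝓗 (γ t)

/-- The left-invariant norm of the velocity, as an extended non-negative real. -/
noncomputable def speed (Q : LinearMap.BilinForm ℝ (GroupLieAlgebra (𝓡 n) G)) (γ : ℝ → G) (t : ℝ) :
    ℝ≥0∞ :=
  ENNReal.ofReal (tangentNorm Q (γ t) (velocity n γ t))

/-- Horizontal curves parametrized by an arbitrary interval `[a, b]`. -/
def IsHorizontalOn (𝓗 : Submodule ℝ (GroupLieAlgebra (𝓡 n) G)) (γ : ℝ → G) (a b : ℝ) : Prop :=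
  IsAbsContOn n γ a b ∧ ∀ᵐ t ∂(volume.restrict (Icc a b)), IsHorizontalAt 𝓗 γ t

/-- The length of the restriction of a curve to `[a, b]`. -/
noncomputable def lengthOn (Q : LinearMap.BilinForm ℝ (GroupLieAlgebra (𝓡 n) G)) (γ : ℝ → G)
    (a b : ℝ) : ℝ≥0∞ :=
  ∫⁻ t in Icc a b, speed Q γ t

variable {𝓗 : Submodule ℝ (GroupLieAlgebra (𝓡 n) G)}
  {Q : LinearMap.BilinForm ℝ (GroupLieAlgebra (𝓡 n) G)} {γ γ' γ₁ γ₂ : ℝ → G} {a b c d t : ℝ}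
  {x y z : G}

theorem mem_horizontalCurves_iff :
    γ ∈ horizontalCurves 𝓗 x y ↔ IsHorizontalOn 𝓗 γ 0 1 ∧ γ 0 = x ∧ γ 1 = y :=
  ⟨fun h => ⟨⟨h.1, h.2.2.2⟩, h.2.1, h.2.2.1⟩, fun h => ⟨h.1.1, h.2.1, h.2.2, h.1.2⟩⟩

theorem tangentNorm_smul (α : ℝ) (v : TangentSpace (𝓡 n) x) :
    tangentNorm Q x (α • v) = |α| * tangentNorm Q x v := by
  have hsqrt : ∀ Z : GroupLieAlgebra (𝓡 n) G, √(Q (α • Z) (α • Z)) = |α| * √(Q Z Z) := by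
    intro Z
    rw [map_smul, map_smul, LinearMap.smul_apply, smul_eq_mul, smul_eq_mul, ← mul_assoc,
      Real.sqrt_mul (mul_self_nonneg α), Real.sqrt_mul_self_eq_abs]
  have hlin : mfderiv (𝓡 n) (𝓡 n) (fun y : G => x⁻¹ * y) x (α • v) =
      α • mfderiv (𝓡 n) (𝓡 n) (fun y : G => x⁻¹ * y) x v := map_smul _ α v
  exact (congrArg (fun Z : GroupLieAlgebra (𝓡 n) G => √(Q Z Z)) hlin).trans (hsqrt _)

theorem smul_mem_distribution (α : ℝ) {v : TangentSpace (𝓡 n) x} (hv : v ∈ distribution 𝓗 x) :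
    α • v ∈ distribution 𝓗 x := by
  obtain ⟨X, hX, rfl⟩ := hv
  exact ⟨α • X, 𝓗.smul_mem α hX, by rw [mulInvariantVectorField_smul]; rfl⟩

theorem apply_velocity_congr {M α : Type*} [TopologicalSpace M]
    [ChartedSpace (EuclideanSpace ℝ (Fin n)) M] {γ γ' : ℝ → M}
    (P : ∀ x : M, TangentSpace (𝓡 n) x → α) (heq : γ =ᶠ[𝓝 t] γ') :
    P (γ t) (velocity n γ t) = P (γ' t) (velocity n γ' t) := by
  have hv : (velocity n γ t : EuclideanSpace ℝ (Fin n)) = velocity n γ' t :=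
    congrArg (fun L : ℝ →L[ℝ] EuclideanSpace ℝ (Fin n) => L 1)
      (heq.mfderiv_eq (I := 𝓘(ℝ, ℝ)) (I' := 𝓡 n))
  have hP : ∀ (x y : M) (v w : EuclideanSpace ℝ (Fin n)), x = y → v = w → P x v = P y w := by
    rintro x _ v _ rfl rfl
    rfl
  exact hP _ _ _ _ heq.eq_of_nhds hv

theorem IsHorizontalAt.congr (h : IsHorizontalAt 𝓗 γ t) (heq : γ =ᶠ[𝓝 t] γ') :
    IsHorizontalAt 𝓗 γ' t :=
  ⟨h.1.congr_of_eventuallyEq heq.symm,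
    (apply_velocity_congr (fun x v => v ∈ distribution 𝓗 x) heq).mp h.2⟩

theorem speed_congr (heq : γ =ᶠ[𝓝 t] γ') : speed Q γ t = speed Q γ' t :=
  apply_velocity_congr (fun x v => ENNReal.ofReal (tangentNorm Q x v)) heq

theorem lengthOn_eq_Ioo : lengthOn Q γ a b = ∫⁻ t in Ioo a b, speed Q γ t :=
  setLIntegral_congr Ioo_ae_eq_Icc.symm

theorem IsHorizontalOn.mono (h : IsHorizontalOn 𝓗 γ a b) (hac : a ≤ c) (hdb : d ≤ b) :
    IsHorizontalOn 𝓗 γ c d :=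
  ⟨h.1.mono hac hdb, ae_mono (Measure.restrict_mono (Icc_subset_Icc hac hdb) le_rfl) h.2⟩

theorem IsHorizontalOn.congr (h : IsHorizontalOn 𝓗 γ a b) (heq : EqOn γ γ' (Icc a b)) :
    IsHorizontalOn 𝓗 γ' a b := by
  refine ⟨h.1.congr heq, ?_⟩
  have hae := h.2
  rw [← restrict_Ioo_eq_restrict_Icc] at hae ⊢
  filter_upwards [hae, ae_restrict_mem measurableSet_Ioo] with t ht htI
  exact ht.congr (eventually_of_mem (Icc_mem_nhds htI.1 htI.2) heq)

theorem lengthOn_congr (heq : EqOn γ γ' (Icc a b)) : lengthOn Q γ a b = lengthOn Q γ' a b := by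
  rw [lengthOn_eq_Ioo, lengthOn_eq_Ioo]
  exact setLIntegral_congr_fun measurableSet_Ioo fun t ht =>
    speed_congr (eventually_of_mem (Icc_mem_nhds ht.1 ht.2) heq)

theorem IsHorizontalOn.union (hab : a ≤ b) (hbc : b ≤ c) (h₁ : IsHorizontalOn 𝓗 γ a b)
    (h₂ : IsHorizontalOn 𝓗 γ b c) : IsHorizontalOn 𝓗 γ a c := by
  refine ⟨h₁.1.union hab hbc h₂.1, ?_⟩
  rw [← Icc_union_Icc_eq_Icc hab hbc, ae_restrict_union_iff]
  exact ⟨h₁.2, h₂.2⟩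

theorem lengthOn_add (hab : a ≤ b) (hbc : b ≤ c) :
    lengthOn Q γ a b + lengthOn Q γ b c = lengthOn Q γ a c := by
  have hIoc : lengthOn Q γ b c = ∫⁻ t in Ioc b c, speed Q γ t :=
    setLIntegral_congr Ioc_ae_eq_Icc.symm
  rw [hIoc, lengthOn, lengthOn, ← Icc_union_Ioc_eq_Icc hab hbc, lintegral_union measurableSet_Ioc]
  rw [Set.disjoint_left]
  exact fun t ht ht' => absurd ht'.1 (not_lt.2 ht.2)

theorem lengthOn_self : lengthOn Q γ a a = 0 := by
  rw [lengthOn, Icc_self]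
  exact setLIntegral_measure_zero _ _ Real.volume_singleton

theorem lengthOn_mono (hac : a ≤ c) (hdb : d ≤ b) : lengthOn Q γ c d ≤ lengthOn Q γ a b :=
  lintegral_mono_set (Icc_subset_Icc hac hdb)

end Horizontal

section Reparametrization

variable {n : ℕ} {G : Type*} [TopologicalSpace G] [ChartedSpace (EuclideanSpace ℝ (Fin n)) G]

theorem velocity_comp {γ : ℝ → G} {φ : ℝ → ℝ} {α t : ℝ} (hφ : HasDerivAt φ α t)
    (hγ : MDifferentiableAt 𝓘(ℝ, ℝ) (𝓡 n) γ (φ t)) :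
    velocity n (fun s => γ (φ s)) t = α • velocity n γ (φ t) := by
  have hcomp := (hγ.hasMFDerivAt.comp t hφ.hasFDerivAt.hasMFDerivAt).mfderiv
  refine (congrArg (fun L : ℝ →L[ℝ] EuclideanSpace ℝ (Fin n) => L 1) hcomp).trans ?_
  refine (congrArg (mfderiv 𝓘(ℝ, ℝ) (𝓡 n) γ (φ t)) ?_).trans
    (ContinuousLinearMap.map_smul _ α (1 : ℝ))
  exact (ContinuousLinearMap.toSpanSingleton_apply ℝ α (1 : ℝ)).trans (mul_comm _ _)

variable [Group G] {𝓗 : Submodule ℝ (GroupLieAlgebra (𝓡 n) G)}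
  {Q : LinearMap.BilinForm ℝ (GroupLieAlgebra (𝓡 n) G)} {γ γ₁ γ₂ : ℝ → G} {a b c d t α β : ℝ}
  {φ : ℝ → ℝ}

theorem IsHorizontalAt.comp (h : IsHorizontalAt 𝓗 γ (φ t)) (hφ : HasDerivAt φ α t) :
    IsHorizontalAt 𝓗 (fun s => γ (φ s)) t := by
  refine ⟨h.1.comp t hφ.differentiableAt.mdifferentiableAt, ?_⟩
  rw [velocity_comp hφ h.1]
  exact smul_mem_distribution α h.2

theorem speed_comp (hφ : HasDerivAt φ α t) (hγ : MDifferentiableAt 𝓘(ℝ, ℝ) (𝓡 n) γ (φ t)) :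
    speed Q (fun s => γ (φ s)) t = ENNReal.ofReal |α| * speed Q γ (φ t) := by
  rw [speed, speed, ← ENNReal.ofReal_mul (abs_nonneg α), velocity_comp hφ hγ]
  exact congrArg ENNReal.ofReal (tangentNorm_smul α _)

theorem ae_restrict_comp_mul_add {P : ℝ → Prop} {s t : Set ℝ} (hα : α ≠ 0)
    (h : ∀ᵐ τ ∂(volume.restrict t), P τ) (hst : MapsTo (fun τ => α * τ + β) s t) :
    ∀ᵐ τ ∂(volume.restrict s), P (α * τ + β) :=
  (((measurePreserving_add_right volume β).quasiMeasurePreserving.comp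
    (Measure.quasiMeasurePreserving_smul volume hα)).restrict hst).ae h

theorem IsHorizontalOn.comp_mul_add (h : IsHorizontalOn 𝓗 γ c d) (hα : α ≠ 0)
    (himg : (fun t => α * t + β) '' Icc a b = Icc c d) :
    IsHorizontalOn 𝓗 (fun t => γ (α * t + β)) a b ∧
      lengthOn Q (fun t => γ (α * t + β)) a b = lengthOn Q γ c d := by
  have hder : ∀ t, HasDerivAt (fun t : ℝ => α * t + β) α t := fun t => by
    simpa using ((hasDerivAt_id t).const_mul α).add_const β
  have hLip : LipschitzWith ‖α‖₊ fun t : ℝ => α * t + β :=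
    LipschitzWith.of_dist_le_mul fun s t => by
      rw [dist_add_right, Real.dist_eq, Real.dist_eq, ← mul_sub, abs_mul, coe_nnnorm,
        Real.norm_eq_abs]
  have hmono : Monotone (fun t : ℝ => α * t + β) ∨ Antitone fun t : ℝ => α * t + β :=
    hα.lt_or_gt.symm.imp
      (fun h s t hst => by dsimp only; gcongr)
      (fun h s t hst => add_le_add_left (mul_le_mul_of_nonpos_left hst h.le) β)
  have hinj : Function.Injective fun t : ℝ => α * t + β := fun s t hst => by simpa [hα] using hst
  have hmaps : MapsTo (fun t => α * t + β) (Icc a b) (Icc c d) := mapsTo_iff_image_subset.2 himg.le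
  have hae := ae_restrict_comp_mul_add hα h.2 hmaps
  refine ⟨⟨h.1.comp_reparametrization hLip hmono hmaps, ?_⟩, ?_⟩
  · filter_upwards [hae] with t ht
    exact IsHorizontalAt.comp (φ := fun t => α * t + β) ht (hder t)
  · rw [lengthOn, lengthOn, ← himg, lintegral_image_eq_lintegral_abs_deriv_mul measurableSet_Icc
      (fun t _ => (hder t).hasDerivWithinAt) hinj.injOn]
    refine lintegral_congr_ae ?_
    filter_upwards [hae] with t ht
    exact speed_comp (φ := fun t => α * t + β) (hder t) ht.1

theorem IsHorizontalOn.exists_reparametrization (h : IsHorizontalOn 𝓗 γ a b) (hab : a < b)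
    (hcd : c < d) :
    ∃ γ', IsHorizontalOn 𝓗 γ' c d ∧ γ' c = γ a ∧ γ' d = γ b ∧
      lengthOn Q γ' c d = lengthOn Q γ a b := by
  have hdc := sub_pos.2 hcd
  set α := (b - a) / (d - c)
  have hα : 0 < α := by positivity
  have hc : α * c + (a - α * c) = a := by ring
  have hd : α * d + (a - α * c) = b := by
    have : α * (d - c) = b - a := div_mul_cancel₀ _ hdc.ne'
    linarith
  obtain ⟨hγ', hlen⟩ := h.comp_mul_add (Q := Q) (a := c) (b := d) hα.ne'
    (by rw [image_affine_Icc' hα (a - α * c), hc, hd])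
  exact ⟨_, hγ', congrArg γ hc, congrArg γ hd, hlen⟩

theorem IsHorizontalOn.exists_reverse (h : IsHorizontalOn 𝓗 γ a b) :
    ∃ γ', IsHorizontalOn 𝓗 γ' a b ∧ γ' a = γ b ∧ γ' b = γ a ∧
      lengthOn Q γ' a b = lengthOn Q γ a b := by
  have hrefl : (fun t : ℝ => -1 * t + (a + b)) = fun t => a + b - t := by
    ext t
    ring
  obtain ⟨hγ', hlen⟩ := h.comp_mul_add (Q := Q) (α := -1) (β := a + b) (a := a) (b := b)
    (by norm_num) (by rw [hrefl, image_const_sub_Icc, add_sub_cancel_left, add_sub_cancel_right])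
  exact ⟨_, hγ', congrArg γ (by ring), congrArg γ (by ring), hlen⟩

theorem IsHorizontalOn.exists_concatenation (h₁ : IsHorizontalOn 𝓗 γ₁ a b)
    (h₂ : IsHorizontalOn 𝓗 γ₂ b c) (hab : a ≤ b) (hbc : b ≤ c) (hb : γ₁ b = γ₂ b) :
    ∃ γ, IsHorizontalOn 𝓗 γ a c ∧ γ a = γ₁ a ∧ γ c = γ₂ c ∧
      lengthOn Q γ a c = lengthOn Q γ₁ a b + lengthOn Q γ₂ b c := by
  set γ : ℝ → G := fun t => if t ≤ b then γ₁ t else γ₂ t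
  have heq₁ : EqOn γ₁ γ (Icc a b) := fun t ht => (if_pos ht.2).symm
  have heq₂ : EqOn γ₂ γ (Icc b c) := fun t ht => by
    rcases ht.1.eq_or_lt with rfl | h
    · exact hb.symm.trans (if_pos le_rfl).symm
    · exact (if_neg (not_le.2 h)).symm
  refine ⟨γ, (h₁.congr heq₁).union hab hbc (h₂.congr heq₂), (heq₁ (left_mem_Icc.2 hab)).symm,
    (heq₂ (right_mem_Icc.2 hbc)).symm, ?_⟩
  rw [← lengthOn_add hab hbc, lengthOn_congr heq₁, lengthOn_congr heq₂]

end Reparametrization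

section Distance

variable {n : ℕ} {G : Type*} [TopologicalSpace G] [ChartedSpace (EuclideanSpace ℝ (Fin n)) G]
  [Group G] {𝓗 : Submodule ℝ (GroupLieAlgebra (𝓡 n) G)}
  {Q : LinearMap.BilinForm ℝ (GroupLieAlgebra (𝓡 n) G)} {γ : ℝ → G} {a b : ℝ} {x y z : G}

theorem ccDist_le_lengthOn (hab : a < b) (h : IsHorizontalOn 𝓗 γ a b) :
    ccDist 𝓗 Q (γ a) (γ b) ≤ lengthOn Q γ a b := by
  obtain ⟨γ', hγ', h0, h1, hlen⟩ := h.exists_reparametrization (Q := Q) hab one_pos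
  rw [← hlen]
  exact iInf₂_le γ' (mem_horizontalCurves_iff.2 ⟨hγ', h0, h1⟩)

theorem exists_isHorizontalOn_of_ccDist_lt {r : ℝ≥0∞} (h : ccDist 𝓗 Q x y < r) (hab : a < b) :
    ∃ γ : ℝ → G, IsHorizontalOn 𝓗 γ a b ∧ γ a = x ∧ γ b = y ∧ lengthOn Q γ a b < r := by
  obtain ⟨γ, hγ⟩ := iInf_lt_iff.1 h
  obtain ⟨hmem, hlt⟩ := iInf_lt_iff.1 hγ
  obtain ⟨hhor, rfl, rfl⟩ := mem_horizontalCurves_iff.1 hmem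
  obtain ⟨γ', hγ', ha, hb, hlen⟩ := hhor.exists_reparametrization (Q := Q) one_pos hab
  exact ⟨γ', hγ', ha, hb, hlen.trans_lt hlt⟩

theorem ccDist_triangle : ccDist 𝓗 Q x z ≤ ccDist 𝓗 Q x y + ccDist 𝓗 Q y z := by
  refine ENNReal.le_of_forall_pos_le_add fun ε hε hfin => ?_
  have hε' : (ε : ℝ≥0∞) / 2 ≠ 0 := (ENNReal.half_pos (ENNReal.coe_ne_zero.2 hε.ne')).ne'
  obtain ⟨hxy, hyz⟩ := ENNReal.add_lt_top.1 hfin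
  obtain ⟨γ₁, h₁, rfl, hy₁, hl₁⟩ := exists_isHorizontalOn_of_ccDist_lt
    (ENNReal.lt_add_right hxy.ne hε') (zero_lt_one (α := ℝ))
  obtain ⟨γ₂, h₂, hy₂, rfl, hl₂⟩ := exists_isHorizontalOn_of_ccDist_lt
    (ENNReal.lt_add_right hyz.ne hε') (one_lt_two (α := ℝ))
  obtain ⟨γ, hγ, h0, h2, hlen⟩ := h₁.exists_concatenation (Q := Q) h₂ zero_le_one one_le_two
    (hy₁.trans hy₂.symm)
  calc ccDist 𝓗 Q (γ₁ 0) (γ₂ 2) = ccDist 𝓗 Q (γ 0) (γ 2) := by rw [h0, h2]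
    _ ≤ lengthOn Q γ 0 2 := ccDist_le_lengthOn zero_lt_two hγ
    _ = lengthOn Q γ₁ 0 1 + lengthOn Q γ₂ 1 2 := hlen
    _ ≤ (ccDist 𝓗 Q (γ₁ 0) y + ε / 2) + (ccDist 𝓗 Q y (γ₂ 2) + ε / 2) := add_le_add hl₁.le hl₂.le
    _ = ccDist 𝓗 Q (γ₁ 0) y + ccDist 𝓗 Q y (γ₂ 2) + ε := by
      rw [add_add_add_comm, ENNReal.add_halves]

theorem ccDist_comm : ccDist 𝓗 Q x y = ccDist 𝓗 Q y x := by
  have hle : ∀ x y : G, ccDist 𝓗 Q y x ≤ ccDist 𝓗 Q x y := by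
    refine fun x y => le_of_forall_gt fun r hr => ?_
    obtain ⟨γ, hγ, rfl, rfl, hl⟩ := exists_isHorizontalOn_of_ccDist_lt hr (zero_lt_one (α := ℝ))
    obtain ⟨γ', hγ', h0, h1, hlen⟩ := hγ.exists_reverse (Q := Q)
    rw [← h0, ← h1]
    exact (ccDist_le_lengthOn one_pos hγ').trans_lt (hlen.trans_lt hl)
  exact le_antisymm (hle y x) (hle x y)

theorem exists_forall_lengthOn_lt (h : lengthOn Q γ a b ≠ ⊤) {ε : ℝ≥0∞} (hε : ε ≠ 0) :
    ∃ η > 0, ∀ p q, a ≤ p → q ≤ b → q - p < η → lengthOn Q γ p q < ε := by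
  obtain ⟨δ, hδ, hsmall⟩ := exists_pos_setLIntegral_lt_of_measure_lt
    (μ := volume.restrict (Icc a b)) (f := speed Q γ) h hε
  obtain ⟨η, hη, hηδ⟩ := ENNReal.lt_iff_exists_nnreal_btwn.1 hδ
  refine ⟨η, by exact_mod_cast hη, fun p q hp hq hlt => ?_⟩
  have hvol : (volume.restrict (Icc a b)) (Icc p q) < δ :=
    (Measure.restrict_apply_le _ _).trans_lt <| by
      rw [Real.volume_Icc]
      exact (ENNReal.ofReal_le_ofReal hlt.le).trans_lt (by rwa [ENNReal.ofReal_coe_nnreal])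
  have hlen := hsmall (Icc p q) hvol
  rwa [Measure.restrict_restrict measurableSet_Icc,
    inter_eq_self_of_subset_left (Icc_subset_Icc hp hq)] at hlen

theorem continuousOn_lengthOn (h : lengthOn Q γ a b ≠ ⊤) :
    ContinuousOn (fun t => (lengthOn Q γ a t).toReal) (Icc a b) := by
  have hfin : ∀ s t, a ≤ s → t ≤ b → lengthOn Q γ s t ≠ ⊤ := fun s t hs ht =>
    ne_top_of_le_ne_top h (lengthOn_mono hs ht)
  rw [Metric.continuousOn_iff]
  intro t ht ε hε
  obtain ⟨η, hη, hsmall⟩ := exists_forall_lengthOn_lt h (ENNReal.ofReal_pos.2 hε).ne'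
  have hlt : ∀ p q, a ≤ p → p ≤ q → q ≤ b → dist p q < η →
      dist (lengthOn Q γ a q).toReal (lengthOn Q γ a p).toReal < ε := by
    intro p q hp hpq hq hpqη
    rw [dist_comm, Real.dist_eq, abs_of_nonneg (sub_nonneg.2 hpq)] at hpqη
    rw [Real.dist_eq, ← lengthOn_add hp hpq, ENNReal.toReal_add (hfin _ _ le_rfl (hpq.trans hq))
      (hfin _ _ hp hq), add_sub_cancel_left, abs_of_nonneg ENNReal.toReal_nonneg]
    exact (ENNReal.lt_ofReal_iff_toReal_lt (hfin _ _ hp hq)).1 (hsmall p q hp hq hpqη)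
  refine ⟨η, hη, fun s hs hst => ?_⟩
  rcases le_total t s with hle | hle
  · exact hlt t s ht.1 hle hs.2 (by rwa [dist_comm])
  · rw [dist_comm]
    exact hlt s t hs.1 hle ht.2 hst

theorem exists_lengthOn_eq (hab : a ≤ b) (h : lengthOn Q γ a b ≠ ⊤) {v : ℝ≥0∞}
    (hv : v ≤ lengthOn Q γ a b) : ∃ t ∈ Icc a b, lengthOn Q γ a t = v := by
  obtain ⟨t, ht, htv⟩ := intermediate_value_Icc hab (continuousOn_lengthOn h)
    (show v.toReal ∈ Icc _ _ from
      ⟨by rw [lengthOn_self]; exact ENNReal.toReal_nonneg, ENNReal.toReal_mono h hv⟩)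
  exact ⟨t, ht, (ENNReal.toReal_eq_toReal_iff' (ne_top_of_le_ne_top h (lengthOn_mono le_rfl ht.2))
    (ne_top_of_le_ne_top h hv)).1 htv⟩

theorem exists_lengthOn_lt_and_lt {A B : ℝ≥0∞} (hab : a < b) (hA : 0 < A) (hB : 0 < B)
    (h : lengthOn Q γ a b < A + B) :
    ∃ t, a < t ∧ t < b ∧ lengthOn Q γ a t < A ∧ lengthOn Q γ t b < B := by
  have hL : lengthOn Q γ a b ≠ ⊤ := h.ne_top
  rcases eq_or_ne (lengthOn Q γ a b) 0 with h0 | h0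
  · obtain ⟨t, hat, htb⟩ := exists_between hab
    exact ⟨t, hat, htb, (lengthOn_mono le_rfl htb.le).trans_lt (h0 ▸ hA),
      (lengthOn_mono hat.le le_rfl).trans_lt (h0 ▸ hB)⟩
  obtain ⟨v, hBv, hv⟩ : ∃ v, lengthOn Q γ a b - B < v ∧ v < min A (lengthOn Q γ a b) := by
    refine exists_between (lt_min ?_ (ENNReal.sub_lt_self hL h0 hB.ne'))
    rcases lt_or_ge (lengthOn Q γ a b) B with hlt | hge
    · rwa [tsub_eq_zero_of_le hlt.le]
    · exact ENNReal.sub_lt_of_lt_add hge h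
  obtain ⟨hvA, hvL⟩ := lt_min_iff.1 hv
  obtain ⟨t, ht, rfl⟩ := exists_lengthOn_eq hab.le hL hvL.le
  have hat : a < t := ht.1.lt_of_ne fun h => not_lt_zero (by rwa [← h, lengthOn_self] at hBv)
  have htb : t < b := ht.2.lt_of_ne fun h => hvL.ne (by rw [h])
  refine ⟨t, hat, htb, hvA, ?_⟩
  have hlt := ENNReal.lt_add_of_sub_lt_right (Or.inl hL) hBv
  rw [← lengthOn_add hat.le htb.le] at hlt
  exact (ENNReal.add_lt_add_iff_left hvL.ne_top).1 hlt

theorem exists_ccDist_lt_and_lt {A B : ℝ≥0∞} (hA : 0 < A) (hB : 0 < B)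
    (h : ccDist 𝓗 Q x y < A + B) : ∃ z, ccDist 𝓗 Q x z < A ∧ ccDist 𝓗 Q z y < B := by
  obtain ⟨γ, hγ, rfl, rfl, hl⟩ := exists_isHorizontalOn_of_ccDist_lt h (zero_lt_one (α := ℝ))
  obtain ⟨t, h0t, ht1, hA, hB⟩ := exists_lengthOn_lt_and_lt one_pos hA hB hl
  exact ⟨γ t, (ccDist_le_lengthOn h0t (hγ.mono le_rfl ht1.le)).trans_lt hA,
    (ccDist_le_lengthOn ht1 (hγ.mono h0t.le le_rfl)).trans_lt hB⟩

end Distance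

section Translation

variable {n : ℕ} {G : Type*} [TopologicalSpace G] [ChartedSpace (EuclideanSpace ℝ (Fin n)) G]
  [Group G]
  {𝓗 : Submodule ℝ (GroupLieAlgebra (𝓡 n) G)}
  {Q : LinearMap.BilinForm ℝ (GroupLieAlgebra (𝓡 n) G)} {γ : ℝ → G} {a b t : ℝ} {x y : G}

theorem velocity_const : velocity n (fun _ : ℝ => x) t = mulInvariantVectorField 0 x := by
  rw [velocity, mfderiv_const]
  exact (map_zero (mfderiv (𝓡 n) (𝓡 n) (fun y : G => x * y) (1 : G))).symm

theorem isHorizontalOn_const : IsHorizontalOn 𝓗 (fun _ : ℝ => x) a b :=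
  ⟨⟨continuousOn_const, fun _ _ _ _ _ _ _ =>
      (LipschitzWith.const _).lipschitzOnWith.absolutelyContinuousOnInterval⟩,
    ae_of_all _ fun _ => ⟨mdifferentiableAt_const, 0, 𝓗.zero_mem, velocity_const⟩⟩

variable [LieGroup (𝓡 n) ∞ G]

theorem mdifferentiableAt_mul_left (g : G) :
    MDifferentiableAt (𝓡 n) (𝓡 n) (fun y : G => g * y) x :=
  (contMDiff_mul_left (I := 𝓡 n) (n := ∞)).mdifferentiableAt (by simp)

theorem mfderiv_mul_left_mul_left (g h : G) (v : TangentSpace (𝓡 n) x) :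
    mfderiv (𝓡 n) (𝓡 n) (fun y : G => g * y) (h * x)
      (mfderiv (𝓡 n) (𝓡 n) (fun y : G => h * y) x v) =
    (mfderiv (𝓡 n) (𝓡 n) (fun y : G => g * (h * y)) x v : EuclideanSpace ℝ (Fin n)) :=
  (mfderiv_comp_apply x (mdifferentiableAt_mul_left g) (mdifferentiableAt_mul_left h) v).symm

theorem mfderiv_mul_left_mulInvariantVectorField (g : G) (X : GroupLieAlgebra (𝓡 n) G) :
    mfderiv (𝓡 n) (𝓡 n) (fun y : G => g * y) x (mulInvariantVectorField X x) =
      (mfderiv (𝓡 n) (𝓡 n) (fun y : G => g * (x * y)) 1 X : EuclideanSpace ℝ (Fin n)) :=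
  (congrArg (fun L : EuclideanSpace ℝ (Fin n) →L[ℝ] EuclideanSpace ℝ (Fin n) =>
    L (mulInvariantVectorField X x)) (mfderiv_congr_point (mul_one x).symm)).trans
    (mfderiv_mul_left_mul_left g x X)

theorem mulInvariantVectorField_mul (g : G) (X : GroupLieAlgebra (𝓡 n) G) :
    mfderiv (𝓡 n) (𝓡 n) (fun y : G => g * y) x (mulInvariantVectorField X x) =
      mulInvariantVectorField X (g * x) := by
  have h := mfderiv_mul_left_mulInvariantVectorField (x := x) g X
  have hmul : (fun y : G => g * (x * y)) = fun y => g * x * y :=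
    funext fun y => (mul_assoc g x y).symm
  rwa [hmul] at h

theorem tangentNorm_mul_left (g : G) (v : TangentSpace (𝓡 n) x) :
    tangentNorm Q (g * x) (mfderiv (𝓡 n) (𝓡 n) (fun y : G => g * y) x v) = tangentNorm Q x v := by
  have h := mfderiv_mul_left_mul_left (g * x)⁻¹ g v
  have hmul : (fun y : G => (g * x)⁻¹ * (g * y)) = fun y => x⁻¹ * y := by ext y; group
  rw [hmul] at h
  exact congrArg (fun Z : GroupLieAlgebra (𝓡 n) G => √(Q Z Z)) h

theorem tangentNorm_mulInvariantVectorField (X : GroupLieAlgebra (𝓡 n) G) :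
    tangentNorm Q x (mulInvariantVectorField X x) = √(Q X X) := by
  have h := mfderiv_mul_left_mulInvariantVectorField (x := x) x⁻¹ X
  have hmul : (fun y : G => x⁻¹ * (x * y)) = id := funext (inv_mul_cancel_left x)
  rw [hmul, mfderiv_id] at h
  exact congrArg (fun Z : GroupLieAlgebra (𝓡 n) G => √(Q Z Z)) h

theorem hasMFDerivAt_mul_left (g : G) (hγ : MDifferentiableAt 𝓘(ℝ, ℝ) (𝓡 n) γ t) :
    HasMFDerivAt 𝓘(ℝ, ℝ) (𝓡 n) (fun s => g * γ s) t
      ((mfderiv (𝓡 n) (𝓡 n) (fun y : G => g * y) (γ t)).comp (mfderiv 𝓘(ℝ, ℝ) (𝓡 n) γ t)) :=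
  (mdifferentiableAt_mul_left g).hasMFDerivAt.comp t hγ.hasMFDerivAt

theorem velocity_mul_left (g : G) (hγ : MDifferentiableAt 𝓘(ℝ, ℝ) (𝓡 n) γ t) :
    velocity n (fun s => g * γ s) t =
      mfderiv (𝓡 n) (𝓡 n) (fun y : G => g * y) (γ t) (velocity n γ t) :=
  congrArg (fun L : ℝ →L[ℝ] EuclideanSpace ℝ (Fin n) => L 1) (hasMFDerivAt_mul_left g hγ).mfderiv

theorem IsHorizontalAt.mul_left (g : G) (h : IsHorizontalAt 𝓗 γ t) :
    IsHorizontalAt 𝓗 (fun s => g * γ s) t := by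
  obtain ⟨hγ, X, hX, hv⟩ := h
  refine ⟨(hasMFDerivAt_mul_left g hγ).mdifferentiableAt, X, hX, ?_⟩
  rw [velocity_mul_left g hγ, hv]
  exact mulInvariantVectorField_mul g X

theorem speed_mul_left (g : G) (h : MDifferentiableAt 𝓘(ℝ, ℝ) (𝓡 n) γ t) :
    speed Q (fun s => g * γ s) t = speed Q γ t := by
  rw [speed, velocity_mul_left g h]
  exact congrArg ENNReal.ofReal (tangentNorm_mul_left g _)

theorem IsHorizontalOn.mul_left (g : G) (h : IsHorizontalOn 𝓗 γ a b) :
    IsHorizontalOn 𝓗 (fun s => g * γ s) a b := by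
  refine ⟨h.1.comp (f := fun y => g * y) ((contMDiff_mul_left (n := ∞)).of_le (by simp)), ?_⟩
  filter_upwards [h.2] with t ht using ht.mul_left g

theorem lengthOn_mul_left (g : G) (h : IsHorizontalOn 𝓗 γ a b) :
    lengthOn Q (fun s => g * γ s) a b = lengthOn Q γ a b := by
  refine lintegral_congr_ae ?_
  filter_upwards [h.2] with t ht using speed_mul_left g ht.1

theorem ccDist_mul_left_le (g : G) : ccDist 𝓗 Q (g * x) (g * y) ≤ ccDist 𝓗 Q x y := by
  refine le_of_forall_gt fun r hr => ?_
  obtain ⟨γ, hγ, rfl, rfl, hlt⟩ := exists_isHorizontalOn_of_ccDist_lt hr (zero_lt_one (α := ℝ))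
  refine (ccDist_le_lengthOn one_pos (hγ.mul_left g)).trans_lt ?_
  rwa [lengthOn_mul_left g hγ]

theorem ccDist_mul_left (g : G) : ccDist 𝓗 Q (g * x) (g * y) = ccDist 𝓗 Q x y := by
  refine le_antisymm (ccDist_mul_left_le g) ?_
  simpa using ccDist_mul_left_le (𝓗 := 𝓗) (Q := Q) (x := g * x) (y := g * y) g⁻¹

theorem lengthOn_const : lengthOn Q (fun _ : ℝ => x) a b = 0 := by
  have hspeed : ∀ t, speed Q (fun _ : ℝ => x) t = 0 := fun t => by
    rw [speed, velocity_const, tangentNorm_mulInvariantVectorField, map_zero, Real.sqrt_zero,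
      ENNReal.ofReal_zero]
  simp only [lengthOn, hspeed, lintegral_zero]

theorem ccDist_self : ccDist 𝓗 Q x x = 0 :=
  le_zero_iff.1 ((ccDist_le_lengthOn one_pos isHorizontalOn_const).trans lengthOn_const.le)

end Translation

section ChartMul

variable {n : ℕ} {G : Type*} [TopologicalSpace G] [ChartedSpace (EuclideanSpace ℝ (Fin n)) G]
  [Group G]

variable (n G) in
/-- The preferred chart at the identity. -/
noncomputable abbrev chartOne : OpenPartialHomeomorph G (EuclideanSpace ℝ (Fin n)) :=
  chartAt (EuclideanSpace ℝ (Fin n)) (1 : G)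

variable (n G) in
/-- The coordinates of the identity. -/
noncomputable abbrev coordOne : EuclideanSpace ℝ (Fin n) := chartOne n G 1

variable (n G) in
/-- The multiplication in the preferred chart at the identity. -/
noncomputable def chartMul (p : EuclideanSpace ℝ (Fin n) × EuclideanSpace ℝ (Fin n)) :
    EuclideanSpace ℝ (Fin n) :=
  chartOne n G ((chartOne n G).symm p.1 * (chartOne n G).symm p.2)

variable (n G) in
/-- The differential at the identity of the left translation by the point of coordinates `u`. -/
noncomputable def leftDeriv (u : EuclideanSpace ℝ (Fin n)) :
    EuclideanSpace ℝ (Fin n) →L[ℝ] EuclideanSpace ℝ (Fin n) :=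
  fderiv ℝ (fun v => chartMul n G (u, v)) (coordOne n G)

theorem one_mem_source : (1 : G) ∈ (chartOne n G).source := mem_chart_source _ _

theorem coordOne_mem_target : coordOne n G ∈ (chartOne n G).target := mem_chart_target _ _

theorem symm_coordOne : (chartOne n G).symm (coordOne n G) = 1 :=
  (chartOne n G).left_inv one_mem_source

theorem chartMul_coordOne_left {v : EuclideanSpace ℝ (Fin n)} (hv : v ∈ (chartOne n G).target) :
    chartMul n G (coordOne n G, v) = v := by
  rw [chartMul, symm_coordOne, one_mul, (chartOne n G).right_inv hv]

theorem leftDeriv_coordOne : leftDeriv n G (coordOne n G) = ContinuousLinearMap.id ℝ _ := by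
  have hid : (fun v => chartMul n G (coordOne n G, v)) =ᶠ[𝓝 (coordOne n G)] id := by
    filter_upwards [(chartOne n G).open_target.mem_nhds coordOne_mem_target] with v hv
      using chartMul_coordOne_left hv
  rw [leftDeriv, hid.fderiv_eq, fderiv_id]

variable [LieGroup (𝓡 n) ∞ G]

theorem contMDiffAt_chartOne_symm {u : EuclideanSpace ℝ (Fin n)} (hu : u ∈ (chartOne n G).target) :
    ContMDiffAt 𝓘(ℝ, EuclideanSpace ℝ (Fin n)) (𝓡 n) ∞ (chartOne n G).symm u := by
  have hu' : u ∈ (extChartAt (𝓡 n) (1 : G)).target := by simpa only [mfld_simps] using hu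
  exact (contMDiffOn_extChartAt_symm (1 : G)).contMDiffAt
    ((isOpen_extChartAt_target _).mem_nhds hu')

theorem contMDiffAt_chartOne {x : G} (hx : x ∈ (chartOne n G).source) :
    ContMDiffAt (𝓡 n) 𝓘(ℝ, EuclideanSpace ℝ (Fin n)) ∞ (chartOne n G) x :=
  contMDiffAt_extChartAt' (I := 𝓡 n) hx

theorem contDiffAt_chartMul {p : EuclideanSpace ℝ (Fin n) × EuclideanSpace ℝ (Fin n)}
    (hp₁ : p.1 ∈ (chartOne n G).target) (hp₂ : p.2 ∈ (chartOne n G).target)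
    (h : (chartOne n G).symm p.1 * (chartOne n G).symm p.2 ∈ (chartOne n G).source) :
    ContDiffAt ℝ ∞ (chartMul n G) p := by
  have hfst : ContMDiffAt 𝓘(ℝ, EuclideanSpace ℝ (Fin n) × EuclideanSpace ℝ (Fin n)) (𝓡 n) ∞
      (fun p : EuclideanSpace ℝ (Fin n) × EuclideanSpace ℝ (Fin n) => (chartOne n G).symm p.1) p :=
    (contMDiffAt_chartOne_symm hp₁).comp p contDiff_fst.contMDiff.contMDiffAt
  have hsnd : ContMDiffAt 𝓘(ℝ, EuclideanSpace ℝ (Fin n) × EuclideanSpace ℝ (Fin n)) (𝓡 n) ∞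
      (fun p : EuclideanSpace ℝ (Fin n) × EuclideanSpace ℝ (Fin n) => (chartOne n G).symm p.2) p :=
    (contMDiffAt_chartOne_symm hp₂).comp p contDiff_snd.contMDiff.contMDiffAt
  exact ((contMDiffAt_chartOne h).comp p (hfst.mul hsnd)).contDiffAt

theorem contDiffAt_chartMul_coordOne_right {u : EuclideanSpace ℝ (Fin n)}
    (hu : u ∈ (chartOne n G).target) : ContDiffAt ℝ ∞ (chartMul n G) (u, coordOne n G) :=
  contDiffAt_chartMul hu coordOne_mem_target (by
    simp only
    rw [symm_coordOne, mul_one]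
    exact (chartOne n G).map_target hu)

theorem contDiffAt_chartMul_coordOne_left {u : EuclideanSpace ℝ (Fin n)}
    (hu : u ∈ (chartOne n G).target) : ContDiffAt ℝ ∞ (chartMul n G) (coordOne n G, u) :=
  contDiffAt_chartMul coordOne_mem_target hu (by
    simp only
    rw [symm_coordOne, one_mul]
    exact (chartOne n G).map_target hu)

theorem leftDeriv_eq {u : EuclideanSpace ℝ (Fin n)} (hu : u ∈ (chartOne n G).target) :
    leftDeriv n G u = (fderiv ℝ (chartMul n G) (u, coordOne n G)).comp
      (ContinuousLinearMap.inr ℝ (EuclideanSpace ℝ (Fin n)) (EuclideanSpace ℝ (Fin n))) :=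
  (((contDiffAt_chartMul_coordOne_right hu).differentiableAt (by simp)).hasFDerivAt.comp
    (coordOne n G) (hasFDerivAt_prodMk_right u (coordOne n G))).fderiv

theorem contDiffAt_leftDeriv {u : EuclideanSpace ℝ (Fin n)} (hu : u ∈ (chartOne n G).target) :
    ContDiffAt ℝ ∞ (leftDeriv n G) u := by
  have hfderiv : ContDiffAt ℝ ∞ (fderiv ℝ (chartMul n G)) (u, coordOne n G) :=
    (contDiffAt_chartMul_coordOne_right hu).fderiv_right (by simp)
  refine ContDiffAt.congr_of_eventuallyEq
    ((hfderiv.comp u (contDiffAt_id.prodMk contDiffAt_const)).clm_comp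
      (contDiffAt_const (c := ContinuousLinearMap.inr ℝ _ _))) ?_
  filter_upwards [(chartOne n G).open_target.mem_nhds hu] with v hv using leftDeriv_eq hv

theorem mfderiv_chartOne_comp_mul_left {x : G} (hx : x ∈ (chartOne n G).source) :
    (mfderiv (𝓡 n) 𝓘(ℝ, EuclideanSpace ℝ (Fin n)) (fun y : G => chartOne n G (x * y)) 1 :
      EuclideanSpace ℝ (Fin n) →L[ℝ] EuclideanSpace ℝ (Fin n)) =
    leftDeriv n G (chartOne n G x) := by
  have hd : MDifferentiableAt (𝓡 n) 𝓘(ℝ, EuclideanSpace ℝ (Fin n))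
      (fun y : G => chartOne n G (x * y)) 1 := by
    refine MDifferentiableAt.comp (g := chartOne n G) (1 : G) ?_ (mdifferentiableAt_mul_left x)
    rw [mul_one]
    exact (contMDiffAt_chartOne hx).mdifferentiableAt (by simp)
  have hwritten : writtenInExtChartAt (𝓡 n) 𝓘(ℝ, EuclideanSpace ℝ (Fin n)) (1 : G)
      (fun y : G => chartOne n G (x * y)) = fun v => chartMul n G (chartOne n G x, v) := by
    ext1 v
    simp only [writtenInExtChartAt, chartMul, mfld_simps, (chartOne n G).left_inv hx]
    rfl
  rw [hd.mfderiv, hwritten, leftDeriv]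
  simp only [mfld_simps, fderivWithin_univ]
  rfl

theorem mfderiv_chartOne_mulInvariantVectorField {x : G} (hx : x ∈ (chartOne n G).source)
    (X : GroupLieAlgebra (𝓡 n) G) :
    mfderiv (𝓡 n) 𝓘(ℝ, EuclideanSpace ℝ (Fin n)) (chartOne n G) x (mulInvariantVectorField X x) =
      leftDeriv n G (chartOne n G x) X := by
  have hd : MDifferentiableAt (𝓡 n) 𝓘(ℝ, EuclideanSpace ℝ (Fin n)) (chartOne n G) x :=
    (contMDiffAt_chartOne hx).mdifferentiableAt (by simp)
  rw [← mfderiv_chartOne_comp_mul_left hx]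
  exact (mfderiv_comp_apply_of_eq (1 : G) hd (mdifferentiableAt_mul_left x) (mul_one x) X).symm

theorem hasDerivAt_chartOne_comp {γ : ℝ → G} {t : ℝ} (hγ : MDifferentiableAt 𝓘(ℝ, ℝ) (𝓡 n) γ t)
    (ht : γ t ∈ (chartOne n G).source) :
    HasDerivAt (fun s => chartOne n G (γ s))
      (mfderiv (𝓡 n) 𝓘(ℝ, EuclideanSpace ℝ (Fin n)) (chartOne n G) (γ t) (velocity n γ t)) t :=
  HasFDerivAt.hasDerivAt (f' := (mfderiv (𝓡 n) 𝓘(ℝ, EuclideanSpace ℝ (Fin n)) (chartOne n G)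
      (γ t) : EuclideanSpace ℝ (Fin n) →L[ℝ] EuclideanSpace ℝ (Fin n)).comp
        (mfderiv 𝓘(ℝ, ℝ) (𝓡 n) γ t))
    (((contMDiffAt_chartOne ht).mdifferentiableAt (by simp)).hasMFDerivAt.comp t
      hγ.hasMFDerivAt).hasFDerivAt

end ChartMul

section Confinement

theorem exists_norm_le_mul_sqrt {E : Type*} [NormedAddCommGroup E] [NormedSpace ℝ E]
    [FiniteDimensional ℝ E] (B : LinearMap.BilinForm ℝ E) (hB : ∀ X, X ≠ 0 → 0 < B X X) :
    ∃ C : ℝ, 0 < C ∧ ∀ X, ‖X‖ ≤ C * √(B X X) := by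
  have hcont : Continuous fun X => B X X := by
    let T : E →ₗ[ℝ] (E →L[ℝ] ℝ) := LinearMap.toContinuousLinearMap.toLinearMap ∘ₗ B
    exact T.continuous_of_finiteDimensional.clm_apply continuous_id
  obtain ⟨m, hm, hle⟩ := (isCompact_sphere (0 : E) 1).exists_forall_le' hcont.continuousOn
    fun X hX => hB X (ne_zero_of_mem_unit_sphere ⟨X, hX⟩)
  refine ⟨(√m)⁻¹, by positivity, fun X => ?_⟩
  rcases eq_or_ne X 0 with rfl | hX
  · simp
  have hX0 : 0 < ‖X‖ := norm_pos_iff.2 hX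
  have hunit : ‖X‖⁻¹ • X ∈ Metric.sphere (0 : E) 1 := by
    rw [mem_sphere_zero_iff_norm, norm_smul, norm_inv, norm_norm, inv_mul_cancel₀ hX0.ne']
  have hscale : B (‖X‖⁻¹ • X) (‖X‖⁻¹ • X) = B X X / ‖X‖ ^ 2 := by
    rw [map_smul, map_smul, LinearMap.smul_apply, smul_eq_mul, smul_eq_mul]
    field_simp
  have hsq : ‖X‖ ^ 2 * m ≤ B X X := by
    rw [mul_comm, ← le_div_iff₀ (by positivity), ← hscale]
    exact hle _ hunit
  rw [inv_mul_eq_div, le_div_iff₀ (by positivity), ← Real.sqrt_sq hX0.le,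
    ← Real.sqrt_mul (sq_nonneg _)]
  exact Real.sqrt_le_sqrt hsq

theorem enorm_sub_le_lintegral_enorm_of_hasDerivAt {E : Type*} [NormedAddCommGroup E]
    [NormedSpace ℝ E] {u u' : ℝ → E} {a b : ℝ} (hab : a ≤ b)
    (hu : AbsolutelyContinuousOnInterval u a b)
    (hu' : ∀ᵐ t ∂volume.restrict (Icc a b), HasDerivAt u (u' t) t) :
    ‖u b - u a‖ₑ ≤ ∫⁻ t in Icc a b, ‖u' t‖ₑ := by
  obtain ⟨ℓ, hℓ, hℓu⟩ := exists_dual_vector'' ℝ (u b - u a)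
  have hftc : ∫ t in a..b, deriv (fun t => ℓ (u t)) t = ‖u b - u a‖ := by
    rw [(absolutelyContinuousOnInterval_lipschitzOnWith_comp ℓ.lipschitz.lipschitzOnWith hu
      (mapsTo_univ _ _)).integral_deriv_eq_sub, ← map_sub, hℓu, RCLike.ofReal_real_eq_id, id]
  calc ‖u b - u a‖ₑ = ‖∫ t in Icc a b, deriv (fun t => ℓ (u t)) t‖ₑ := by
        rw [integral_Icc_eq_integral_Ioc, ← intervalIntegral.integral_of_le hab, hftc, enorm_norm]
    _ ≤ ∫⁻ t in Icc a b, ‖deriv (fun t => ℓ (u t)) t‖ₑ := enorm_integral_le_lintegral_enorm _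
    _ ≤ ∫⁻ t in Icc a b, ‖u' t‖ₑ := by
        refine lintegral_mono_ae ?_
        filter_upwards [hu'] with t ht
        have hℓderiv : HasDerivAt (fun t => ℓ (u t)) (ℓ (u' t)) t :=
          ℓ.hasFDerivAt.comp_hasDerivAt t ht
        rw [hℓderiv.deriv, enorm_le_iff_norm_le]
        exact (ℓ.le_opNorm _).trans (mul_le_of_le_one_left (norm_nonneg _) hℓ)

theorem mapsTo_Icc_of_forall_mapsTo_imp_mem {X : Type*} [TopologicalSpace X] {γ : ℝ → X} {a b : ℝ}
    {V K : Set X} (hγ : ContinuousOn γ (Icc a b)) (hV : IsOpen V) (hK : IsClosed K) (hKV : K ⊆ V)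
    (ha : γ a ∈ V) (hstep : ∀ t ∈ Icc a b, MapsTo γ (Icc a t) V → γ t ∈ K) :
    MapsTo γ (Icc a b) V := by
  by_contra! hexit
  obtain ⟨s, hs, hsV⟩ := not_subset.1 hexit
  have hcompact : IsCompact (Icc a b ∩ γ ⁻¹' Vᶜ) := isCompact_Icc.of_isClosed_subset
    (hγ.preimage_isClosed_of_isClosed isClosed_Icc hV.isClosed_compl) inter_subset_left
  obtain ⟨T, ⟨hT, hTV⟩, hleast⟩ := hcompact.exists_isLeast ⟨s, hs, hsV⟩
  have hbefore : ∀ t, a ≤ t → t < T → γ t ∈ V := fun t hat htT => by_contra fun htV =>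
    htT.not_ge (hleast ⟨⟨hat, htT.le.trans hT.2⟩, htV⟩)
  have haT : a < T := hT.1.lt_of_ne fun h => hTV (h ▸ ha)
  have hne : (𝓝[Ico a T] T).NeBot := by
    rw [nhdsWithin_Ico_eq_nhdsLT haT]
    infer_instance
  have hlim : Tendsto γ (𝓝[Ico a T] T) (𝓝 (γ T)) :=
    (hγ T hT).mono_left (nhdsWithin_mono _ fun t ht => ⟨ht.1, ht.2.le.trans hT.2⟩)
  refine hTV (hKV (hK.mem_of_tendsto hlim ?_))
  filter_upwards [self_mem_nhdsWithin] with t ht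
  exact hstep t ⟨ht.1, ht.2.le.trans hT.2⟩ fun s hs => hbefore s hs.1 (hs.2.trans_lt ht.2)

variable {n : ℕ} {G : Type*} [TopologicalSpace G] [ChartedSpace (EuclideanSpace ℝ (Fin n)) G]
  [Group G] [LieGroup (𝓡 n) ∞ G]
  {𝓗 : Submodule ℝ (GroupLieAlgebra (𝓡 n) G)}
  {Q : LinearMap.BilinForm ℝ (GroupLieAlgebra (𝓡 n) G)}

theorem enorm_chartOne_sub_le {C K : ℝ}
    (hC : ∀ X : EuclideanSpace ℝ (Fin n),
      ‖X‖ ≤ C * √(Q (X : GroupLieAlgebra (𝓡 n) G) (X : GroupLieAlgebra (𝓡 n) G)))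
    (hK : 0 ≤ K) {γ : ℝ → G} {a b : ℝ} (hab : a ≤ b) (hγ : IsHorizontalOn 𝓗 γ a b)
    (hsource : MapsTo γ (Icc a b) (chartOne n G).source)
    (hderiv : ∀ t ∈ Icc a b, ‖leftDeriv n G (chartOne n G (γ t))‖ ≤ K) :
    ‖chartOne n G (γ b) - chartOne n G (γ a)‖ₑ ≤ ENNReal.ofReal (K * C) * lengthOn Q γ a b := by
  have hAC : AbsolutelyContinuousOnInterval (fun t => chartOne n G (γ t)) a b :=
    hγ.1.2 1 a b le_rfl hab le_rfl hsource
  have hγ' : ∀ᵐ t ∂volume.restrict (Icc a b), HasDerivAt (fun t => chartOne n G (γ t))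
      (mfderiv (𝓡 n) 𝓘(ℝ, EuclideanSpace ℝ (Fin n)) (chartOne n G) (γ t) (velocity n γ t)) t := by
    filter_upwards [hγ.2, ae_restrict_mem measurableSet_Icc] with t ht htI
      using hasDerivAt_chartOne_comp ht.1 (hsource htI)
  refine (enorm_sub_le_lintegral_enorm_of_hasDerivAt hab hAC hγ').trans ?_
  rw [lengthOn, ← lintegral_const_mul' _ _ ENNReal.ofReal_ne_top]
  refine lintegral_mono_ae ?_
  filter_upwards [hγ.2, ae_restrict_mem measurableSet_Icc] with t ht htI
  obtain ⟨X, -, hX⟩ := ht.2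
  rw [speed, hX, mfderiv_chartOne_mulInvariantVectorField (hsource htI),
    tangentNorm_mulInvariantVectorField, ← ENNReal.ofReal_mul' (Real.sqrt_nonneg _), ← ofReal_norm]
  refine ENNReal.ofReal_le_ofReal ?_
  rw [mul_assoc]
  exact ((leftDeriv n G (chartOne n G (γ t))).le_opNorm X).trans
    (mul_le_mul (hderiv t htI) (hC X) (norm_nonneg _) hK)

theorem exists_closedBall_coordOne {U : Set G} (hU : U ∈ 𝓝 (1 : G)) :
    ∃ K : ℝ, 0 < K ∧ ∃ ρ : ℝ, 0 < ρ ∧ ∀ u ∈ Metric.closedBall (coordOne n G) ρ,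
      u ∈ (chartOne n G).target ∧ ‖leftDeriv n G u‖ ≤ K ∧ (chartOne n G).symm u ∈ U := by
  have htarget : ∀ᶠ u in 𝓝 (coordOne n G), u ∈ (chartOne n G).target :=
    (chartOne n G).open_target.mem_nhds coordOne_mem_target
  have hnorm : ∀ᶠ u in 𝓝 (coordOne n G), ‖leftDeriv n G u‖ < ‖leftDeriv n G (coordOne n G)‖ + 1 :=
    (contDiffAt_leftDeriv coordOne_mem_target).continuousAt.norm.eventually
      (gt_mem_nhds (lt_add_one _))
  have hsymm : ∀ᶠ u in 𝓝 (coordOne n G), (chartOne n G).symm u ∈ U :=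
    (chartOne n G).continuousAt_symm coordOne_mem_target (by rwa [symm_coordOne])
  obtain ⟨ρ, hρ, hball⟩ := Metric.nhds_basis_closedBall.eventually_iff.1
    (htarget.and (hnorm.and hsymm))
  exact ⟨_, by positivity, ρ, hρ, fun u hu =>
    ⟨(hball hu).1, (hball hu).2.1.le, (hball hu).2.2⟩⟩

theorem exists_ccDist_lt_imp_mem [T2Space G] (hQpos : ∀ X, X ≠ 0 → 0 < Q X X)
    {U : Set G} (hU : U ∈ 𝓝 (1 : G)) :
    ∃ r : ℝ, 0 < r ∧ ∀ y, ccDist 𝓗 Q 1 y < ENNReal.ofReal r → y ∈ U := by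
  obtain ⟨C, hC, hQ⟩ := exists_norm_le_mul_sqrt (E := EuclideanSpace ℝ (Fin n)) Q hQpos
  obtain ⟨K, hK, ρ, hρ, hball⟩ := exists_closedBall_coordOne (n := n) hU
  set φ := chartOne n G
  have hhalf : Metric.closedBall (coordOne n G) (ρ / 2) ⊆ Metric.ball (coordOne n G) ρ :=
    Metric.closedBall_subset_ball (half_lt_self hρ)
  have hsub : Metric.ball (coordOne n G) ρ ⊆ Metric.closedBall (coordOne n G) ρ :=
    Metric.ball_subset_closedBall
  have hVU : φ.source ∩ φ ⁻¹' Metric.ball (coordOne n G) ρ ⊆ U := fun y hy => by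
    simpa only [φ.left_inv hy.1] using (hball _ (hsub hy.2)).2.2
  have hclosed : IsClosed (φ.symm '' Metric.closedBall (coordOne n G) (ρ / 2)) :=
    ((isCompact_closedBall _ _).image_of_continuousOn
      (φ.continuousOn_symm.mono fun u hu => (hball u (hsub (hhalf hu))).1)).isClosed
  have hhalfV : φ.symm '' Metric.closedBall (coordOne n G) (ρ / 2) ⊆
      φ.source ∩ φ ⁻¹' Metric.ball (coordOne n G) ρ := by
    rintro _ ⟨u, hu, rfl⟩
    have hut := (hball u (hsub (hhalf hu))).1
    exact ⟨φ.map_target hut, by rw [mem_preimage, φ.right_inv hut]; exact hhalf hu⟩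
  refine ⟨ρ / 2 / (K * C), by positivity, fun y hy => ?_⟩
  obtain ⟨γ, hγ, h0, rfl, hlen⟩ := exists_isHorizontalOn_of_ccDist_lt hy (zero_lt_one (α := ℝ))
  refine hVU (mapsTo_Icc_of_forall_mapsTo_imp_mem hγ.1.1
    (φ.isOpen_inter_preimage Metric.isOpen_ball) hclosed hhalfV
    (h0 ▸ ⟨one_mem_source, Metric.mem_ball_self hρ⟩) (fun t ht htV => ?_)
    (right_mem_Icc.2 zero_le_one))
  have hdisp : ‖φ (γ t) - φ (γ 0)‖ₑ ≤ ENNReal.ofReal (ρ / 2) :=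
    calc ‖φ (γ t) - φ (γ 0)‖ₑ ≤ ENNReal.ofReal (K * C) * lengthOn Q γ 0 t :=
          enorm_chartOne_sub_le hQ hK.le ht.1 (hγ.mono le_rfl ht.2) (fun s hs => (htV hs).1)
            fun s hs => (hball _ (hsub (htV hs).2)).2.1
      _ ≤ ENNReal.ofReal (K * C) * ENNReal.ofReal (ρ / 2 / (K * C)) := by
          gcongr
          exact (lengthOn_mono le_rfl ht.2).trans hlen.le
      _ = ENNReal.ofReal (ρ / 2) := by
          rw [← ENNReal.ofReal_mul (by positivity), mul_div_cancel₀ _ (by positivity)]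
  refine ⟨φ (γ t), ?_, φ.left_inv (htV (right_mem_Icc.2 ht.1)).1⟩
  rw [← ofReal_norm, ENNReal.ofReal_le_ofReal_iff (by positivity), h0] at hdisp
  exact mem_closedBall_iff_norm.2 hdisp

end Confinement

section IntegralCurves

variable {n : ℕ} {G : Type*} [TopologicalSpace G] [ChartedSpace (EuclideanSpace ℝ (Fin n)) G]
  [Group G] [LieGroup (𝓡 n) ∞ G]
  {𝓗 : Submodule ℝ (GroupLieAlgebra (𝓡 n) G)}
  {Q : LinearMap.BilinForm ℝ (GroupLieAlgebra (𝓡 n) G)}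
  {X : GroupLieAlgebra (𝓡 n) G} {γ : ℝ → G} {a b : ℝ}

theorem isHorizontalOn_of_lipschitzOnWith_chartOne {K : ℝ≥0} (hX : X ∈ 𝓗)
    (hsource : MapsTo γ (Icc a b) (chartOne n G).source)
    (hLip : LipschitzOnWith K (fun t => chartOne n G (γ t)) (Icc a b))
    (hγ : ∀ t ∈ Icc a b, MDifferentiableAt 𝓘(ℝ, ℝ) (𝓡 n) γ t ∧
      velocity n γ t = mulInvariantVectorField X (γ t)) :
    IsHorizontalOn 𝓗 γ a b := by
  refine ⟨IsAbsContOn.of_local fun t ht => ⟨univ, univ_mem, (chartOne n G).symm,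
    fun t => chartOne n G (γ t), ?_, hLip.continuousOn t ht, ?_, fun p q hp hpq hq _ => ?_⟩, ?_⟩
  · exact (contMDiffAt_chartOne_symm ((chartOne n G).map_source (hsource ht))).of_le (by simp)
  · exact fun s hs => ((chartOne n G).left_inv (hsource hs.2)).symm
  · refine (hLip.mono ?_).absolutelyContinuousOnInterval
    rw [uIcc_of_le hpq]
    exact Icc_subset_Icc hp hq
  · filter_upwards [ae_restrict_mem measurableSet_Icc] with t ht
    exact ⟨(hγ t ht).1, X, hX, (hγ t ht).2⟩

theorem lengthOn_of_velocity_eq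
    (hγ : ∀ t ∈ Icc a b, velocity n γ t = mulInvariantVectorField X (γ t)) :
    lengthOn Q γ a b = ENNReal.ofReal (√(Q X X) * (b - a)) := by
  have hspeed : EqOn (speed Q γ) (fun _ => ENNReal.ofReal √(Q X X)) (Icc a b) := fun t ht => by
    rw [speed, hγ t ht, tangentNorm_mulInvariantVectorField]
  rw [lengthOn, setLIntegral_congr_fun measurableSet_Icc hspeed, setLIntegral_const,
    Real.volume_Icc, ENNReal.ofReal_mul (Real.sqrt_nonneg _)]

theorem exists_velocity_eq_mulInvariantVectorField (X : GroupLieAlgebra (𝓡 n) G) :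
    ∃ γ : ℝ → G, γ 0 = 1 ∧ ∀ᶠ t in 𝓝 (0 : ℝ), MDifferentiableAt 𝓘(ℝ, ℝ) (𝓡 n) γ t ∧
      velocity n γ t = mulInvariantVectorField X (γ t) := by
  have hX : ContMDiffAt (𝓡 n) (𝓡 n).tangent 1
      (fun g : G => (⟨g, mulInvariantVectorField X g⟩ : TangentBundle (𝓡 n) G)) 1 :=
    (contMDiffAt_mulInvariantVectorField X).of_le (by
      rw [minSmoothness_of_isRCLikeNormedField]
      norm_num)
  obtain ⟨γ, h0, hγ⟩ := exists_isMIntegralCurveAt_of_contMDiffAt_boundaryless (t₀ := 0) hX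
  refine ⟨γ, h0, hγ.mono fun t ht => ⟨ht.mdifferentiableAt, ?_⟩⟩
  exact (congrArg (fun L : ℝ →L[ℝ] EuclideanSpace ℝ (Fin n) => L 1) ht.mfderiv).trans
    (one_smul ℝ (mulInvariantVectorField X (γ t) : EuclideanSpace ℝ (Fin n)))

theorem hasStrictDerivAt_chartOne_comp (h0 : γ 0 = 1)
    (hγ : ∀ᶠ t in 𝓝 (0 : ℝ), MDifferentiableAt 𝓘(ℝ, ℝ) (𝓡 n) γ t ∧
      velocity n γ t = mulInvariantVectorField X (γ t)) :
    HasStrictDerivAt (fun t => chartOne n G (γ t)) (X : EuclideanSpace ℝ (Fin n)) 0 := by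
  have hsource : ∀ᶠ t in 𝓝 (0 : ℝ), γ t ∈ (chartOne n G).source :=
    hγ.self_of_nhds.1.continuousAt.eventually_mem
      ((chartOne n G).open_source.mem_nhds (h0 ▸ one_mem_source))
  have hderiv : ∀ᶠ t in 𝓝 (0 : ℝ), HasDerivAt (fun t => chartOne n G (γ t))
      (leftDeriv n G (chartOne n G (γ t)) X) t := by
    filter_upwards [hγ, hsource] with t ht hts
    rw [← mfderiv_chartOne_mulInvariantVectorField hts, ← ht.2]
    exact hasDerivAt_chartOne_comp ht.1 hts
  have hcont : ContinuousAt (fun t => leftDeriv n G (chartOne n G (γ t)) X) 0 := by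
    have hleft : ContinuousAt (leftDeriv n G) (chartOne n G (γ 0)) :=
      h0.symm ▸ (contDiffAt_leftDeriv coordOne_mem_target).continuousAt
    exact (ContinuousAt.comp (f := fun t => chartOne n G (γ t)) hleft
      hderiv.self_of_nhds.continuousAt).clm_apply continuousAt_const
  have hstrict := hasStrictDerivAt_of_hasDerivAt_of_continuousAt hderiv hcont
  rwa [h0, leftDeriv_coordOne] at hstrict

theorem eventually_ccDist_le (hX : X ∈ 𝓗) (h0 : γ 0 = 1)
    (hγ : ∀ᶠ t in 𝓝 (0 : ℝ), MDifferentiableAt 𝓘(ℝ, ℝ) (𝓡 n) γ t ∧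
      velocity n γ t = mulInvariantVectorField X (γ t)) :
    ∀ᶠ s in 𝓝 (0 : ℝ), ccDist 𝓗 Q 1 (γ s) ≤ ENNReal.ofReal (√(Q X X) * |s|) := by
  have hsource : ∀ᶠ t in 𝓝 (0 : ℝ), γ t ∈ (chartOne n G).source :=
    hγ.self_of_nhds.1.continuousAt.eventually_mem
      ((chartOne n G).open_source.mem_nhds (h0 ▸ one_mem_source))
  obtain ⟨K, N, hN, hLip⟩ :=
    (hasStrictDerivAt_chartOne_comp h0 hγ).hasStrictFDerivAt.exists_lipschitzOnWith
  obtain ⟨ε, hε, hall⟩ := Metric.eventually_nhds_iff_ball.1 (hsource.and (hγ.and hN))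
  have hhor : ∀ p q, Icc p q ⊆ Metric.ball 0 ε → IsHorizontalOn 𝓗 γ p q := fun p q hpq =>
    isHorizontalOn_of_lipschitzOnWith_chartOne hX (fun t ht => (hall t (hpq ht)).1)
      (hLip.mono fun t ht => (hall t (hpq ht)).2.2) fun t ht => (hall t (hpq ht)).2.1
  have hlen : ∀ p q, Icc p q ⊆ Metric.ball 0 ε →
      lengthOn Q γ p q = ENNReal.ofReal (√(Q X X) * (q - p)) := fun p q hpq =>
    lengthOn_of_velocity_eq fun t ht => (hall t (hpq ht)).2.1.2
  have h0ε : (0 : ℝ) ∈ Metric.ball 0 ε := Metric.mem_ball_self hε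
  have hball : (Metric.ball (0 : ℝ) ε).OrdConnected := by
    rw [Real.ball_zero_eq_Ioo]
    exact ordConnected_Ioo
  filter_upwards [Metric.ball_mem_nhds 0 hε] with s hs
  rcases lt_trichotomy s 0 with hs0 | rfl | hs0
  · have hsub := hball.out hs h0ε
    have hle := ccDist_le_lengthOn (Q := Q) hs0 (hhor s 0 hsub)
    rwa [hlen s 0 hsub, h0, ccDist_comm, zero_sub, ← abs_of_neg hs0] at hle
  · rw [h0, ccDist_self]
    exact zero_le
  · have hsub := hball.out h0ε hs
    have hle := ccDist_le_lengthOn (Q := Q) hs0 (hhor 0 s hsub)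
    rw [hlen 0 s hsub, h0, sub_zero] at hle
    rwa [abs_of_pos hs0]

end IntegralCurves

open VectorField

section Bracket

variable {n : ℕ} {G : Type*} [TopologicalSpace G] [ChartedSpace (EuclideanSpace ℝ (Fin n)) G]
  [Group G] [LieGroup (𝓡 n) ∞ G]

theorem mfderiv_extChartAt_one :
    (mfderiv (𝓡 n) 𝓘(ℝ, EuclideanSpace ℝ (Fin n)) (extChartAt (𝓡 n) (1 : G)) (1 : G) :
      EuclideanSpace ℝ (Fin n) →L[ℝ] EuclideanSpace ℝ (Fin n)) = ContinuousLinearMap.id ℝ _ := by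
  have hd : MDifferentiableAt (𝓡 n) 𝓘(ℝ, EuclideanSpace ℝ (Fin n)) (extChartAt (𝓡 n) (1 : G)) 1 :=
    (contMDiffAt_chartOne one_mem_source).mdifferentiableAt (by simp)
  have hid : writtenInExtChartAt (𝓡 n) 𝓘(ℝ, EuclideanSpace ℝ (Fin n)) (1 : G)
      (extChartAt (𝓡 n) (1 : G)) =ᶠ[𝓝 (coordOne n G)] id := by
    filter_upwards [(chartOne n G).open_target.mem_nhds coordOne_mem_target] with v hv
    simp only [writtenInExtChartAt, mfld_simps]
    exact (chartOne n G).right_inv hv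
  have hfderiv := hid.fderiv_eq (𝕜 := ℝ)
  rw [fderiv_id, ← fderivWithin_univ,
    ← ModelWithCorners.Boundaryless.range_eq_univ (I := 𝓡 n)] at hfderiv
  exact hd.mfderiv.trans hfderiv

theorem mpullbackWithin_extChartAt_symm {u : EuclideanSpace ℝ (Fin n)}
    (hu : u ∈ (chartOne n G).target) (X : GroupLieAlgebra (𝓡 n) G) :
    mpullbackWithin 𝓘(ℝ, EuclideanSpace ℝ (Fin n)) (𝓡 n) (extChartAt (𝓡 n) (1 : G)).symm
      (mulInvariantVectorField X) (range (𝓡 n)) u = leftDeriv n G u X := by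
  have hu' : u ∈ (extChartAt (𝓡 n) (1 : G)).target := by simpa only [mfld_simps] using hu
  have : IsManifold (𝓡 n) 1 G := IsManifold.of_le (n := ∞) (by simp)
  have hfield := mfderiv_chartOne_mulInvariantVectorField ((chartOne n G).map_target hu) X
  rw [(chartOne n G).right_inv hu] at hfield
  rw [mpullbackWithin_apply, ContinuousLinearMap.inverse_eq
    (mfderivWithin_extChartAt_symm_comp_mfderiv_extChartAt hu')
    (mfderiv_extChartAt_comp_mfderivWithin_extChartAt_symm hu')]
  exact hfield

theorem bracket_eq_fderiv_leftDeriv (Y Z : GroupLieAlgebra (𝓡 n) G) :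
    ⁅Y, Z⁆ = (fderiv ℝ (fun u => leftDeriv n G u Z) (coordOne n G) Y -
      fderiv ℝ (fun u => leftDeriv n G u Y) (coordOne n G) Z : EuclideanSpace ℝ (Fin n)) := by
  have hpull : ∀ X : GroupLieAlgebra (𝓡 n) G,
      (fun u => mpullbackWithin 𝓘(ℝ, EuclideanSpace ℝ (Fin n)) (𝓡 n)
        (extChartAt (𝓡 n) (1 : G)).symm (mulInvariantVectorField X) (range (𝓡 n)) u :
        EuclideanSpace ℝ (Fin n) → EuclideanSpace ℝ (Fin n)) =ᶠ[𝓝 (coordOne n G)]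
      fun u => leftDeriv n G u X := fun X => by
    filter_upwards [(chartOne n G).open_target.mem_nhds coordOne_mem_target] with u hu
    exact mpullbackWithin_extChartAt_symm hu X
  have huniv : (extChartAt (𝓡 n) (1 : G)).symm ⁻¹' univ ∩ range (𝓡 n) = univ := by
    rw [preimage_univ, univ_inter, ModelWithCorners.Boundaryless.range_eq_univ]
  have hinverse (L : EuclideanSpace ℝ (Fin n) →L[ℝ] EuclideanSpace ℝ (Fin n))
      (hL : L = ContinuousLinearMap.id ℝ _) (v : EuclideanSpace ℝ (Fin n)) : L.inverse v = v := by
    rw [hL, ContinuousLinearMap.inverse_id, ContinuousLinearMap.id_apply]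
  have hflat : lieBracket ℝ (fun u => leftDeriv n G u Y) (fun u => leftDeriv n G u Z)
      (coordOne n G) = fderiv ℝ (fun u => leftDeriv n G u Z) (coordOne n G) Y -
        fderiv ℝ (fun u => leftDeriv n G u Y) (coordOne n G) Z := by
    rw [lieBracket_eq]
    simp only [leftDeriv_coordOne]
    rfl
  have hwithin (V W : EuclideanSpace ℝ (Fin n) → EuclideanSpace ℝ (Fin n)) :
      lieBracketWithin ℝ V W ((extChartAt (𝓡 n) (1 : G)).symm ⁻¹' univ ∩ range (𝓡 n))
        (coordOne n G) = lieBracket ℝ V W (coordOne n G) := by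
    rw [huniv, lieBracketWithin_univ]
  exact (mlieBracketWithin_apply (I := 𝓡 n) (s := univ) (x₀ := (1 : G))).trans
    ((hinverse _ mfderiv_extChartAt_one _).trans ((hwithin _ _).trans
      (((hpull Y).lieBracket_vectorField_eq (hpull Z)).trans hflat)))

end Bracket

section Adjoint

variable {n : ℕ} {G : Type*} [TopologicalSpace G] [ChartedSpace (EuclideanSpace ℝ (Fin n)) G]
  [Group G]

variable (n) in
/-- The conjugation by `g` in the preferred chart at the identity. -/
noncomputable def chartConj (g : G) (v : EuclideanSpace ℝ (Fin n)) : EuclideanSpace ℝ (Fin n) :=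
  chartOne n G (g * (chartOne n G).symm v * g⁻¹)

variable (n) in
/-- The adjoint representation, on the model space of the preferred chart at the identity. -/
noncomputable def adjointMap (g : G) : EuclideanSpace ℝ (Fin n) →L[ℝ] EuclideanSpace ℝ (Fin n) :=
  fderiv ℝ (chartConj n g) (coordOne n G)

theorem conj_symm_coordOne (g : G) : g * (chartOne n G).symm (coordOne n G) * g⁻¹ = 1 := by
  rw [symm_coordOne, mul_one, mul_inv_cancel]

theorem conj_symm_coordOne_mem_source (g : G) :
    g * (chartOne n G).symm (coordOne n G) * g⁻¹ ∈ (chartOne n G).source := by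
  rw [conj_symm_coordOne]
  exact one_mem_source

theorem chartConj_coordOne (g : G) : chartConj n g (coordOne n G) = coordOne n G := by
  rw [chartConj, conj_symm_coordOne]

theorem adjointMap_one : adjointMap n (1 : G) = ContinuousLinearMap.id ℝ _ := by
  have hid : chartConj n (1 : G) =ᶠ[𝓝 (coordOne n G)] id := by
    filter_upwards [(chartOne n G).open_target.mem_nhds coordOne_mem_target] with v hv
    rw [chartConj, one_mul, inv_one, mul_one, (chartOne n G).right_inv hv, id]
  rw [adjointMap, hid.fderiv_eq, fderiv_id]

variable [LieGroup (𝓡 n) ∞ G]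

theorem contMDiffAt_conj_chartOne_symm (g : G) :
    ContMDiffAt 𝓘(ℝ, EuclideanSpace ℝ (Fin n)) (𝓡 n) ∞
      (fun v => g * (chartOne n G).symm v * g⁻¹) (coordOne n G) :=
  (contMDiffAt_const.mul (contMDiffAt_chartOne_symm coordOne_mem_target)).mul contMDiffAt_const

theorem eventually_conj_mem_source (g : G) :
    ∀ᶠ v in 𝓝 (coordOne n G), g * (chartOne n G).symm v * g⁻¹ ∈ (chartOne n G).source :=
  (contMDiffAt_conj_chartOne_symm g).continuousAt.eventually_mem
    ((chartOne n G).open_source.mem_nhds (conj_symm_coordOne_mem_source g))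

theorem contDiffAt_chartConj (g : G) : ContDiffAt ℝ ∞ (chartConj n g) (coordOne n G) :=
  ((contMDiffAt_chartOne (conj_symm_coordOne_mem_source g)).comp (coordOne n G)
    (contMDiffAt_conj_chartOne_symm g)).contDiffAt

theorem hasFDerivAt_chartConj (g : G) :
    HasFDerivAt (chartConj n g) (adjointMap n g) (coordOne n G) :=
  ((contDiffAt_chartConj g).differentiableAt (by simp)).hasFDerivAt

theorem adjointMap_mul (g h : G) :
    adjointMap n (g * h) = (adjointMap n g).comp (adjointMap n h) := by
  have hcomp : HasFDerivAt (chartConj n g ∘ chartConj n h) ((adjointMap n g).comp (adjointMap n h))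
      (coordOne n G) := by
    refine HasFDerivAt.comp _ ?_ (hasFDerivAt_chartConj h)
    rw [chartConj_coordOne]
    exact hasFDerivAt_chartConj g
  refine (hcomp.congr_of_eventuallyEq ?_).fderiv
  filter_upwards [eventually_conj_mem_source h] with v hv
  simp only [Function.comp, chartConj]
  rw [(chartOne n G).left_inv hv]
  congr 1
  group

theorem contDiffAt_chartConj_symm {u : EuclideanSpace ℝ (Fin n)} (hu : u ∈ (chartOne n G).target) :
    ContDiffAt ℝ ∞ (fun p : EuclideanSpace ℝ (Fin n) × EuclideanSpace ℝ (Fin n) =>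
      chartConj n ((chartOne n G).symm p.1) p.2) (u, coordOne n G) := by
  have hfst : ContMDiffAt 𝓘(ℝ, EuclideanSpace ℝ (Fin n) × EuclideanSpace ℝ (Fin n)) (𝓡 n) ∞
      (fun p : EuclideanSpace ℝ (Fin n) × EuclideanSpace ℝ (Fin n) => (chartOne n G).symm p.1)
      (u, coordOne n G) :=
    (contMDiffAt_chartOne_symm hu).comp (u, coordOne n G) contDiff_fst.contMDiff.contMDiffAt
  have hsnd : ContMDiffAt 𝓘(ℝ, EuclideanSpace ℝ (Fin n) × EuclideanSpace ℝ (Fin n)) (𝓡 n) ∞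
      (fun p : EuclideanSpace ℝ (Fin n) × EuclideanSpace ℝ (Fin n) => (chartOne n G).symm p.2)
      (u, coordOne n G) :=
    (contMDiffAt_chartOne_symm coordOne_mem_target).comp (u, coordOne n G)
      contDiff_snd.contMDiff.contMDiffAt
  exact ((contMDiffAt_chartOne (conj_symm_coordOne_mem_source _)).comp
    (u, coordOne n G) ((hfst.mul hsnd).mul hfst.inv)).contDiffAt

theorem differentiableAt_adjointMap_symm :
    DifferentiableAt ℝ (fun u => adjointMap n ((chartOne n G).symm u)) (coordOne n G) := by
  set q : EuclideanSpace ℝ (Fin n) × EuclideanSpace ℝ (Fin n) → EuclideanSpace ℝ (Fin n) :=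
    fun p => chartConj n ((chartOne n G).symm p.1) p.2
  have hpartial : ∀ u ∈ (chartOne n G).target, adjointMap n ((chartOne n G).symm u) =
      (fderiv ℝ q (u, coordOne n G)).comp
        (ContinuousLinearMap.inr ℝ (EuclideanSpace ℝ (Fin n)) (EuclideanSpace ℝ (Fin n))) :=
    fun u hu => (((contDiffAt_chartConj_symm hu).differentiableAt (by simp)).hasFDerivAt.comp
      (coordOne n G) (hasFDerivAt_prodMk_right u (coordOne n G))).fderiv
  have hfderiv : ContDiffAt ℝ ∞ (fderiv ℝ q) (coordOne n G, coordOne n G) :=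
    (contDiffAt_chartConj_symm coordOne_mem_target).fderiv_right (by simp)
  have hcomp := (ContDiffAt.comp (f := fun u => (id u, coordOne n G)) (coordOne n G) hfderiv
    (contDiffAt_id.prodMk contDiffAt_const)).clm_comp
      (contDiffAt_const (c := ContinuousLinearMap.inr ℝ _ _))
  refine (hcomp.differentiableAt (by simp)).congr_of_eventuallyEq ?_
  filter_upwards [(chartOne n G).open_target.mem_nhds coordOne_mem_target] with v hv
    using hpartial v hv

-- The identity `(g h g⁻¹) g = g h`, differentiated in `h` at the identity.
theorem fderiv_chartMul_adjointMap {u : EuclideanSpace ℝ (Fin n)} (hu : u ∈ (chartOne n G).target)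
    (Z : EuclideanSpace ℝ (Fin n)) :
    fderiv ℝ (chartMul n G) (coordOne n G, u) (adjointMap n ((chartOne n G).symm u) Z, 0) =
      leftDeriv n G u Z := by
  set g := (chartOne n G).symm u with hg
  have hderiv : HasFDerivAt (fun v => chartMul n G (chartConj n g v, u))
      ((fderiv ℝ (chartMul n G) (coordOne n G, u)).comp ((adjointMap n g).prod 0))
      (coordOne n G) := by
    refine HasFDerivAt.comp (g := chartMul n G) (coordOne n G) ?_
      ((hasFDerivAt_chartConj g).prodMk (hasFDerivAt_const u (coordOne n G)))
    rw [chartConj_coordOne]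
    exact ((contDiffAt_chartMul_coordOne_left hu).differentiableAt (by simp)).hasFDerivAt
  have hconj : (fun v => chartMul n G (u, v)) =ᶠ[𝓝 (coordOne n G)]
      fun v => chartMul n G (chartConj n g v, u) := by
    filter_upwards [eventually_conj_mem_source g] with v hv
    simp only [chartMul, chartConj]
    rw [(chartOne n G).left_inv hv, ← hg, inv_mul_cancel_right]
  rw [leftDeriv, hconj.fderiv_eq, hderiv.fderiv]
  rfl

theorem fderiv_chartMul_coordOne :
    fderiv ℝ (chartMul n G) (coordOne n G, coordOne n G) =
      ContinuousLinearMap.fst ℝ _ _ + ContinuousLinearMap.snd ℝ _ _ := by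
  have hleft (v : EuclideanSpace ℝ (Fin n)) :
      fderiv ℝ (chartMul n G) (coordOne n G, coordOne n G) (v, 0) = v := by
    simpa only [symm_coordOne, adjointMap_one, leftDeriv_coordOne, ContinuousLinearMap.id_apply]
      using fderiv_chartMul_adjointMap (coordOne_mem_target (n := n) (G := G)) v
  have hright (v : EuclideanSpace ℝ (Fin n)) :
      fderiv ℝ (chartMul n G) (coordOne n G, coordOne n G) (0, v) = v := by
    have happly := congrArg (fun L => L v) (leftDeriv_eq (coordOne_mem_target (n := n) (G := G)))
    rw [leftDeriv_coordOne] at happly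
    exact happly.symm
  refine ContinuousLinearMap.ext fun v => ?_
  conv_lhs => rw [← Prod.fst_add_snd v, map_add, hleft, hright]
  rfl

variable (n G) in
theorem differentiableAt_fderiv_chartMul :
    DifferentiableAt ℝ (fderiv ℝ (chartMul n G)) (coordOne n G, coordOne n G) :=
  ((contDiffAt_chartMul_coordOne_left coordOne_mem_target).fderiv_right
    (m := ∞) (by simp)).differentiableAt (by simp)

theorem hasFDerivAt_leftDeriv_apply (Y : EuclideanSpace ℝ (Fin n)) :
    HasFDerivAt (fun u => leftDeriv n G u Y)
      (((fderiv ℝ (fderiv ℝ (chartMul n G)) (coordOne n G, coordOne n G)).flip (0, Y)).comp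
        (ContinuousLinearMap.inl ℝ _ _)) (coordOne n G) := by
  have hfderiv := HasFDerivAt.comp (f := fun u => (u, coordOne n G)) (coordOne n G)
    (differentiableAt_fderiv_chartMul n G).hasFDerivAt (hasFDerivAt_prodMk_left _ _)
  have happly := hfderiv.clm_apply
    (hasFDerivAt_const ((0 : EuclideanSpace ℝ (Fin n)), Y) (coordOne n G))
  refine (happly.congr_of_eventuallyEq ?_).congr_fderiv ?_
  · filter_upwards [(chartOne n G).open_target.mem_nhds coordOne_mem_target] with u hu
    rw [leftDeriv_eq hu]
    rfl
  · ext1 v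
    simp

theorem hasFDerivAt_leftDeriv_apply_add_adjointMap (Z : EuclideanSpace ℝ (Fin n)) :
    HasFDerivAt (fun u => leftDeriv n G u Z)
      (((fderiv ℝ (fderiv ℝ (chartMul n G)) (coordOne n G, coordOne n G)).flip (Z, 0)).comp
        (ContinuousLinearMap.inr ℝ _ _) +
        (fderiv ℝ (fun u => adjointMap n ((chartOne n G).symm u)) (coordOne n G)).flip Z)
      (coordOne n G) := by
  have hfderiv := (differentiableAt_fderiv_chartMul n G).hasFDerivAt.comp (coordOne n G)
    (hasFDerivAt_prodMk_right (coordOne n G) (coordOne n G))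
  have hadjoint : HasFDerivAt (fun u => adjointMap n ((chartOne n G).symm u) Z)
      ((fderiv ℝ (fun u => adjointMap n ((chartOne n G).symm u)) (coordOne n G)).flip Z)
      (coordOne n G) := by
    refine (differentiableAt_adjointMap_symm.hasFDerivAt.clm_apply
      (hasFDerivAt_const Z (coordOne n G))).congr_fderiv ?_
    ext1 v
    simp
  have happly := hfderiv.clm_apply
    (hadjoint.prodMk (hasFDerivAt_const (0 : EuclideanSpace ℝ (Fin n)) (coordOne n G)))
  refine (happly.congr_of_eventuallyEq ?_).congr_fderiv ?_
  · filter_upwards [(chartOne n G).open_target.mem_nhds coordOne_mem_target] with u hu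
    exact (fderiv_chartMul_adjointMap hu Z).symm
  · ext1 v
    simp [fderiv_chartMul_coordOne, adjointMap_one, add_comm]

-- The mixed second derivatives of the multiplication cancel by symmetry.
theorem fderiv_adjointMap_symm_apply (Y Z : EuclideanSpace ℝ (Fin n)) :
    fderiv ℝ (fun u => adjointMap n ((chartOne n G).symm u)) (coordOne n G) Y Z =
      fderiv ℝ (fun u => leftDeriv n G u Z) (coordOne n G) Y -
        fderiv ℝ (fun u => leftDeriv n G u Y) (coordOne n G) Z := by
  have hsymm : IsSymmSndFDerivAt ℝ (chartMul n G) (coordOne n G, coordOne n G) :=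
    (contDiffAt_chartMul_coordOne_left coordOne_mem_target).isSymmSndFDerivAt (by
      rw [minSmoothness_of_isRCLikeNormedField]
      exact ENat.LEInfty.out)
  have hmixed := hsymm.eq (Z, 0) (0, Y)
  rw [(hasFDerivAt_leftDeriv_apply_add_adjointMap Z).fderiv,
    (hasFDerivAt_leftDeriv_apply Y).fderiv]
  simp [hmixed]

theorem bracket_eq_fderiv_adjointMap_symm (Y Z : GroupLieAlgebra (𝓡 n) G) :
    ⁅Y, Z⁆ = (fderiv ℝ (fun u => adjointMap n ((chartOne n G).symm u)) (coordOne n G) Y Z :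
      EuclideanSpace ℝ (Fin n)) :=
  (bracket_eq_fderiv_leftDeriv Y Z).trans (fderiv_adjointMap_symm_apply Y Z).symm

end Adjoint

section DifferentialToOne

variable {n : ℕ} {G : Type*} [TopologicalSpace G] [ChartedSpace (EuclideanSpace ℝ (Fin n)) G]
  [Group G] {D : Type*} [NormedAddCommGroup D] [NormedSpace ℝ D]
  {f g : D → G} {f' g' : D →L[ℝ] EuclideanSpace ℝ (Fin n)} {a : D}

/-- The map `f` sends `a` to the identity and has there the strict differential `f'`, read in the
preferred chart at the identity. Continuity is required separately, since the chart takes junk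
values outside its source. -/
structure HasDifferentialToOne (f : D → G) (f' : D →L[ℝ] EuclideanSpace ℝ (Fin n)) (a : D) :
    Prop where
  map_eq_one : f a = 1
  continuousAt : ContinuousAt f a
  hasStrictFDerivAt : HasStrictFDerivAt (fun s => chartOne n G (f s)) f' a

namespace HasDifferentialToOne

theorem const_one : HasDifferentialToOne (fun _ : D => (1 : G))
    (0 : D →L[ℝ] EuclideanSpace ℝ (Fin n)) a :=
  ⟨rfl, continuousAt_const, hasStrictFDerivAt_const _ _⟩

theorem eventually_mem_source (hf : HasDifferentialToOne f f' a) :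
    ∀ᶠ s in 𝓝 a, f s ∈ (chartOne n G).source :=
  hf.continuousAt.eventually_mem
    ((chartOne n G).open_source.mem_nhds (hf.map_eq_one ▸ one_mem_source))

theorem comp {D' : Type*} [NormedAddCommGroup D'] [NormedSpace ℝ D'] {p : D' → D} {p' : D' →L[ℝ] D}
    {b : D'} (hf : HasDifferentialToOne f f' (p b)) (hp : HasStrictFDerivAt p p' b) :
    HasDifferentialToOne (fun s => f (p s)) (f'.comp p') b :=
  ⟨hf.map_eq_one, ContinuousAt.comp hf.continuousAt hp.continuousAt,
    HasStrictFDerivAt.comp (g := fun t => chartOne n G (f t)) b hf.hasStrictFDerivAt hp⟩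

theorem image_mem_nhds_one [CompleteSpace D] (hf : HasDifferentialToOne f f' a)
    (hsurj : f'.range = ⊤) {S : Set D} (hS : S ∈ 𝓝 a) : f '' S ∈ 𝓝 (1 : G) := by
  have himage := image_mem_map (m := fun s => chartOne n G (f s))
    (inter_mem hS hf.eventually_mem_source)
  rw [hf.hasStrictFDerivAt.map_nhds_eq_of_surj hsurj, hf.map_eq_one] at himage
  filter_upwards [(chartOne n G).continuousAt one_mem_source himage,
    (chartOne n G).open_source.mem_nhds one_mem_source] with y ⟨s, ⟨hsS, hsource⟩, hsy⟩ hy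
  exact ⟨s, hsS, (chartOne n G).injOn hsource hy hsy⟩

variable [LieGroup (𝓡 n) ∞ G]

theorem mul (hf : HasDifferentialToOne f f' a) (hg : HasDifferentialToOne g g' a) :
    HasDifferentialToOne (fun s => f s * g s) (f' + g') a := by
  have : IsTopologicalGroup G := topologicalGroup_of_lieGroup (𝓡 n) ∞
  refine ⟨by rw [hf.map_eq_one, hg.map_eq_one, mul_one],
    hf.continuousAt.mul hg.continuousAt, ?_⟩
  have hmul := (contDiffAt_chartMul_coordOne_left
    (coordOne_mem_target (n := n) (G := G))).hasStrictFDerivAt (by simp)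
  rw [fderiv_chartMul_coordOne] at hmul
  have hcomp : HasStrictFDerivAt (fun s => chartMul n G (chartOne n G (f s), chartOne n G (g s)))
      (ContinuousLinearMap.comp (ContinuousLinearMap.fst ℝ _ _ + ContinuousLinearMap.snd ℝ _ _)
        (f'.prod g')) a := by
    refine HasStrictFDerivAt.comp (g := chartMul n G) a ?_
      (hf.hasStrictFDerivAt.prodMk hg.hasStrictFDerivAt)
    rwa [hf.map_eq_one, hg.map_eq_one]
  refine (hcomp.congr_of_eventuallyEq ?_).congr_fderiv ?_
  · filter_upwards [hf.eventually_mem_source, hg.eventually_mem_source] with s hfs hgs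
    rw [chartMul, (chartOne n G).left_inv hfs, (chartOne n G).left_inv hgs]
  · ext1 v
    simp

theorem conj (hf : HasDifferentialToOne f f' a) (h : G) :
    HasDifferentialToOne (fun s => h * f s * h⁻¹) ((adjointMap n h).comp f') a := by
  have : IsTopologicalGroup G := topologicalGroup_of_lieGroup (𝓡 n) ∞
  refine ⟨by rw [hf.map_eq_one, mul_one, mul_inv_cancel],
    (continuousAt_const.mul hf.continuousAt).mul continuousAt_const, ?_⟩
  have hconj : HasStrictFDerivAt (chartConj n h) (adjointMap n h) (chartOne n G (f a)) := by
    rw [hf.map_eq_one]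
    exact (contDiffAt_chartConj h).hasStrictFDerivAt (by simp)
  refine (hconj.comp a hf.hasStrictFDerivAt).congr_of_eventuallyEq ?_
  filter_upwards [hf.eventually_mem_source] with s hs
  rw [chartConj, (chartOne n G).left_inv hs]

theorem hasDerivAt_adjointMap {γ : ℝ → G} {Y : GroupLieAlgebra (𝓡 n) G}
    (hγ : HasDifferentialToOne γ (.toSpanSingleton ℝ (Y : EuclideanSpace ℝ (Fin n))) 0)
    (Z : GroupLieAlgebra (𝓡 n) G) :
    HasDerivAt (fun s => adjointMap n (γ s) Z)
      ((⁅Y, Z⁆ : GroupLieAlgebra (𝓡 n) G) : EuclideanSpace ℝ (Fin n)) 0 := by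
  have hAd : HasFDerivAt (fun u => adjointMap n ((chartOne n G).symm u))
      (fderiv ℝ (fun u => adjointMap n ((chartOne n G).symm u)) (coordOne n G))
      (chartOne n G (γ 0)) := by
    rw [hγ.map_eq_one]
    exact differentiableAt_adjointMap_symm.hasFDerivAt
  have hcomp := hAd.comp_hasDerivAt (0 : ℝ) (hasStrictDerivAt_iff_hasStrictFDerivAt.2
    hγ.hasStrictFDerivAt).hasDerivAt
  have happly (Z' : EuclideanSpace ℝ (Fin n)) :
      HasDerivAt (fun s => adjointMap n ((chartOne n G).symm (chartOne n G (γ s))) Z')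
        (fderiv ℝ (fun u => adjointMap n ((chartOne n G).symm u)) (coordOne n G) Y Z') 0 :=
    (ContinuousLinearMap.apply ℝ (EuclideanSpace ℝ (Fin n)) Z').hasFDerivAt.comp_hasDerivAt (0 : ℝ)
      hcomp
  rw [bracket_eq_fderiv_adjointMap_symm Y Z]
  refine (happly Z).congr_of_eventuallyEq ?_
  filter_upwards [hγ.eventually_mem_source] with t ht
  rw [(chartOne n G).left_inv ht]

end HasDifferentialToOne

end DifferentialToOne

section Conjugates

variable {n : ℕ} {G : Type*} [TopologicalSpace G] [ChartedSpace (EuclideanSpace ℝ (Fin n)) G]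
  [Group G]

/-- The conjugates of the horizontal vectors by the points at distance less than `ρ` from the
identity. -/
def conjugates (𝓗 : Submodule ℝ (GroupLieAlgebra (𝓡 n) G))
    (Q : LinearMap.BilinForm ℝ (GroupLieAlgebra (𝓡 n) G)) (ρ : ℝ) :
    Set (EuclideanSpace ℝ (Fin n)) :=
  {v | ∃ h : G, ccDist 𝓗 Q 1 h < ENNReal.ofReal ρ ∧ ∃ X ∈ 𝓗, adjointMap n h X = v}

variable {𝓗 : Submodule ℝ (GroupLieAlgebra (𝓡 n) G)}
  {Q : LinearMap.BilinForm ℝ (GroupLieAlgebra (𝓡 n) G)}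

theorem conjugates_mono : Monotone (conjugates 𝓗 Q) := fun _ _ hρσ _ ⟨h, hh, hX⟩ =>
  ⟨h, hh.trans_le (ENNReal.ofReal_le_ofReal hρσ), hX⟩

variable [LieGroup (𝓡 n) ∞ G]

theorem ccDist_one_mul_le (x y : G) :
    ccDist 𝓗 Q 1 (x * y) ≤ ccDist 𝓗 Q 1 x + ccDist 𝓗 Q 1 y := by
  have hleft := ccDist_mul_left (𝓗 := 𝓗) (Q := Q) (x := 1) (y := y) x
  rw [mul_one] at hleft
  exact hleft ▸ ccDist_triangle

theorem ccDist_one_inv (x : G) : ccDist 𝓗 Q 1 x⁻¹ = ccDist 𝓗 Q 1 x := by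
  rw [← ccDist_mul_left x, mul_one, mul_inv_cancel, ccDist_comm]

theorem exists_curve_of_mem {X : GroupLieAlgebra (𝓡 n) G} (hX : X ∈ 𝓗) :
    ∃ γ : ℝ → G, HasDifferentialToOne γ (.toSpanSingleton ℝ (X : EuclideanSpace ℝ (Fin n))) 0 ∧
      Tendsto (fun s => ccDist 𝓗 Q 1 (γ s)) (𝓝 0) (𝓝 0) := by
  obtain ⟨γ, h0, hγ⟩ := exists_velocity_eq_mulInvariantVectorField X
  refine ⟨γ, ⟨h0, hγ.self_of_nhds.1.continuousAt, hasStrictDerivAt_chartOne_comp h0 hγ⟩, ?_⟩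
  have hbound : Tendsto (fun s : ℝ => ENNReal.ofReal (√(Q X X) * |s|)) (𝓝 0) (𝓝 0) := by
    refine (ENNReal.continuous_ofReal.comp (by fun_prop)).tendsto' 0 0 ?_
    rw [Function.comp_apply, abs_zero, mul_zero, ENNReal.ofReal_zero]
  exact tendsto_of_tendsto_of_tendsto_of_le_of_le' tendsto_const_nhds hbound
    (Eventually.of_forall fun _ => zero_le) (eventually_ccDist_le hX h0 hγ)

theorem mem_conjugates {ρ : ℝ} (hρ : 0 < ρ) {X : GroupLieAlgebra (𝓡 n) G} (hX : X ∈ 𝓗) :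
    (X : EuclideanSpace ℝ (Fin n)) ∈ conjugates 𝓗 Q ρ :=
  ⟨1, by rwa [ccDist_self, ENNReal.ofReal_pos], X, hX, by rw [adjointMap_one]; rfl⟩

theorem adjointMap_mem_conjugates {ρ σ : ℝ} {g : G} (hg : ccDist 𝓗 Q 1 g < ENNReal.ofReal ρ)
    {v : EuclideanSpace ℝ (Fin n)} (hv : v ∈ conjugates 𝓗 Q σ) :
    adjointMap n g v ∈ conjugates 𝓗 Q (ρ + σ) := by
  obtain ⟨h, hh, X, hX, rfl⟩ := hv
  have hρ := ENNReal.ofReal_pos.1 (pos_of_gt hg)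
  have hσ := ENNReal.ofReal_pos.1 (pos_of_gt hh)
  refine ⟨g * h, ?_, X, hX, by rw [adjointMap_mul]; rfl⟩
  rw [ENNReal.ofReal_add hρ.le hσ.le]
  exact (ccDist_one_mul_le g h).trans_lt (ENNReal.add_lt_add hg hh)

theorem mem_of_hasDerivAt_of_eventually_mem {E : Type*} [NormedAddCommGroup E] [NormedSpace ℝ E]
    [FiniteDimensional ℝ E] {W : Submodule ℝ E} {f : ℝ → E} {f' : E} {t : ℝ}
    (hf : HasDerivAt f f' t) (hmem : ∀ᶠ s in 𝓝 t, f s ∈ W) : f' ∈ W := by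
  refine W.closed_of_finiteDimensional.mem_of_tendsto (hasDerivAt_iff_tendsto_slope.1 hf) ?_
  filter_upwards [nhdsWithin_le_nhds hmem] with s hs
  exact W.smul_mem _ (W.sub_mem hs hmem.self_of_nhds)

theorem bracket_mem_span_conjugates {ρ σ : ℝ} (hσρ : σ < ρ) {Y Z : GroupLieAlgebra (𝓡 n) G}
    (hY : Y ∈ 𝓗) (hZ : (Z : EuclideanSpace ℝ (Fin n)) ∈ Submodule.span ℝ (conjugates 𝓗 Q σ)) :
    ((⁅Y, Z⁆ : GroupLieAlgebra (𝓡 n) G) : EuclideanSpace ℝ (Fin n)) ∈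
      Submodule.span ℝ (conjugates 𝓗 Q ρ) := by
  obtain ⟨γ, hγ, hdist⟩ := exists_curve_of_mem (Q := Q) hY
  refine mem_of_hasDerivAt_of_eventually_mem (hγ.hasDerivAt_adjointMap Z) ?_
  filter_upwards [hdist.eventually_lt_const (ENNReal.ofReal_pos.2 (sub_pos.2 hσρ))] with s hs
  have hle : Submodule.span ℝ (conjugates 𝓗 Q σ) ≤
      (Submodule.span ℝ (conjugates 𝓗 Q ρ)).comap (adjointMap n (γ s)).toLinearMap :=
    Submodule.span_le.2 fun v hv => Submodule.subset_span
      (sub_add_cancel ρ σ ▸ adjointMap_mem_conjugates hs hv)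
  exact hle hZ

theorem eq_top_of_lieSpan_eq_top {R L : Type*} [CommRing R] [LieRing L] [LieAlgebra R L]
    {H W : Submodule R L} (hHW : H ≤ W) (h : ∀ Y ∈ H, ∀ Z ∈ W, ⁅Y, Z⁆ ∈ W)
    (hspan : LieSubalgebra.lieSpan R L (H : Set L) = ⊤) : W = ⊤ := by
  have hideal : ∀ Y : L, ∀ Z ∈ W, ⁅Y, Z⁆ ∈ W := by
    intro Y
    have hY : Y ∈ LieSubalgebra.lieSpan R L (H : Set L) := hspan ▸ LieSubalgebra.mem_top Y
    induction hY using LieSubalgebra.lieSpan_induction with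
    | mem Y hY => exact h Y hY
    | zero => exact fun Z _ => by rw [zero_lie]; exact W.zero_mem
    | add x y _ _ hx hy => exact fun Z hZ => by rw [add_lie]; exact W.add_mem (hx Z hZ) (hy Z hZ)
    | smul a x _ hx => exact fun Z hZ => by rw [smul_lie]; exact W.smul_mem a (hx Z hZ)
    | lie x y _ _ hx hy =>
      exact fun Z hZ => by rw [lie_lie]; exact W.sub_mem (hx _ (hy Z hZ)) (hy _ (hx Z hZ))
  let K : LieSubalgebra R L := { W with lie_mem' := fun {x y} _ hy => hideal x y hy }
  have hK : LieSubalgebra.lieSpan R L (H : Set L) ≤ K := LieSubalgebra.lieSpan_le.2 hHW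
  exact eq_top_iff.2 fun x _ => hK (hspan ▸ LieSubalgebra.mem_top x)

-- For `ρ` minimizing the dimension, the span is stable under brackets with horizontal vectors.
theorem span_conjugates_eq_top
    (h𝓗 : LieSubalgebra.lieSpan ℝ (GroupLieAlgebra (𝓡 n) G)
      (𝓗 : Set (GroupLieAlgebra (𝓡 n) G)) = ⊤) {r : ℝ} (hr : 0 < r) :
    Submodule.span ℝ (conjugates 𝓗 Q r) = ⊤ := by
  set W : ℝ → Submodule ℝ (EuclideanSpace ℝ (Fin n)) :=
    fun ρ => Submodule.span ℝ (conjugates 𝓗 Q ρ)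
  have hmono : Monotone W := fun ρ σ hρσ => Submodule.span_mono (conjugates_mono hρσ)
  obtain ⟨ρ, ⟨hρ, hρr⟩, hmin⟩ := WellFounded.has_min
    (measure fun ρ => Module.finrank ℝ (W ρ)).wf (Ioc 0 r) ⟨r, hr, le_rfl⟩
  have hstable : W (ρ / 2) = W ρ := Submodule.eq_of_le_of_finrank_le (hmono (half_le_self hρ.le))
    (not_lt.1 (hmin (ρ / 2) ⟨half_pos hρ, (half_le_self hρ.le).trans hρr⟩))
  have hsubset : ∀ X ∈ 𝓗, (X : EuclideanSpace ℝ (Fin n)) ∈ W ρ :=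
    fun _ hX => Submodule.subset_span (mem_conjugates hρ hX)
  have hbracket : ∀ Y ∈ 𝓗, ∀ Z : GroupLieAlgebra (𝓡 n) G, (Z : EuclideanSpace ℝ (Fin n)) ∈ W ρ →
      ((⁅Y, Z⁆ : GroupLieAlgebra (𝓡 n) G) : EuclideanSpace ℝ (Fin n)) ∈ W ρ :=
    fun _ hY _ hZ => bracket_mem_span_conjugates (half_lt_self hρ) hY (hstable.ge hZ)
  have htop : W ρ = ⊤ :=
    @eq_top_of_lieSpan_eq_top ℝ (GroupLieAlgebra (𝓡 n) G) _ _ _ 𝓗 (W ρ) hsubset hbracket h𝓗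
  exact top_le_iff.1 (htop ▸ hmono hρr)

end Conjugates

section Chow

variable {n : ℕ} {G : Type*} [TopologicalSpace G] [ChartedSpace (EuclideanSpace ℝ (Fin n)) G]
  [Group G] [LieGroup (𝓡 n) ∞ G]
  {𝓗 : Submodule ℝ (GroupLieAlgebra (𝓡 n) G)}
  {Q : LinearMap.BilinForm ℝ (GroupLieAlgebra (𝓡 n) G)}

theorem exists_curve_of_mem_conjugates {ρ : ℝ} {v : EuclideanSpace ℝ (Fin n)}
    (hv : v ∈ conjugates 𝓗 Q ρ) :
    ∃ γ : ℝ → G, HasDifferentialToOne γ (.toSpanSingleton ℝ v) 0 ∧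
      ∀ᶠ s in 𝓝 (0 : ℝ), ccDist 𝓗 Q 1 (γ s) ≤ 3 * ENNReal.ofReal ρ := by
  obtain ⟨h, hh, X, hX, rfl⟩ := hv
  obtain ⟨γ, hγ, hdist⟩ := exists_curve_of_mem (Q := Q) hX
  refine ⟨fun t => h * γ t * h⁻¹, ?_, ?_⟩
  · exact ContinuousLinearMap.comp_toSpanSingleton (R₁ := ℝ) (adjointMap n h) X ▸ hγ.conj h
  · filter_upwards [hdist.eventually_lt_const (pos_of_gt hh)] with s hs
    calc ccDist 𝓗 Q 1 (h * γ s * h⁻¹)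
        ≤ ccDist 𝓗 Q 1 h + ccDist 𝓗 Q 1 (γ s) + ccDist 𝓗 Q 1 h⁻¹ :=
          (ccDist_one_mul_le _ _).trans (add_le_add_left (ccDist_one_mul_le _ _) _)
      _ ≤ ENNReal.ofReal ρ + ENNReal.ofReal ρ + ENNReal.ofReal ρ := by
          rw [ccDist_one_inv]
          gcongr
      _ = 3 * ENNReal.ofReal ρ := by ring

theorem exists_map_of_mem_conjugates {ρ : ℝ} {ι : Type*} [Fintype ι]
    {v : ι → EuclideanSpace ℝ (Fin n)} (hv : ∀ i, v i ∈ conjugates 𝓗 Q ρ) (T : Finset ι) :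
    ∃ F : (ι → ℝ) → G, HasDifferentialToOne F
        (∑ i ∈ T, (ContinuousLinearMap.toSpanSingleton ℝ (v i)).comp (.proj i)) 0 ∧
      ∀ᶠ s in 𝓝 (0 : ι → ℝ), ccDist 𝓗 Q 1 (F s) ≤ T.card * (3 * ENNReal.ofReal ρ) := by
  classical
  induction T using Finset.induction_on with
  | empty =>
    refine ⟨fun _ => 1, by simpa only [Finset.sum_empty] using .const_one, .of_forall fun s => ?_⟩
    rw [ccDist_self]
    exact zero_le
  | insert i T hi ih =>
    obtain ⟨F, hF, hFdist⟩ := ih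
    obtain ⟨γ, hγ, hγdist⟩ := exists_curve_of_mem_conjugates (hv i)
    have hproj : HasStrictFDerivAt (fun s : ι → ℝ => s i) (.proj i) 0 :=
      (ContinuousLinearMap.proj (R := ℝ) (φ := fun _ : ι => ℝ) i).hasStrictFDerivAt
    refine ⟨fun s => γ (s i) * F s, ?_, ?_⟩
    · rw [Finset.sum_insert hi]
      exact (HasDifferentialToOne.comp (f := γ) (p := fun s : ι → ℝ => s i) hγ hproj).mul hF
    · filter_upwards [hFdist, hproj.continuousAt.eventually hγdist] with s hFs hγs
      rw [Finset.card_insert_of_notMem hi, Nat.cast_add, Nat.cast_one, add_mul, one_mul, add_comm]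
      exact (ccDist_one_mul_le _ _).trans (add_le_add hγs hFs)

theorem setOf_ccDist_lt_mem_nhds
    (h𝓗 : LieSubalgebra.lieSpan ℝ (GroupLieAlgebra (𝓡 n) G)
      (𝓗 : Set (GroupLieAlgebra (𝓡 n) G)) = ⊤) {r : ℝ} (hr : 0 < r) :
    {y | ccDist 𝓗 Q 1 y < ENNReal.ofReal r} ∈ 𝓝 (1 : G) := by
  set ρ : ℝ := r / (3 * (n + 1)) with hρ
  have htop : Submodule.span ℝ (conjugates 𝓗 Q ρ) = ⊤ :=
    span_conjugates_eq_top h𝓗 (by positivity)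
  obtain ⟨v, hv, hspan, -⟩ := Submodule.exists_fun_fin_finrank_span_eq ℝ (conjugates 𝓗 Q ρ)
  have hcard : Module.finrank ℝ (Submodule.span ℝ (conjugates 𝓗 Q ρ)) = n := by
    rw [htop, finrank_top, finrank_euclideanSpace_fin]
  obtain ⟨F, hF, hdist⟩ := exists_map_of_mem_conjugates hv Finset.univ
  refine mem_of_superset (hF.image_mem_nhds_one ?_ hdist) ?_
  · refine top_le_iff.1 ((hspan.trans htop).ge.trans (Submodule.span_le.2 ?_))
    rintro _ ⟨i, rfl⟩
    exact ⟨Pi.single i 1, by simp [Pi.single_apply]⟩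
  · rintro _ ⟨s, hs, rfl⟩
    refine (mem_ofPred_eq ▸ hs : ccDist 𝓗 Q 1 (F s) ≤ _).trans_lt ?_
    have hsum : (n : ℝ) * (3 * ρ) = r * (n / (n + 1)) := by
      rw [hρ]
      field_simp
    rw [Finset.card_univ, Fintype.card_fin, hcard, ← ENNReal.ofReal_natCast, ← ENNReal.ofReal_ofNat,
      ← ENNReal.ofReal_mul (by positivity), ← ENNReal.ofReal_mul (by positivity),
      ENNReal.ofReal_lt_ofReal_iff hr, hsum]
    exact mul_lt_of_lt_one_right hr ((div_lt_one (by positivity)).2 (lt_add_one _))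

end Chow

section Balls

open scoped Pointwise

variable {n : ℕ} {G : Type*} [TopologicalSpace G] [ChartedSpace (EuclideanSpace ℝ (Fin n)) G]
  [Group G] [LieGroup (𝓡 n) ∞ G]
  {𝓗 : Submodule ℝ (GroupLieAlgebra (𝓡 n) G)}
  {Q : LinearMap.BilinForm ℝ (GroupLieAlgebra (𝓡 n) G)}

theorem ccDist_eq_ccDist_one (x y : G) : ccDist 𝓗 Q x y = ccDist 𝓗 Q 1 (x⁻¹ * y) := by
  rw [← ccDist_mul_left x⁻¹, inv_mul_cancel]

theorem ccBall_eq_preimage (x : G) (r : ℝ) :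
    ccBall 𝓗 Q x r = (fun y => x⁻¹ * y) ⁻¹' ccBall 𝓗 Q 1 r := by
  ext y
  rw [ccBall, mem_ofPred_eq, ccDist_eq_ccDist_one]
  rfl

theorem measure_ccBall_eq [MeasurableSpace G] [BorelSpace G] (μ : Measure G)
    [μ.IsMulLeftInvariant] (x y : G) (r : ℝ) : μ (ccBall 𝓗 Q x r) = μ (ccBall 𝓗 Q y r) := by
  have : IsTopologicalGroup G := topologicalGroup_of_lieGroup (𝓡 n) ∞
  rw [ccBall_eq_preimage x, ccBall_eq_preimage y, measure_preimage_mul, measure_preimage_mul]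

theorem exists_ccBall_subset [T2Space G] (hQpos : ∀ X, X ≠ 0 → 0 < Q X X) {x : G} {U : Set G}
    (hU : U ∈ 𝓝 x) : ∃ r : ℝ, 0 < r ∧ ccBall 𝓗 Q x r ⊆ U := by
  have : IsTopologicalGroup G := topologicalGroup_of_lieGroup (𝓡 n) ∞
  have hU' : (fun y => x * y) ⁻¹' U ∈ 𝓝 (1 : G) :=
    (continuous_const_mul x).tendsto' 1 x (mul_one x) hU
  obtain ⟨r, hr, h⟩ := exists_ccDist_lt_imp_mem (𝓗 := 𝓗) hQpos hU'
  refine ⟨r, hr, fun y hy => ?_⟩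
  rw [ccBall_eq_preimage] at hy
  simpa only [mem_preimage, mul_inv_cancel_left] using h _ hy

theorem exists_isCompact_ccBall_one_subset [T2Space G] (hQpos : ∀ X, X ≠ 0 → 0 < Q X X) :
    ∃ ρ : ℝ, 0 < ρ ∧ ∀ k : ℕ, ∃ K, IsCompact K ∧ ccBall 𝓗 Q (1 : G) ((k + 1) * ρ) ⊆ K := by
  have : IsTopologicalGroup G := topologicalGroup_of_lieGroup (𝓡 n) ∞
  have : LocallyCompactSpace G := Manifold.locallyCompact_of_finiteDimensional (𝓡 n)
  obtain ⟨K₀, hK₀, hK₀n⟩ := exists_compact_mem_nhds (1 : G)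
  obtain ⟨ρ, hρ, hsub⟩ := exists_ccBall_subset (𝓗 := 𝓗) hQpos hK₀n
  refine ⟨ρ, hρ, fun k => ?_⟩
  induction k with
  | zero => exact ⟨K₀, hK₀, by rwa [Nat.cast_zero, zero_add, one_mul]⟩
  | succ k ih =>
    obtain ⟨K, hK, hKsub⟩ := ih
    refine ⟨K * K₀, hK.mul hK₀, fun y hy => ?_⟩
    have hy' : ccDist 𝓗 Q 1 y < ENNReal.ofReal ((k + 1) * ρ) + ENNReal.ofReal ρ := by
      rwa [← ENNReal.ofReal_add (by positivity) hρ.le, ← add_one_mul, ← Nat.cast_add_one]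
    obtain ⟨z, hz, hzy⟩ := exists_ccDist_lt_and_lt
      (ENNReal.ofReal_pos.2 (by positivity)) (ENNReal.ofReal_pos.2 hρ) hy'
    rw [ccDist_eq_ccDist_one] at hzy
    exact ⟨z, hKsub hz, z⁻¹ * y, hsub hzy, mul_inv_cancel_left z y⟩

theorem exists_isCompact_ccBall_subset [T2Space G] (hQpos : ∀ X, X ≠ 0 → 0 < Q X X) (x : G)
    (r : ℝ) : ∃ K, IsCompact K ∧ ccBall 𝓗 Q x r ⊆ K := by
  have : IsTopologicalGroup G := topologicalGroup_of_lieGroup (𝓡 n) ∞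
  obtain ⟨ρ, hρ, h⟩ := exists_isCompact_ccBall_one_subset (𝓗 := 𝓗) hQpos
  obtain ⟨k, hk⟩ := exists_nat_gt (r / ρ)
  obtain ⟨K, hK, hsub⟩ := h k
  have hr : r ≤ (k + 1) * ρ := (div_le_iff₀ hρ).1 (hk.le.trans (lt_add_one _).le)
  refine ⟨(fun y => x * y) '' K, hK.image (continuous_const_mul x), fun y hy => ?_⟩
  rw [ccBall_eq_preimage] at hy
  exact ⟨x⁻¹ * y, hsub (lt_of_lt_of_le hy (ENNReal.ofReal_le_ofReal hr)), mul_inv_cancel_left x y⟩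

theorem measure_ccBall_ne_top [T2Space G] [MeasurableSpace G] (ν : Measure G)
    [IsFiniteMeasureOnCompacts ν] (hQpos : ∀ X, X ≠ 0 → 0 < Q X X) (x : G) (r : ℝ) :
    ν (ccBall 𝓗 Q x r) ≠ ⊤ := by
  obtain ⟨K, hK, hsub⟩ := exists_isCompact_ccBall_subset (𝓗 := 𝓗) hQpos x r
  exact ((measure_mono hsub).trans_lt hK.measure_lt_top).ne

theorem ccBall_mem_nhds
    (h𝓗 : LieSubalgebra.lieSpan ℝ (GroupLieAlgebra (𝓡 n) G)
      (𝓗 : Set (GroupLieAlgebra (𝓡 n) G)) = ⊤) (x : G) {r : ℝ} (hr : 0 < r) :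
    ccBall 𝓗 Q x r ∈ 𝓝 x := by
  have : IsTopologicalGroup G := topologicalGroup_of_lieGroup (𝓡 n) ∞
  rw [ccBall_eq_preimage]
  exact (continuous_const_mul x⁻¹).tendsto' x 1 (inv_mul_cancel x)
    (setOf_ccDist_lt_mem_nhds h𝓗 hr)

theorem measure_ccBall_ne_zero [MeasurableSpace G] (μ : Measure G) [μ.IsOpenPosMeasure]
    (h𝓗 : LieSubalgebra.lieSpan ℝ (GroupLieAlgebra (𝓡 n) G)
      (𝓗 : Set (GroupLieAlgebra (𝓡 n) G)) = ⊤) (x : G) (r : ℝ) (hr : 0 < r) :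
    μ (ccBall 𝓗 Q x r) ≠ 0 :=
  (Measure.measure_pos_of_mem_nhds μ (ccBall_mem_nhds h𝓗 x hr)).ne'

theorem isOpen_ccBall
    (h𝓗 : LieSubalgebra.lieSpan ℝ (GroupLieAlgebra (𝓡 n) G)
      (𝓗 : Set (GroupLieAlgebra (𝓡 n) G)) = ⊤) (x : G) (r : ℝ) : IsOpen (ccBall 𝓗 Q x r) := by
  refine isOpen_iff_mem_nhds.2 fun y hy => ?_
  obtain ⟨ε, hε, hlt⟩ := ENNReal.lt_iff_exists_add_pos_lt.1 hy
  refine mem_of_superset (ccBall_mem_nhds (Q := Q) h𝓗 y (NNReal.coe_pos.2 hε)) fun z hz => ?_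
  refine ccDist_triangle.trans_lt ((add_le_add le_rfl (le_of_lt hz)).trans_lt ?_)
  rwa [ENNReal.ofReal_coe_nnreal]

variable [ConnectedSpace G]

theorem ccDist_ne_top
    (h𝓗 : LieSubalgebra.lieSpan ℝ (GroupLieAlgebra (𝓡 n) G)
      (𝓗 : Set (GroupLieAlgebra (𝓡 n) G)) = ⊤) (x y : G) : ccDist 𝓗 Q x y ≠ ⊤ := by
  have : IsTopologicalGroup G := topologicalGroup_of_lieGroup (𝓡 n) ∞
  let S : Subgroup G :=
    { carrier := {y | ccDist 𝓗 Q 1 y < ⊤}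
      one_mem' := by rw [mem_ofPred_eq, ccDist_self]; exact ENNReal.zero_lt_top
      mul_mem' := fun ha hb => (ccDist_one_mul_le _ _).trans_lt (ENNReal.add_lt_top.2 ⟨ha, hb⟩)
      inv_mem' := fun ha => (ccDist_one_inv _).trans_lt ha }
  have hnhds : (S : Set G) ∈ 𝓝 (1 : G) :=
    mem_of_superset (ccBall_mem_nhds (Q := Q) h𝓗 1 one_pos) fun y hy =>
      lt_top_of_lt (a := ccDist 𝓗 Q 1 y) hy
  have hopen := S.isOpen_of_mem_nhds hnhds
  have huniv : (S : Set G) = univ :=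
    IsClopen.eq_univ ⟨S.isClosed_of_isOpen hopen, hopen⟩ ⟨1, S.one_mem⟩
  rw [ccDist_eq_ccDist_one]
  exact ne_of_lt (huniv.ge (mem_univ (x⁻¹ * y)))

theorem toReal_ccDist_lt_iff
    (h𝓗 : LieSubalgebra.lieSpan ℝ (GroupLieAlgebra (𝓡 n) G)
      (𝓗 : Set (GroupLieAlgebra (𝓡 n) G)) = ⊤) {x y : G} {r : ℝ} :
    (ccDist 𝓗 Q x y).toReal < r ↔ y ∈ ccBall 𝓗 Q x r :=
  (ENNReal.lt_ofReal_iff_toReal_lt (ccDist_ne_top h𝓗 x y)).symm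

variable [T2Space G]

/-- The Carnot–Carathéodory distance as a metric structure inducing the given topology of `G`. -/
noncomputable abbrev ccPseudoMetricSpace (hQpos : ∀ X, X ≠ 0 → 0 < Q X X)
    (h𝓗 : LieSubalgebra.lieSpan ℝ (GroupLieAlgebra (𝓡 n) G)
      (𝓗 : Set (GroupLieAlgebra (𝓡 n) G)) = ⊤) : PseudoMetricSpace G :=
  PseudoMetricSpace.ofDistTopology (fun x y => (ccDist 𝓗 Q x y).toReal)
    (fun x => by rw [ccDist_self, ENNReal.toReal_zero])
    (fun x y => by rw [ccDist_comm])
    (fun x y z => by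
      have hxy : ccDist 𝓗 Q x y ≠ ⊤ := ccDist_ne_top h𝓗 x y
      have hyz : ccDist 𝓗 Q y z ≠ ⊤ := ccDist_ne_top h𝓗 y z
      rw [← ENNReal.toReal_add hxy hyz]
      exact ENNReal.toReal_mono (ENNReal.add_ne_top.2 ⟨hxy, hyz⟩) ccDist_triangle)
    (fun s => by
      simp only [toReal_ccDist_lt_iff h𝓗]
      refine ⟨fun hs x hx => exists_ccBall_subset hQpos (hs.mem_nhds hx), fun hs => ?_⟩
      refine isOpen_iff_mem_nhds.2 fun x hx => ?_
      obtain ⟨r, hr, h⟩ := hs x hx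
      exact mem_of_superset (ccBall_mem_nhds h𝓗 x hr) h)

theorem ccBall_eq_ball (hQpos : ∀ X, X ≠ 0 → 0 < Q X X)
    (h𝓗 : LieSubalgebra.lieSpan ℝ (GroupLieAlgebra (𝓡 n) G)
      (𝓗 : Set (GroupLieAlgebra (𝓡 n) G)) = ⊤) :
    ccBall 𝓗 Q = @Metric.ball G (ccPseudoMetricSpace hQpos h𝓗) := by
  let _ : PseudoMetricSpace G := ccPseudoMetricSpace hQpos h𝓗
  ext x r y
  rw [Metric.mem_ball']
  exact (toReal_ccDist_lt_iff h𝓗).symm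

theorem properSpace_ccPseudoMetricSpace (hQpos : ∀ X, X ≠ 0 → 0 < Q X X)
    (h𝓗 : LieSubalgebra.lieSpan ℝ (GroupLieAlgebra (𝓡 n) G)
      (𝓗 : Set (GroupLieAlgebra (𝓡 n) G)) = ⊤) :
    @ProperSpace G (ccPseudoMetricSpace hQpos h𝓗) := by
  let _ : PseudoMetricSpace G := ccPseudoMetricSpace hQpos h𝓗
  refine ⟨fun x r => ?_⟩
  obtain ⟨K, hK, hsub⟩ := exists_isCompact_ccBall_subset (𝓗 := 𝓗) hQpos x (r + 1)
  rw [ccBall_eq_ball hQpos h𝓗] at hsub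
  exact hK.of_isClosed_subset Metric.isClosed_closedBall
    ((Metric.closedBall_subset_ball (lt_add_one r)).trans hsub)

theorem lengthProperty_ccPseudoMetricSpace (hQpos : ∀ X, X ≠ 0 → 0 < Q X X)
    (h𝓗 : LieSubalgebra.lieSpan ℝ (GroupLieAlgebra (𝓡 n) G)
      (𝓗 : Set (GroupLieAlgebra (𝓡 n) G)) = ⊤) :
    @LengthProperty G (ccPseudoMetricSpace hQpos h𝓗) := by
  intro x y a b ha hb h
  have hxy : ccDist 𝓗 Q x y < ENNReal.ofReal a + ENNReal.ofReal b := by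
    rw [← ENNReal.ofReal_add ha.le hb.le]
    exact (toReal_ccDist_lt_iff h𝓗).1 h
  obtain ⟨z, hxz, hzy⟩ := exists_ccDist_lt_and_lt (ENNReal.ofReal_pos.2 ha)
    (ENNReal.ofReal_pos.2 hb) hxy
  exact ⟨z, (toReal_ccDist_lt_iff h𝓗).2 hxz, (toReal_ccDist_lt_iff h𝓗).2 hzy⟩

theorem cond3_ccBall_of_cond1 [MeasurableSpace G] [BorelSpace G] {μ : Measure G}
    [μ.IsHaarMeasure] {w : G → ℝ} [IsFiniteMeasureOnCompacts (weightMeasure μ w)] {R : ℝ}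
    (hQpos : ∀ X, X ≠ 0 → 0 < Q X X)
    (h𝓗 : LieSubalgebra.lieSpan ℝ (GroupLieAlgebra (𝓡 n) G)
      (𝓗 : Set (GroupLieAlgebra (𝓡 n) G)) = ⊤) (hw : AEMeasurable w μ)
    (hD : FiveDoubling (ccBall 𝓗 Q) μ w R) (h : Cond1 (ccBall 𝓗 Q) μ w R) :
    Cond3 (ccBall 𝓗 Q) μ w R := by
  have hinv := measure_ccBall_eq (𝓗 := 𝓗) (Q := Q) μ
  have hpos := measure_ccBall_ne_zero (Q := Q) μ h𝓗
  let _ : PseudoMetricSpace G := ccPseudoMetricSpace hQpos h𝓗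
  have : ProperSpace G := properSpace_ccPseudoMetricSpace hQpos h𝓗
  rw [ccBall_eq_ball hQpos h𝓗] at hinv hpos hD h ⊢
  exact cond3_of_cond1 (lengthProperty_ccPseudoMetricSpace hQpos h𝓗) hinv hpos hw hD h

end Balls

end SubRiemannian

theorem proposition6p1_general
    {n : ℕ} {G : Type*} [TopologicalSpace G] [T2Space G] [SecondCountableTopology G]
    [ChartedSpace (EuclideanSpace ℝ (Fin n)) G] [Group G] [LieGroup (𝓡 n) ∞ G]
    [ConnectedSpace G] [MeasurableSpace G] [BorelSpace G] (μ : Measure G) [μ.IsHaarMeasure]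
    (Q : LinearMap.BilinForm ℝ (GroupLieAlgebra (𝓡 n) G)) (hQpos : ∀ X, X ≠ 0 → 0 < Q X X)
    (𝓗 : Submodule ℝ (GroupLieAlgebra (𝓡 n) G))
    (h𝓗 : LieSubalgebra.lieSpan ℝ (GroupLieAlgebra (𝓡 n) G)
      (𝓗 : Set (GroupLieAlgebra (𝓡 n) G)) = ⊤)
    (R : ℝ) (w : G → ℝ) (hw : LocallyIntegrable w μ) (hw_nonneg : ∀ᵐ x ∂μ, 0 ≤ w x) :
    (Cond4 (ccBall 𝓗 Q) μ w R → Cond1 (ccBall 𝓗 Q) μ w R) ∧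
    (Cond3 (ccBall 𝓗 Q) μ w R → Cond2 (ccBall 𝓗 Q) μ w R) ∧
    (Cond2 (ccBall 𝓗 Q) μ w R → Cond1 (ccBall 𝓗 Q) μ w R) ∧
    (Cond3 (ccBall 𝓗 Q) μ w R → Cond4 (ccBall 𝓗 Q) μ w R) ∧
    (FiveDoubling (ccBall 𝓗 Q) μ w R →
      [Cond1 (ccBall 𝓗 Q) μ w R, Cond2 (ccBall 𝓗 Q) μ w R,
        Cond3 (ccBall 𝓗 Q) μ w R, Cond4 (ccBall 𝓗 Q) μ w R].TFAE) := by
  have hmeas (x : G) (r : ℝ) : MeasurableSet (ccBall 𝓗 Q x r) :=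
    (isOpen_ccBall h𝓗 x r).measurableSet
  have hpos := measure_ccBall_ne_zero (Q := Q) μ h𝓗
  have hfin := measure_ccBall_ne_top (𝓗 := 𝓗) μ hQpos
  have := isFiniteMeasureOnCompacts_weightMeasure hw hw_nonneg
  have hwfin := measure_ccBall_ne_top (𝓗 := 𝓗) (weightMeasure μ w) hQpos
  have hwm := hw.aestronglyMeasurable.aemeasurable
  have h41 := cond1_of_cond4 (R := R) hmeas hpos hfin hwfin hwm
  have h24 := cond4_of_cond2 (R := R) hmeas hpos hfin hwfin hwm
  have h32 := cond2_of_cond3 (R := R) hmeas hpos hfin hwfin hwm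
  refine ⟨h41, h32, h41 ∘ h24, h24 ∘ h32, fun hD => ?_⟩
  tfae_have 4 → 1 := h41
  tfae_have 2 → 4 := h24
  tfae_have 3 → 2 := h32
  tfae_have 1 → 3 := cond3_ccBall_of_cond1 hQpos h𝓗 hwm hD
  tfae_finish

theorem proposition6p1
    {n : ℕ} {G : Type*} [TopologicalSpace G] [T2Space G] [SecondCountableTopology G]
    [ChartedSpace (EuclideanSpace ℝ (Fin n)) G] [Group G] [LieGroup (𝓡 n) ∞ G]
    [ConnectedSpace G] [NoncompactSpace G]
    [MeasurableSpace G] [BorelSpace G] (μ : Measure G) [μ.IsHaarMeasure]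
    (Q : LinearMap.BilinForm ℝ (GroupLieAlgebra (𝓡 n) G))
    (hQsymm : ∀ X Y, Q X Y = Q Y X) (hQpos : ∀ X, X ≠ 0 → 0 < Q X X)
    (𝓗 : Submodule ℝ (GroupLieAlgebra (𝓡 n) G))
    (h𝓗 : LieSubalgebra.lieSpan ℝ (GroupLieAlgebra (𝓡 n) G) (𝓗 : Set (GroupLieAlgebra (𝓡 n) G)) = ⊤)
    (R : ℝ) (hR : 0 < R)
    (w : G → ℝ) (hw : LocallyIntegrable w μ) (hw_nonneg : ∀ᵐ x ∂μ, 0 ≤ w x)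
    (hw_ne : ¬ w =ᵐ[μ] 0) :
    (Cond4 (ccBall 𝓗 Q) μ w R → Cond1 (ccBall 𝓗 Q) μ w R) ∧
    (Cond3 (ccBall 𝓗 Q) μ w R → Cond2 (ccBall 𝓗 Q) μ w R) ∧
    (Cond2 (ccBall 𝓗 Q) μ w R → Cond1 (ccBall 𝓗 Q) μ w R) ∧
    (Cond3 (ccBall 𝓗 Q) μ w R → Cond4 (ccBall 𝓗 Q) μ w R) ∧
    (FiveDoubling (ccBall 𝓗 Q) μ w R →
      [Cond1 (ccBall 𝓗 Q) μ w R, Cond2 (ccBall 𝓗 Q) μ w R,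
        Cond3 (ccBall 𝓗 Q) μ w R, Cond4 (ccBall 𝓗 Q) μ w R].TFAE) := by
  exact proposition6p1_general μ Q hQpos 𝓗 h𝓗 R w hw hw_nonneg
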